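/- **Theorem A.** All algebras are unital and associative over $\mathbb{C}$. A quasi-Hopf algebra $(\mathcal G,\Delta,\epsilon,\phi,S,\alpha,\beta)$ is understood in Drinfeld's sense, with invertible antipode $S$: the maps $\Delta:\mathcal G\to\mathcal G\otimes\mathcal G$ and $\epsilon:\mathcal G\to\mathbb C$ are algebra homomorphisms, $\phi=\sum\phi^1\otimes\phi^2\otimes\phi^3\in\mathcal G^{\otimes 3}$ is invertible, $S$ is a bijective linear antimorphism, $\alpha,\beta\in\mathcal G$, and for all $a\in\mathcal G$ $$(\mathrm{id}\otimes\Delta)(\Delta(a))\,\phi=\phi\,(\Delta\otimes\mathrm{id})(\Delta(a)),\qquad (\epsilon\otimes\mathrm{id})\Delta=\mathrm{id}=(\mathrm{id}\otimes\epsilon)\Delta,\qquad(\mathrm{id}\otimes\epsilon\otimes\mathrm{id})(\phi)=1\otimes 1,$$ $$(\mathrm{id}\otimes\mathrm{id}\otimes\Delta)(\phi)(\Delta\otimes\mathrm{id}\otimes\mathrm{id})(\phi)=(1\otimes\phi)(\mathrm{id}\otimes\Delta\otimes\mathrm{id})(\phi)(\phi\otimes 1),$$ $$S(a_{(1)})\alpha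 a_{(2)}=\epsilon(a)\alpha,\quad a_{(1)}\beta S(a_{(2)})=\epsilon(a)\beta,\quad \textstyle\sum X\beta S(Y)\alpha Z=1=\sum S(P)\alpha Q\beta S(R),$$ where $\phi=\sum X\otimes Y\otimes Z$ and $\phi^{-1}=\sum P\otimes Q\otimes R$. An invertible $R\in\mathcal G\otimes\mathcal G$ is *quasitriangular* if for all $a\in\mathcal G$ $$\Delta^{op}(a)R=R\Delta(a),\quad(\Delta\otimes\mathrm{id})(R)=\phi^{312}R^{13}(\phi^{-1})^{132}R^{23}\phi,\quad(\mathrm{id}\otimes\Delta)(R)=(\phi^{-1})^{231}R^{13}\phi^{213}R^{12}\phi^{-1},$$ where $\psi^{n_1n_2\dots}$ has the $k$-th factor of $\psi$ in slot $n_k$ and $1$ in the slots not listed. An *extension* $\mathcal D\supset\mathcal G$ of quasi-Hopf algebras is an injective homomorphism of unital algebras $\mathcal G\to\mathcal D$ that respects $\Delta,\epsilon,\phi,S,\alpha,\beta$; we regard $\mathcal G$ as a subset of $\mathcal D$. Let $\mathcal G$ be a finite-dimensional quasi-Hopf algebra (with invertible antipode), with basis $e_\mu$, let $\hat{\mathcal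 G}$ be the dual space of $\mathcal G$ with dual basis $e^\mu$, and write $\hat\Delta(\varphi)=\varphi_{(1)}\otimes\varphi_{(2)}$ for the coproduct of $\hat{\mathcal G}$ given by $\langle\hat\Delta(\varphi),a\otimes b\rangle=\langle\varphi,ab\rangle$. Consider pairs $(\mathcal D,D)$ of a quasi-Hopf algebra extension $\mathcal D\supset\mathcal G$ and a linear map $D:\hat{\mathcal G}\to\mathcal D$ such that 1. $\mathcal D$ is generated as an algebra by $\mathcal G$ and $D(\hat{\mathcal G})$; 2. $R_D:=\sum_\mu e_\mu\otimes D(e^\mu)\in\mathcal D\otimes\mathcal D$ is quasitriangular. Then there is a finite-dimensional $\mathcal D(\mathcal G)\supset\mathcal G$ with a linear map $D:\hat{\mathcal G}\to\mathcal D(\mathcal G)$ that satisfies 1 and 2 and the following universal property: 3. whenever $(\tilde{\mathcal D},\tilde D)$ also satisfies 1 and 2, there is a quasi-bialgebra homomorphism $f:\mathcal D(\mathcal G)\to\tilde{\mathcal D}$ (an algebra homomorphism respecting coproduct, counit and reassociator) that restricts to the identity on $\mathcal G$ and satisfies $f\circ D=\tilde D$. The extension $\mathcal D(\mathcal G)\supset\mathcal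 G$ is unique up to equivalence: for any two pairs $(\mathcal D_1,D_1)$, $(\mathcal D_2,D_2)$ satisfying 1, 2 and 3 there is an isomorphism of quasi-Hopf algebras $e:\mathcal D_1\to\mathcal D_2$ that is the identity on $\mathcal G$ and satisfies $e\circ D_1=D_2$. Moreover, for every pair $(\mathcal D(\mathcal G),D)$ satisfying 1, 2 and 3, the linear map $$\mu:\hat{\mathcal G}\otimes\mathcal G\to\mathcal D(\mathcal G),\qquad \mu(\varphi\otimes a)=(\mathrm{id}\otimes\varphi_{(1)})(q_\rho)\,D(\varphi_{(2)})\,a,\qquad q_\rho=\sum\phi^1\otimes S^{-1}(\alpha\phi^3)\phi^2\in\mathcal G\otimes\mathcal G,$$ is bijective. -/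

import Mathlib

open scoped TensorProduct

universe u v w

noncomputable section

namespace QuasiHopf

/-! ### Permutations of tensor factors and leg embeddings

Triple and quadruple tensor powers are bracketed to the left:
`A ⊗ A ⊗ A = (A ⊗ A) ⊗ A`. For `ψ = ψ¹ ⊗ ψ² ⊗ ψ³`, the element `ψ^{n₁n₂n₃}` has `ψᵏ` in
slot number `n_k`. -/

section Legs

variable (k : Type u) [Field k] (A : Type v) [Ring A] [Algebra k A]

/-- Rebracketing `A ⊗ (A ⊗ A) → (A ⊗ A) ⊗ A`. -/
def rebracket : A ⊗[k] (A ⊗[k] A) →ₐ[k] A ⊗[k] A ⊗[k] A :=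
  (Algebra.TensorProduct.assoc k k k A A A).symm.toAlgHom

/-- `ψ ↦ ψ^{213}`. -/
def perm213 : A ⊗[k] A ⊗[k] A →ₐ[k] A ⊗[k] A ⊗[k] A :=
  Algebra.TensorProduct.map (Algebra.TensorProduct.comm k A A).toAlgHom (AlgHom.id k A)

/-- `ψ ↦ ψ^{132}`. -/
def perm132 : A ⊗[k] A ⊗[k] A →ₐ[k] A ⊗[k] A ⊗[k] A :=
  ((rebracket k A).comp
    (Algebra.TensorProduct.map (AlgHom.id k A)
      (Algebra.TensorProduct.comm k A A).toAlgHom)).comp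
    (Algebra.TensorProduct.assoc k k k A A A).toAlgHom

/-- `ψ ↦ ψ^{312}`. -/
def perm312 : A ⊗[k] A ⊗[k] A →ₐ[k] A ⊗[k] A ⊗[k] A :=
  (perm132 k A).comp (perm213 k A)

/-- `ψ ↦ ψ^{231}`. -/
def perm231 : A ⊗[k] A ⊗[k] A →ₐ[k] A ⊗[k] A ⊗[k] A :=
  (perm213 k A).comp (perm132 k A)

/-- `R ↦ R^{12} = R ⊗ 1`. -/
def leg12 : A ⊗[k] A →ₐ[k] A ⊗[k] A ⊗[k] A :=
  Algebra.TensorProduct.includeLeft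

/-- `R ↦ R^{13}`. -/
def leg13 : A ⊗[k] A →ₐ[k] A ⊗[k] A ⊗[k] A :=
  Algebra.TensorProduct.map Algebra.TensorProduct.includeLeft (AlgHom.id k A)

/-- `R ↦ R^{23} = 1 ⊗ R`. -/
def leg23 : A ⊗[k] A →ₐ[k] A ⊗[k] A ⊗[k] A :=
  Algebra.TensorProduct.map Algebra.TensorProduct.includeRight (AlgHom.id k A)

/-- `φ ↦ φ ⊗ 1`, the embedding in the first three of four tensor factors. -/
def leg123 : A ⊗[k] A ⊗[k] A →ₐ[k] A ⊗[k] A ⊗[k] A ⊗[k] A :=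
  Algebra.TensorProduct.includeLeft

/-- `φ ↦ 1 ⊗ φ`, the embedding in the last three of four tensor factors. -/
def leg234 : A ⊗[k] A ⊗[k] A →ₐ[k] A ⊗[k] A ⊗[k] A ⊗[k] A :=
  Algebra.TensorProduct.map (leg23 k A) (AlgHom.id k A)

variable {A}

theorem rebracket_tmul (a b c : A) :
    rebracket k A (a ⊗ₜ (b ⊗ₜ c)) = a ⊗ₜ b ⊗ₜ c := rfl

theorem perm213_tmul (a b c : A) :
    perm213 k A (a ⊗ₜ b ⊗ₜ c) = b ⊗ₜ a ⊗ₜ c := rfl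

theorem perm132_tmul (a b c : A) :
    perm132 k A (a ⊗ₜ b ⊗ₜ c) = a ⊗ₜ c ⊗ₜ b := rfl

theorem perm312_tmul (a b c : A) :
    perm312 k A (a ⊗ₜ b ⊗ₜ c) = b ⊗ₜ c ⊗ₜ a := rfl

theorem perm231_tmul (a b c : A) :
    perm231 k A (a ⊗ₜ b ⊗ₜ c) = c ⊗ₜ a ⊗ₜ b := rfl

theorem leg12_tmul (a b : A) : leg12 k A (a ⊗ₜ b) = a ⊗ₜ b ⊗ₜ 1 := rfl

theorem leg13_tmul (a b : A) : leg13 k A (a ⊗ₜ b) = a ⊗ₜ 1 ⊗ₜ b := rfl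

theorem leg23_tmul (a b : A) : leg23 k A (a ⊗ₜ b) = 1 ⊗ₜ a ⊗ₜ b := rfl

theorem leg123_tmul (a b c : A) :
    leg123 k A (a ⊗ₜ b ⊗ₜ c) = a ⊗ₜ b ⊗ₜ c ⊗ₜ 1 := rfl

theorem leg234_tmul (a b c : A) :
    leg234 k A (a ⊗ₜ b ⊗ₜ c) = 1 ⊗ₜ a ⊗ₜ b ⊗ₜ c := rfl

end Legs

/-! ### Coproducts applied in one leg -/

section ComulLegs

variable {k : Type u} [Field k] {A : Type v} [Ring A] [Algebra k A]

/-- `Δ ⊗ id : A ⊗ A → A ⊗ A ⊗ A`. -/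
def comulLeft (Δ : A →ₐ[k] A ⊗[k] A) : A ⊗[k] A →ₐ[k] A ⊗[k] A ⊗[k] A :=
  Algebra.TensorProduct.map Δ (AlgHom.id k A)

/-- `id ⊗ Δ : A ⊗ A → A ⊗ A ⊗ A`. -/
def comulRight (Δ : A →ₐ[k] A ⊗[k] A) : A ⊗[k] A →ₐ[k] A ⊗[k] A ⊗[k] A :=
  (rebracket k A).comp (Algebra.TensorProduct.map (AlgHom.id k A) Δ)

/-- `Δ ⊗ id ⊗ id : A ⊗ A ⊗ A → A ⊗ A ⊗ A ⊗ A`. -/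
def comul₁ (Δ : A →ₐ[k] A ⊗[k] A) : A ⊗[k] A ⊗[k] A →ₐ[k] A ⊗[k] A ⊗[k] A ⊗[k] A :=
  Algebra.TensorProduct.map (comulLeft Δ) (AlgHom.id k A)

/-- `id ⊗ Δ ⊗ id : A ⊗ A ⊗ A → A ⊗ A ⊗ A ⊗ A`. -/
def comul₂ (Δ : A →ₐ[k] A ⊗[k] A) : A ⊗[k] A ⊗[k] A →ₐ[k] A ⊗[k] A ⊗[k] A ⊗[k] A :=
  Algebra.TensorProduct.map (comulRight Δ) (AlgHom.id k A)

/-- `id ⊗ id ⊗ Δ : A ⊗ A ⊗ A → A ⊗ A ⊗ A ⊗ A`. -/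
def comul₃ (Δ : A →ₐ[k] A ⊗[k] A) : A ⊗[k] A ⊗[k] A →ₐ[k] A ⊗[k] A ⊗[k] A ⊗[k] A :=
  (Algebra.TensorProduct.assoc k k k (A ⊗[k] A) A A).symm.toAlgHom.comp
    (Algebra.TensorProduct.map (AlgHom.id k (A ⊗[k] A)) Δ)

end ComulLegs

/-! ### Quasi-bialgebras, quasi-Hopf algebras, R-matrices -/

/-- A quasi-bialgebra structure `(Δ, ε, φ)` on a unital associative algebra `A`. -/
structure QuasiBialgebra (k : Type u) [Field k] (A : Type v) [Ring A] [Algebra k A] where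
  /-- the coproduct `Δ` -/
  comul : A →ₐ[k] A ⊗[k] A
  /-- the counit `ε` -/
  counit : A →ₐ[k] k
  /-- the reassociator `φ`, an invertible element of `A ⊗ A ⊗ A` -/
  reassoc : (A ⊗[k] A ⊗[k] A)ˣ
  /-- `(id ⊗ Δ)(Δ(a)) φ = φ (Δ ⊗ id)(Δ(a))` -/
  quasi_coassoc : ∀ a : A,
    comulRight comul (comul a) * (reassoc : A ⊗[k] A ⊗[k] A) =
      (reassoc : A ⊗[k] A ⊗[k] A) * comulLeft comul (comul a)
  /-- `(id ⊗ id ⊗ Δ)(φ) (Δ ⊗ id ⊗ id)(φ) = (1 ⊗ φ) (id ⊗ Δ ⊗ id)(φ) (φ ⊗ 1)` -/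
  pentagon :
    comul₃ comul (reassoc : A ⊗[k] A ⊗[k] A) * comul₁ comul (reassoc : A ⊗[k] A ⊗[k] A) =
      leg234 k A (reassoc : A ⊗[k] A ⊗[k] A) * comul₂ comul (reassoc : A ⊗[k] A ⊗[k] A) *
        leg123 k A (reassoc : A ⊗[k] A ⊗[k] A)
  /-- `(ε ⊗ id) ∘ Δ = id` -/
  counit_left : ∀ a : A,
    Algebra.TensorProduct.lid k A
      (Algebra.TensorProduct.map counit (AlgHom.id k A) (comul a)) = a
  /-- `(id ⊗ ε) ∘ Δ = id` -/
  counit_right : ∀ a : A,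
    Algebra.TensorProduct.rid k k A
      (Algebra.TensorProduct.map (AlgHom.id k A) counit (comul a)) = a
  /-- `(id ⊗ ε ⊗ id)(φ) = 1 ⊗ 1` -/
  counit_reassoc :
    Algebra.TensorProduct.map
      ((Algebra.TensorProduct.rid k k A).toAlgHom.comp
        (Algebra.TensorProduct.map (AlgHom.id k A) counit))
      (AlgHom.id k A) (reassoc : A ⊗[k] A ⊗[k] A) = 1

/-- A quasi-Hopf algebra structure `(Δ, ε, φ, S, α, β)` with invertible antipode. -/
structure QuasiHopfAlgebra (k : Type u) [Field k] (A : Type v) [Ring A] [Algebra k A]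
    extends QuasiBialgebra k A where
  /-- the antipode `S`, an invertible linear map -/
  antipode : A ≃ₗ[k] A
  /-- the structural element `α` -/
  alpha : A
  /-- the structural element `β` -/
  beta : A
  /-- `S` is an algebra antimorphism (so `S(1) = 1`, as `S` is onto). -/
  antipode_mul : ∀ a b : A, antipode (a * b) = antipode b * antipode a
  /-- `S(a₍₁₎) α a₍₂₎ = ε(a) α` -/
  antipode_alpha : ∀ a : A,
    LinearMap.mul' k A
      (TensorProduct.map (LinearMap.mulRight k alpha ∘ₗ antipode.toLinearMap) LinearMap.id
        (comul a)) = counit a • alpha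
  /-- `a₍₁₎ β S(a₍₂₎) = ε(a) β` -/
  antipode_beta : ∀ a : A,
    LinearMap.mul' k A
      (TensorProduct.map (LinearMap.mulRight k beta) antipode.toLinearMap
        (comul a)) = counit a • beta
  /-- `X β S(Y) α Z = 1` for `φ = X ⊗ Y ⊗ Z` -/
  reassoc_antipode :
    LinearMap.mul' k A
      (TensorProduct.map
        (LinearMap.mul' k A ∘ₗ
          TensorProduct.map (LinearMap.mulRight k beta)
            (LinearMap.mulRight k alpha ∘ₗ antipode.toLinearMap))
        LinearMap.id (reassoc : A ⊗[k] A ⊗[k] A)) = 1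
  /-- `S(P) α Q β S(R) = 1` for `φ⁻¹ = P ⊗ Q ⊗ R` -/
  reassoc_inv_antipode :
    LinearMap.mul' k A
      (TensorProduct.map
        (LinearMap.mul' k A ∘ₗ
          TensorProduct.map (LinearMap.mulRight k alpha ∘ₗ antipode.toLinearMap)
            (LinearMap.mulRight k beta))
        antipode.toLinearMap (reassoc⁻¹ : (A ⊗[k] A ⊗[k] A)ˣ).val) = 1

section Structures

variable {k : Type u} [Field k] {A : Type v} [Ring A] [Algebra k A]

/-- `R ∈ A ⊗ A` is quasitriangular for the quasi-bialgebra `(A, Δ, ε, φ)`. -/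
structure IsQuasitriangular (H : QuasiBialgebra k A) (R : A ⊗[k] A) : Prop where
  isUnit : IsUnit R
  /-- `Δᵒᵖ(a) R = R Δ(a)` -/
  flip : ∀ a : A,
    Algebra.TensorProduct.comm k A A (H.comul a) * R = R * H.comul a
  /-- `(Δ ⊗ id)(R) = φ^{312} R^{13} (φ⁻¹)^{132} R^{23} φ` -/
  hexagon_left :
    comulLeft H.comul R =
      perm312 k A H.reassoc.val * leg13 k A R * perm132 k A (H.reassoc⁻¹).val *
        leg23 k A R * H.reassoc.val
  /-- `(id ⊗ Δ)(R) = (φ⁻¹)^{231} R^{13} φ^{213} R^{12} φ⁻¹` -/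
  hexagon_right :
    comulRight H.comul R =
      perm231 k A (H.reassoc⁻¹).val * leg13 k A R * perm213 k A H.reassoc.val *
        leg12 k A R * (H.reassoc⁻¹).val

variable {B : Type w} [Ring B] [Algebra k B]

/-- Homomorphisms of quasi-bialgebras. -/
structure IsQuasiBialgebraHom (H : QuasiBialgebra k A) (K : QuasiBialgebra k B)
    (f : A →ₐ[k] B) : Prop where
  map_comul : ∀ a : A, K.comul (f a) = Algebra.TensorProduct.map f f (H.comul a)
  map_counit : ∀ a : A, K.counit (f a) = H.counit a
  map_reassoc :
    Algebra.TensorProduct.map (Algebra.TensorProduct.map f f) f H.reassoc.val = K.reassoc.val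

/-- Homomorphisms of quasi-Hopf algebras. -/
structure IsQuasiHopfHom (H : QuasiHopfAlgebra k A) (K : QuasiHopfAlgebra k B)
    (f : A →ₐ[k] B) : Prop
    extends IsQuasiBialgebraHom H.toQuasiBialgebra K.toQuasiBialgebra f where
  map_antipode : ∀ a : A, K.antipode (f a) = f (H.antipode a)
  map_alpha : f H.alpha = K.alpha
  map_beta : f H.beta = K.beta

/-- `q_ρ = φ¹ ⊗ S⁻¹(α φ³) φ² ∈ A ⊗ A`. -/
def QuasiHopfAlgebra.qRho (H : QuasiHopfAlgebra k A) : A ⊗[k] A :=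
  TensorProduct.map LinearMap.id
    (LinearMap.mul' k A ∘ₗ
      TensorProduct.map (H.antipode.symm.toLinearMap ∘ₗ LinearMap.mulLeft k H.alpha)
        LinearMap.id ∘ₗ
      (TensorProduct.comm k A A).toLinearMap)
    (TensorProduct.assoc k A A A H.reassoc.val)

end Structures

/-! ### The dual coalgebra and the quantum double -/

section Double

variable {k : Type u} [Field k] {A : Type v} [Ring A] [Algebra k A] [FiniteDimensional k A]

/-- The coproduct `Δ̂(ψ) = ψ₍₁₎ ⊗ ψ₍₂₎` of the dual space, with
`⟨Δ̂(ψ), a ⊗ b⟩ = ⟨ψ, a b⟩`. -/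
def dualComul : Module.Dual k A →ₗ[k] Module.Dual k A ⊗[k] Module.Dual k A :=
  (TensorProduct.dualDistribEquiv k A A).symm.toLinearMap ∘ₗ (LinearMap.mul' k A).dualMap

theorem dualDistrib_dualComul (ψ : Module.Dual k A) (a b : A) :
    TensorProduct.dualDistrib k A A (dualComul ψ) (a ⊗ₜ b) = ψ (a * b) := by
  have h : TensorProduct.dualDistrib k A A (dualComul ψ) = (LinearMap.mul' k A).dualMap ψ :=
    (TensorProduct.dualDistribEquiv k A A).apply_symm_apply _
  rw [h]
  simp

variable {D : Type w} [Ring D] [Algebra k D]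

/-- `R_D = ∑ i(e_μ) ⊗ δ(e^μ) ∈ D ⊗ D` for a basis `e_μ` of `A` with dual basis `e^μ`. -/
def rMatrix (i : A →ₐ[k] D) (δ : Module.Dual k A →ₗ[k] D) : D ⊗[k] D :=
  ∑ μ, i (Module.finBasis k A μ) ⊗ₜ[k] δ ((Module.finBasis k A).coord μ)

/-- `R_D` does not depend on the choice of the basis. -/
theorem rMatrix_eq_sum {ι : Type*} [Fintype ι] [DecidableEq ι] (b : Module.Basis ι k A)
    (i : A →ₐ[k] D) (δ : Module.Dual k A →ₗ[k] D) :
    rMatrix i δ = ∑ μ, i (b μ) ⊗ₜ[k] δ (b.coord μ) := by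
  have key : ∑ μ, Module.finBasis k A μ ⊗ₜ[k] (Module.finBasis k A).coord μ
      = ∑ μ, b μ ⊗ₜ[k] b.coord μ := by
    apply (TensorProduct.comm k A (Module.Dual k A)).injective
    apply (dualTensorHomEquivOfBasis b).injective
    apply LinearMap.ext
    intro x
    simp [dualTensorHomEquivOfBasis_apply, dualTensorHom_apply, Module.Basis.sum_repr]
  have h := congrArg (TensorProduct.map i.toLinearMap δ) key
  simpa [rMatrix] using h

/-- The linear map `μ : Â ⊗ A → D`, `ψ ⊗ a ↦ i((id ⊗ ψ₍₁₎)(q_ρ)) δ(ψ₍₂₎) i(a)`. -/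
def muMap (H : QuasiHopfAlgebra k A) (i : A →ₐ[k] D) (δ : Module.Dual k A →ₗ[k] D) :
    Module.Dual k A ⊗[k] A →ₗ[k] D :=
  let slice : Module.Dual k A →ₗ[k] A :=
    (TensorProduct.rid k A).toLinearMap ∘ₗ
      LinearMap.applyₗ H.qRho ∘ₗ LinearMap.lTensorHom A
  LinearMap.mul' k D ∘ₗ
    TensorProduct.map
      (LinearMap.mul' k D ∘ₗ TensorProduct.map (i.toLinearMap ∘ₗ slice) δ ∘ₗ dualComul)
      i.toLinearMap

/-- `i : A → D` is a quasi-Hopf algebra extension (an injective homomorphism of quasi-Hopf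
algebras) and `δ : Â → D` is a linear map such that
(i) `D` is generated as an algebra by `i(A)` and `δ(Â)`, and
(ii) `R_D` is quasitriangular. -/
structure IsDoubleExtension (H : QuasiHopfAlgebra k A) (K : QuasiHopfAlgebra k D)
    (i : A →ₐ[k] D) (δ : Module.Dual k A →ₗ[k] D) : Prop where
  isHom : IsQuasiHopfHom H K i
  injective : Function.Injective i
  generates : Algebra.adjoin k (Set.range i ∪ Set.range δ) = ⊤
  quasitriangular : IsQuasitriangular K.toQuasiBialgebra (rMatrix i δ)

/-- `(D, i, δ)` is a quantum double of `A`: it satisfies (i), (ii) above and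
(iii) it is universal among the extensions with these properties. -/
structure IsQuantumDouble {A : Type v} [Ring A] [Algebra k A] [FiniteDimensional k A]
    {D : Type w} [Ring D] [Algebra k D]
    (H : QuasiHopfAlgebra k A) (K : QuasiHopfAlgebra k D)
    (i : A →ₐ[k] D) (δ : Module.Dual k A →ₗ[k] D) : Prop
    extends IsDoubleExtension H K i δ where
  universal : ∀ (E : Type w) [Ring E] [Algebra k E] (L : QuasiHopfAlgebra k E)
    (j : A →ₐ[k] E) (γ : Module.Dual k A →ₗ[k] E), IsDoubleExtension H L j γ →
    ∃ f : D →ₐ[k] E, IsQuasiBialgebraHom K.toQuasiBialgebra L.toQuasiBialgebra f ∧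
      f.comp i = j ∧ f.toLinearMap ∘ₗ δ = γ

end Double

end QuasiHopf

end

open QuasiHopf

/-!
The quantum double is obtained from the Drinfeld centre of the monoidal category `QMod H` of all
`A`-modules, where `A` carries the quasi-Hopf structure `H`.

Let `X` be a module with a half-braiding `c_U : U ⊗ X → X ⊗ U`. By naturality `c` is determined by
its values at `1 ⊗ x` for the regular module `U = A`, that is by a linear map from the dual space
of `A` to `End X` (`dualAct`). In the other direction, an extension `E` of `A` with an element
`∑ e_μ ⊗ γ(e^μ)` of `A ⊗ E` that is quasitriangular in `E ⊗ E` makes the left regular module of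
`E` an object of the centre (`extensionBraiding`): the intertwining property of the R-matrix gives
linearity, the left hexagon gives the tensor axiom, and the invertibility of the R-matrix gives
the unit axiom (`unit_of_isIso`).
So the double has to be the algebra whose modules are the objects of the centre.

The forgetful functor from the centre has a left adjoint because the regular module has a dual:
the free object on `W` has the underlying space `Dual A ⊗ W`, realized as a quotient of
`(A ⊗ W) ⊗ A^∨` by a coend relation (`freeMod`, `freeFamily`). Invertibility of half-braidings is
automatic by duality (`isIso_halfBraiding`). The free object on the regular module, `freeCenter`, has
a generating vector, which can be mapped to every vector of every object of the centre.
`Double H` is the algebra of its endomorphisms generated by `A` and by the operators `dualAct`. Every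
element of it acts on all objects of the centre (`act`), and evaluation at the generating vector
identifies `Double H` with the free object, that is with `Dual A ⊗ A`. This identification is inverse
to `μ` (`muMap_double_bijective`), so that the double is finite-dimensional.

The quasi-Hopf structure is read off from the centre: the coproduct and the counit from
the action on tensor products and on the unit object, the axioms for them from
the associator and the unitors being morphisms of the centre, the R-matrix and its hexagons from the
half-braiding, the antipode from the action on the dual of the free object
(`isDoubleExtension_double`).

For a double extension `E`, the double acts on the object `E` of the centre by left multiplications,
which gives the homomorphism to `E` (`lift`). It respects the coproduct and the counit, because on
the generators `γ(ψ)` these are determined by the right hexagon and by the normalization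
`(id ⊗ ε)(R) = 1` (`IsDoubleExtension.isQuasiBialgebraHom`). Uniqueness follows from the universal
property; an isomorphism respects the antipode because an antipode is determined by `α`, `β`
and the normalization `S(P) α Q β S(R) = 1`, whose ingredients lie in `A` (`antipode_unique`).
-/

noncomputable section

/-! ### Half-braidings in monoidal categories -/

section HalfBraidings

open CategoryTheory MonoidalCategory

namespace QuasiHopf

variable {C : Type u} [Category.{v} C] [MonoidalCategory C]

/-- A half-braiding `c_U : U ⊗ V ⟶ V ⊗ U` on `V`, natural and multiplicative in `U`, whose
components are not required to be invertible. -/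
structure LaxHalfBraiding (V : C) where
  c : ∀ U : C, U ⊗ V ⟶ V ⊗ U
  naturality : ∀ {U U' : C} (f : U ⟶ U'), f ▷ V ≫ c U' = c U ≫ V ◁ f
  tensor : ∀ U U' : C, c (U ⊗ U') =
    (α_ U U' V).hom ≫ U ◁ c U' ≫ (α_ U V U').inv ≫ c U ▷ U' ≫ (α_ V U U').hom
  unit : c (𝟙_ C) = (λ_ V).hom ≫ (ρ_ V).inv

/-- For an invertible half-braiding the unit axiom follows from the other ones. -/
theorem unit_of_isIso {V : C} (c : ∀ U : C, U ⊗ V ⟶ V ⊗ U) [IsIso (c (𝟙_ C))]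
    (naturality : ∀ {U U' : C} (f : U ⟶ U'), f ▷ V ≫ c U' = c U ≫ V ◁ f)
    (tensor : c (𝟙_ C ⊗ 𝟙_ C) = (α_ _ _ V).hom ≫ 𝟙_ C ◁ c (𝟙_ C) ≫ (α_ _ V _).inv ≫
      c (𝟙_ C) ▷ 𝟙_ C ≫ (α_ V _ _).hom) :
    c (𝟙_ C) = (λ_ V).hom ≫ (ρ_ V).inv := by
  have h := naturality (λ_ (𝟙_ C)).hom
  rw [tensor] at h
  have h2 : ((λ_ (𝟙_ C)).hom ▷ V ≫ c (𝟙_ C)) ≫ (ρ_ V).hom ≫ (λ_ V).inv ≫ c (𝟙_ C) =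
      ((λ_ (𝟙_ C)).hom ▷ V ≫ c (𝟙_ C)) ≫ 𝟙 _ := by
    rw [Category.comp_id]
    conv_rhs => rw [h]
    monoidal
  rw [cancel_epi] at h2
  rw [← cancel_epi ((ρ_ V).hom ≫ (λ_ V).inv)]
  simpa using h2

namespace LaxHalfBraiding

/-- The inverse of the component of a half-braiding at an object `U` with right dual `U'`. -/
def dualInv {V : C} (b : LaxHalfBraiding V) (U U' : C) [ExactPairing U U'] : V ⊗ U ⟶ U ⊗ V :=
  (λ_ _).inv ≫ (η_ U U') ▷ (V ⊗ U) ⊗≫ U ◁ b.c U' ▷ U ⊗≫ (U ⊗ V) ◁ (ε_ U U') ≫ (ρ_ _).hom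

theorem c_dualInv {V : C} (b : LaxHalfBraiding V) (U U' : C) [ExactPairing U U'] :
    b.c U ≫ b.dualInv U U' = 𝟙 _ := by
  have h := b.naturality (ε_ U U')
  rw [b.tensor, b.unit] at h
  calc
    _ = 𝟙 _ ⊗≫ (𝟙_ C ◁ b.c U ≫ (η_ U U') ▷ (V ⊗ U)) ⊗≫ U ◁ b.c U' ▷ U ⊗≫
        (U ⊗ V) ◁ (ε_ U U') ⊗≫ 𝟙 _ := by
      dsimp only [dualInv]; monoidal
    _ = 𝟙 _ ⊗≫ (η_ U U') ▷ (U ⊗ V) ⊗≫ U ◁ ((α_ _ _ _).hom ≫ U' ◁ b.c U ≫ (α_ _ _ _).inv ≫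
        b.c U' ▷ U ≫ (α_ _ _ _).hom ≫ V ◁ (ε_ U U')) ⊗≫ 𝟙 _ := by
      rw [whisker_exchange]; monoidal
    _ = 𝟙 _ ⊗≫ (η_ U U') ▷ (U ⊗ V) ⊗≫ U ◁ ((ε_ U U') ▷ V ≫ (λ_ V).hom ≫ (ρ_ V).inv) ⊗≫ 𝟙 _ := by
      rw [h]; simp only [Category.assoc]
    _ = 𝟙 _ ⊗≫ ((η_ U U') ▷ U ⊗≫ U ◁ (ε_ U U')) ▷ V ⊗≫ 𝟙 _ := by monoidal
    _ = _ := by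
      rw [ExactPairing.evaluation_coevaluation'']; monoidal

theorem dualInv_c {V : C} (b : LaxHalfBraiding V) (U U' : C) [ExactPairing U U'] :
    b.dualInv U U' ≫ b.c U = 𝟙 _ := by
  have h := b.naturality (η_ U U')
  rw [b.tensor, b.unit] at h
  calc
    _ = 𝟙 _ ⊗≫ (η_ U U') ▷ (V ⊗ U) ⊗≫ U ◁ b.c U' ▷ U ⊗≫
        ((U ⊗ V) ◁ (ε_ U U') ≫ b.c U ▷ 𝟙_ C) ⊗≫ 𝟙 _ := by
      dsimp only [dualInv]; monoidal
    _ = 𝟙 _ ⊗≫ ((η_ U U') ▷ V ≫ (α_ _ _ _).hom ≫ U ◁ b.c U' ≫ (α_ _ _ _).inv ≫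
        b.c U ▷ U' ≫ (α_ _ _ _).hom) ▷ U ⊗≫ V ◁ (U ◁ (ε_ U U')) ⊗≫ 𝟙 _ := by
      rw [whisker_exchange]; monoidal
    _ = 𝟙 _ ⊗≫ V ◁ ((η_ U U') ▷ U ⊗≫ U ◁ (ε_ U U')) ⊗≫ 𝟙 _ := by
      rw [h]; monoidal
    _ = _ := by
      rw [ExactPairing.evaluation_coevaluation'']; monoidal

theorem isIso_c {V : C} (b : LaxHalfBraiding V) (U U' : C) [ExactPairing U U'] :
    IsIso (b.c U) :=
  ⟨b.dualInv U U', b.c_dualInv U U', b.dualInv_c U U'⟩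

/-- The object of the Drinfeld centre given by an invertible half-braiding. -/
def toCenter {V : C} (b : LaxHalfBraiding V) (h : ∀ U, IsIso (b.c U)) : Center C :=
  ⟨V, { β := fun U => (@asIso _ _ _ _ (b.c U) (h U)).symm
        monoidal := fun U U' => by
          have := h U
          have := h U'
          have := h (U ⊗ U')
          simp only [Iso.symm_hom, asIso_inv]
          rw [IsIso.inv_eq_of_hom_inv_id]
          rw [b.tensor]
          simp
        naturality := fun {U U'} f => by
          have := h U
          have := h U'
          simp only [Iso.symm_hom, asIso_inv]
          rw [IsIso.comp_inv_eq, Category.assoc, IsIso.eq_inv_comp, b.naturality] }⟩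

/-- The half-braiding of an object of the Drinfeld centre. -/
def ofCenter (X : Center C) : LaxHalfBraiding X.1 where
  c U := (X.2.β U).inv
  naturality f := by
    rw [Iso.comp_inv_eq, Category.assoc, X.2.naturality, Iso.inv_hom_id_assoc]
  tensor U U' := by
    rw [← cancel_mono (X.2.β (U ⊗ U')).hom, Iso.inv_hom_id, X.2.monoidal]; simp
  unit := by
    refine unit_of_isIso (fun U => (X.2.β U).inv) (fun f => ?_) ?_
    · rw [Iso.comp_inv_eq, Category.assoc, X.2.naturality, Iso.inv_hom_id_assoc]
    · rw [← cancel_mono (X.2.β (𝟙_ C ⊗ 𝟙_ C)).hom, Iso.inv_hom_id, X.2.monoidal]; simp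

/-- The components of the half-braiding on a left dual `Y` of an object `X` of the centre. -/
def leftDualC (X : Center C) (Y : C) [ExactPairing Y X.1] (U : C) : U ⊗ Y ⟶ Y ⊗ U :=
  (λ_ _).inv ≫ (η_ Y X.1) ▷ (U ⊗ Y) ⊗≫ Y ◁ (X.2.β U).hom ▷ Y ⊗≫ (Y ⊗ U) ◁ (ε_ Y X.1) ≫ (ρ_ _).hom

theorem leftDualC_evaluation (X : Center C) (Y : C) [ExactPairing Y X.1] (U : C) :
    X.1 ◁ leftDualC X Y U ≫ (α_ _ _ _).inv ≫ (ε_ Y X.1) ▷ U =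
      (α_ _ _ _).inv ≫ (X.2.β U).hom ▷ Y ≫ (α_ _ _ _).hom ≫ U ◁ (ε_ Y X.1) ≫
        (ρ_ U).hom ≫ (λ_ U).inv := by
  calc
    _ = 𝟙 _ ⊗≫ X.1 ◁ (η_ Y X.1) ▷ (U ⊗ Y) ⊗≫ (X.1 ⊗ Y) ◁ (X.2.β U).hom ▷ Y ⊗≫
        ((X.1 ⊗ Y) ◁ (U ◁ (ε_ Y X.1)) ≫ (ε_ Y X.1) ▷ (U ⊗ 𝟙_ C)) ⊗≫ 𝟙 _ := by
      dsimp only [leftDualC]; monoidal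
    _ = 𝟙 _ ⊗≫ X.1 ◁ (η_ Y X.1) ▷ (U ⊗ Y) ⊗≫ ((X.1 ⊗ Y) ◁ (X.2.β U).hom ≫
        (ε_ Y X.1) ▷ (U ⊗ X.1)) ▷ Y ⊗≫ U ◁ (ε_ Y X.1) ⊗≫ 𝟙 _ := by
      rw [whisker_exchange]; monoidal
    _ = 𝟙 _ ⊗≫ (X.1 ◁ (η_ Y X.1) ⊗≫ (ε_ Y X.1) ▷ X.1) ▷ (U ⊗ Y) ⊗≫ (X.2.β U).hom ▷ Y ⊗≫
        U ◁ (ε_ Y X.1) ⊗≫ 𝟙 _ := by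
      rw [whisker_exchange]; monoidal
    _ = _ := by rw [ExactPairing.coevaluation_evaluation'']; monoidal

theorem coevaluation_leftDualC (X : Center C) (Y : C) [ExactPairing Y X.1] (U : C) :
    U ◁ (η_ Y X.1) ≫ (α_ _ _ _).inv ≫ leftDualC X Y U ▷ X.1 =
      (ρ_ U).hom ≫ (λ_ U).inv ≫ (η_ Y X.1) ▷ U ≫ (α_ _ _ _).hom ≫ Y ◁ (X.2.β U).hom ≫
        (α_ _ _ _).inv := by
  calc
    _ = 𝟙 _ ⊗≫ (𝟙_ C ◁ (U ◁ (η_ Y X.1)) ≫ (η_ Y X.1) ▷ (U ⊗ (Y ⊗ X.1))) ⊗≫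
        Y ◁ (X.2.β U).hom ▷ (Y ⊗ X.1) ⊗≫ (Y ⊗ U) ◁ (ε_ Y X.1) ▷ X.1 ⊗≫ 𝟙 _ := by
      dsimp only [leftDualC]; monoidal
    _ = 𝟙 _ ⊗≫ (η_ Y X.1) ▷ U ⊗≫ Y ◁ ((X.1 ⊗ U) ◁ (η_ Y X.1) ≫
        (X.2.β U).hom ▷ (Y ⊗ X.1)) ⊗≫ (Y ⊗ U) ◁ (ε_ Y X.1) ▷ X.1 ⊗≫ 𝟙 _ := by
      rw [whisker_exchange]; monoidal
    _ = 𝟙 _ ⊗≫ (η_ Y X.1) ▷ U ⊗≫ Y ◁ (X.2.β U).hom ⊗≫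
        (Y ⊗ U) ◁ (X.1 ◁ (η_ Y X.1) ⊗≫ (ε_ Y X.1) ▷ X.1) ⊗≫ 𝟙 _ := by
      rw [whisker_exchange]; monoidal
    _ = _ := by rw [ExactPairing.coevaluation_evaluation'']; monoidal

/-- The half-braiding on a left dual of an object of the centre. -/
def leftDual (X : Center C) (Y : C) [ExactPairing Y X.1] : LaxHalfBraiding Y where
  c := leftDualC X Y
  naturality {U U'} f := by
    calc
      _ = 𝟙 _ ⊗≫ (𝟙_ C ◁ (f ▷ Y) ≫ (η_ Y X.1) ▷ (U' ⊗ Y)) ⊗≫ Y ◁ (X.2.β U').hom ▷ Y ⊗≫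
          (Y ⊗ U') ◁ (ε_ Y X.1) ⊗≫ 𝟙 _ := by
        dsimp only [leftDualC]; monoidal
      _ = 𝟙 _ ⊗≫ (η_ Y X.1) ▷ (U ⊗ Y) ⊗≫ Y ◁ (X.1 ◁ f ≫ (X.2.β U').hom) ▷ Y ⊗≫
          (Y ⊗ U') ◁ (ε_ Y X.1) ⊗≫ 𝟙 _ := by
        rw [whisker_exchange]; monoidal
      _ = 𝟙 _ ⊗≫ (η_ Y X.1) ▷ (U ⊗ Y) ⊗≫ Y ◁ (X.2.β U).hom ▷ Y ⊗≫
          Y ◁ (f ▷ (X.1 ⊗ Y) ≫ U' ◁ (ε_ Y X.1)) ⊗≫ 𝟙 _ := by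
        rw [X.2.naturality]; monoidal
      _ = _ := by
        rw [← whisker_exchange]; dsimp only [leftDualC]; monoidal
  tensor U U' := by
    symm
    calc
      _ = 𝟙 _ ⊗≫ (𝟙_ C ◁ (U ◁ leftDualC X Y U') ≫ (η_ Y X.1) ▷ (U ⊗ (Y ⊗ U'))) ⊗≫
          Y ◁ (X.2.β U).hom ▷ (Y ⊗ U') ⊗≫ (Y ⊗ U) ◁ (ε_ Y X.1) ▷ U' ⊗≫ 𝟙 _ := by
        conv_lhs => rw [leftDualC.eq_def X Y U]
        monoidal
      _ = 𝟙 _ ⊗≫ (η_ Y X.1) ▷ (U ⊗ (U' ⊗ Y)) ⊗≫ Y ◁ ((X.1 ⊗ U) ◁ leftDualC X Y U' ≫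
          (X.2.β U).hom ▷ (Y ⊗ U')) ⊗≫ (Y ⊗ U) ◁ (ε_ Y X.1) ▷ U' ⊗≫ 𝟙 _ := by
        rw [whisker_exchange]; monoidal
      _ = 𝟙 _ ⊗≫ (η_ Y X.1) ▷ (U ⊗ (U' ⊗ Y)) ⊗≫ Y ◁ (X.2.β U).hom ▷ (U' ⊗ Y) ⊗≫
          (Y ⊗ U) ◁ (X.1 ◁ leftDualC X Y U' ≫ (α_ _ _ _).inv ≫ (ε_ Y X.1) ▷ U') ⊗≫ 𝟙 _ := by
        rw [whisker_exchange]; monoidal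
      _ = _ := by
        rw [leftDualC_evaluation]; dsimp only [leftDualC]; rw [X.2.monoidal]; monoidal
  unit := by
    have h := (ofCenter X).unit
    have h' : (X.2.β (𝟙_ C)).hom = (ρ_ X.1).hom ≫ (λ_ X.1).inv := by
      rw [← cancel_epi (X.2.β (𝟙_ C)).inv, Iso.inv_hom_id]
      change _ = (ofCenter X).c (𝟙_ C) ≫ _
      rw [h]; simp
    calc
      _ = 𝟙 _ ⊗≫ ((η_ Y X.1) ▷ Y ⊗≫ Y ◁ (ε_ Y X.1)) ⊗≫ 𝟙 _ := by
        dsimp only [leftDualC]; rw [h']; monoidal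
      _ = _ := by rw [ExactPairing.evaluation_coevaluation'']; monoidal

end LaxHalfBraiding

/-- The object of the centre on a left dual of an object of the centre. -/
def leftDualCenter (X : Center C) (Y : C) [ExactPairing Y X.1]
    (h : ∀ U, IsIso ((LaxHalfBraiding.leftDual X Y).c U)) : Center C :=
  (LaxHalfBraiding.leftDual X Y).toCenter h

/-- The duality of `Y` and `X` is a duality in the centre. -/
@[reducible]
def leftDualPairing (X : Center C) (Y : C) [ExactPairing Y X.1]
    (h : ∀ U, IsIso ((LaxHalfBraiding.leftDual X Y).c U)) :
    ExactPairing (leftDualCenter X Y h) X where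
  coevaluation' := ⟨η_ Y X.1, fun U => by
    have h1 : IsIso (LaxHalfBraiding.leftDualC X Y U) := h U
    have h2 := LaxHalfBraiding.coevaluation_leftDualC X Y U
    change (η_ Y X.1) ▷ U ≫ (α_ Y X.1 U).hom ≫ Y ◁ (X.2.β U).hom ≫ (α_ Y U X.1).inv ≫
      (inv (LaxHalfBraiding.leftDualC X Y U)) ▷ X.1 ≫ (α_ U Y X.1).hom =
      ((λ_ U).hom ≫ (ρ_ U).inv) ≫ U ◁ (η_ Y X.1)
    rw [← cancel_epi ((ρ_ U).hom ≫ (λ_ U).inv)]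
    have h3 := congrArg (fun t => t ≫ (inv (LaxHalfBraiding.leftDualC X Y U)) ▷ X.1 ≫
      (α_ U Y X.1).hom) h2
    simp only [Category.assoc] at h3
    simp only [Category.assoc]
    rw [← h3]
    simp⟩
  evaluation' := ⟨ε_ Y X.1, fun U => by
    have h1 : IsIso (LaxHalfBraiding.leftDualC X Y U) := h U
    have h2 := LaxHalfBraiding.leftDualC_evaluation X Y U
    change (ε_ Y X.1) ▷ U ≫ ((λ_ U).hom ≫ (ρ_ U).inv) =
      ((α_ X.1 Y U).hom ≫ X.1 ◁ inv (LaxHalfBraiding.leftDualC X Y U) ≫ (α_ X.1 U Y).inv ≫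
        (X.2.β U).hom ▷ Y ≫ (α_ U X.1 Y).hom) ≫ U ◁ (ε_ Y X.1)
    have h3 := congrArg (fun t => (α_ X.1 Y U).hom ≫ X.1 ◁ inv (LaxHalfBraiding.leftDualC X Y U) ≫
      t ≫ (λ_ U).hom ≫ (ρ_ U).inv) h2
    simp only [Category.assoc] at h3 ⊢
    simp at h3
    simp [h3]⟩
  coevaluation_evaluation' := by
    apply Center.ext
    simp only [Center.comp_f, Center.whiskerLeft_f, Center.whiskerRight_f,
      Center.associator_inv_f, Center.leftUnitor_inv_f, Center.rightUnitor_hom_f]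
    exact ExactPairing.coevaluation_evaluation Y X.1
  evaluation_coevaluation' := by
    apply Center.ext
    simp only [Center.comp_f, Center.whiskerLeft_f, Center.whiskerRight_f,
      Center.associator_hom_f, Center.leftUnitor_hom_f, Center.rightUnitor_inv_f]
    exact ExactPairing.evaluation_coevaluation Y X.1

/-- The transpose of a morphism is determined by its compatibility with the evaluations. -/
theorem eq_transpose {X X' Y Y' : C} [ExactPairing Y X] [ExactPairing Y' X'] (f : X ⟶ X')
    (g : Y' ⟶ Y) (h : X ◁ g ≫ ε_ Y X = f ▷ Y' ≫ ε_ Y' X') :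
    g = (λ_ Y').inv ≫ (η_ Y X) ▷ Y' ≫ (α_ _ _ _).hom ≫ Y ◁ (f ▷ Y') ≫ Y ◁ (ε_ Y' X') ≫
      (ρ_ Y).hom := by
  calc
    _ = 𝟙 _ ⊗≫ 𝟙_ C ◁ g ⊗≫ ((η_ Y X) ▷ Y ⊗≫ Y ◁ (ε_ Y X)) ⊗≫ 𝟙 _ := by
      rw [ExactPairing.evaluation_coevaluation'']; monoidal
    _ = 𝟙 _ ⊗≫ (𝟙_ C ◁ g ≫ (η_ Y X) ▷ Y) ⊗≫ Y ◁ (ε_ Y X) ⊗≫ 𝟙 _ := by monoidal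
    _ = 𝟙 _ ⊗≫ (η_ Y X) ▷ Y' ⊗≫ Y ◁ (X ◁ g ≫ (ε_ Y X)) ⊗≫ 𝟙 _ := by
      rw [whisker_exchange]; monoidal
    _ = _ := by rw [h]; monoidal

/-- A duality in the centre is a duality of the underlying objects. -/
@[reducible]
def centerPairing (P X : Center C) [ExactPairing P X] : ExactPairing P.1 X.1 where
  coevaluation' := (η_ P X).f
  evaluation' := (ε_ P X).f
  coevaluation_evaluation' := by
    have h := congrArg Center.Hom.f (ExactPairing.coevaluation_evaluation P X)
    simp only [Center.comp_f, Center.whiskerLeft_f, Center.whiskerRight_f,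
      Center.associator_inv_f, Center.leftUnitor_inv_f, Center.rightUnitor_hom_f] at h
    exact h
  evaluation_coevaluation' := by
    have h := congrArg Center.Hom.f (ExactPairing.evaluation_coevaluation P X)
    simp only [Center.comp_f, Center.whiskerLeft_f, Center.whiskerRight_f,
      Center.associator_hom_f, Center.leftUnitor_hom_f, Center.rightUnitor_inv_f] at h
    exact h

/-- Transposes of morphisms of the centre are morphisms of the centre. -/
theorem exists_center_transpose {X X' P P' : Center C} [ExactPairing P X] [ExactPairing P' X']
    (f : X ⟶ X') (g : P'.1 ⟶ P.1)
    (h : X.1 ◁ g ≫ (ε_ P X).f = f.f ▷ P'.1 ≫ (ε_ P' X').f) :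
    ∃ g' : P' ⟶ P, g'.f = g := by
  let _ := centerPairing P X
  let _ := centerPairing P' X'
  refine ⟨(λ_ P').inv ≫ (η_ P X) ▷ P' ≫ (α_ _ _ _).hom ≫ P ◁ (f ▷ P') ≫ P ◁ (ε_ P' X') ≫
      (ρ_ P).hom, ?_⟩
  rw [eq_transpose f.f g h]
  simp
  rfl

/-- A natural family `u_X : X ⊗ W ⟶ V ⊗ X` through which, for all `Y` and `Z`, every natural family
`Y ⊗ (X ⊗ W) ⟶ Z ⊗ X` factors by a unique `Y ⊗ V ⟶ Z`. -/
structure FreeFamily (W V : C) where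
  u : ∀ X : C, X ⊗ W ⟶ V ⊗ X
  naturality : ∀ {X X' : C} (f : X ⟶ X'), f ▷ W ≫ u X' = u X ≫ V ◁ f
  exists_desc : ∀ {Y Z : C} (h : ∀ X : C, Y ⊗ (X ⊗ W) ⟶ Z ⊗ X),
    (∀ {X X' : C} (f : X ⟶ X'), Y ◁ (f ▷ W) ≫ h X' = h X ≫ Z ◁ f) →
    ∃ h' : Y ⊗ V ⟶ Z, ∀ X, Y ◁ u X ≫ (α_ Y V X).inv ≫ h' ▷ X = h X
  hom_ext : ∀ {Y Z : C} (h h' : Y ⊗ V ⟶ Z),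
    (∀ X, Y ◁ u X ≫ (α_ Y V X).inv ≫ h ▷ X = Y ◁ u X ≫ (α_ Y V X).inv ≫ h' ▷ X) → h = h'

namespace FreeFamily

variable {W V : C} (F : FreeFamily W V)

theorem exists_c (Y : C) : ∃ c : Y ⊗ V ⟶ V ⊗ Y, ∀ X,
    Y ◁ F.u X ≫ (α_ Y V X).inv ≫ c ▷ X =
      (α_ Y X W).inv ≫ F.u (Y ⊗ X) ≫ (α_ V Y X).inv := by
  apply F.exists_desc (fun X => (α_ Y X W).inv ≫ F.u (Y ⊗ X) ≫ (α_ V Y X).inv)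
  intro X X' f
  have := F.naturality (Y ◁ f)
  calc
    _ = (α_ Y X W).inv ≫ ((Y ◁ f) ▷ W ≫ F.u (Y ⊗ X')) ≫ (α_ V Y X').inv := by monoidal
    _ = _ := by rw [this]; monoidal

/-- The components of the half-braiding on the target of a free family. -/
def c (Y : C) : Y ⊗ V ⟶ V ⊗ Y := (F.exists_c Y).choose

theorem c_spec (Y X : C) : Y ◁ F.u X ≫ (α_ Y V X).inv ≫ F.c Y ▷ X =
    (α_ Y X W).inv ≫ F.u (Y ⊗ X) ≫ (α_ V Y X).inv := (F.exists_c Y).choose_spec X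

/-- The half-braiding on the target of a free family. -/
def laxHalfBraiding : LaxHalfBraiding V where
  c := F.c
  naturality {U U'} f := by
    apply F.hom_ext
    intro X
    calc
      _ = (U ◁ F.u X ≫ f ▷ _) ≫ (α_ U' V X).inv ≫ F.c U' ▷ X := by
        monoidal
      _ = f ▷ _ ≫ (U' ◁ F.u X ≫ (α_ U' V X).inv ≫ F.c U' ▷ X) := by
        rw [whisker_exchange]; monoidal
      _ = (α_ U X W).inv ≫ ((f ▷ X) ▷ W ≫ F.u (U' ⊗ X)) ≫ (α_ V U' X).inv := by
        rw [F.c_spec]; monoidal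
      _ = ((α_ U X W).inv ≫ F.u (U ⊗ X) ≫ (α_ V U X).inv) ≫ (V ◁ f) ▷ X := by
        rw [F.naturality]; monoidal
      _ = _ := by rw [← F.c_spec]; monoidal
  tensor U U' := by
    apply F.hom_ext
    intro X
    have hn := F.naturality (α_ U U' X).hom
    rw [F.c_spec]
    symm
    calc
      _ = 𝟙 _ ⊗≫ U ◁ (U' ◁ F.u X ≫ (α_ U' V X).inv ≫ F.c U' ▷ X) ⊗≫ F.c U ▷ U' ▷ X ⊗≫ 𝟙 _ := by
        monoidal
      _ = 𝟙 _ ⊗≫ (U ◁ F.u (U' ⊗ X) ≫ (α_ U V (U' ⊗ X)).inv ≫ F.c U ▷ (U' ⊗ X)) ⊗≫ 𝟙 _ := by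
        rw [F.c_spec]; monoidal
      _ = 𝟙 _ ⊗≫ ((α_ U U' X).hom ▷ W ≫ F.u (U ⊗ (U' ⊗ X))) ⊗≫ 𝟙 _ := by
        rw [F.c_spec]; monoidal
      _ = _ := by rw [hn]; monoidal
  unit := by
    apply F.hom_ext
    intro X
    have hn := F.naturality (λ_ X).hom
    rw [F.c_spec]
    calc
      _ = 𝟙 _ ⊗≫ (F.u (𝟙_ C ⊗ X) ≫ V ◁ (λ_ X).hom) ⊗≫ 𝟙 _ := by monoidal
      _ = _ := by rw [← hn]; monoidal

/-- The universal arrow `W ⟶ V`. -/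
def incl : W ⟶ V := (λ_ W).inv ≫ F.u (𝟙_ C) ≫ (ρ_ V).hom

theorem incl_c (Y : C) : Y ◁ F.incl ≫ F.c Y = F.u Y := by
  have hn := F.naturality (ρ_ Y).hom
  calc
    _ = 𝟙 _ ⊗≫ (Y ◁ F.u (𝟙_ C) ≫ (α_ Y V (𝟙_ C)).inv ≫ F.c Y ▷ 𝟙_ C) ⊗≫ 𝟙 _ := by
      dsimp only [incl]; monoidal
    _ = 𝟙 _ ⊗≫ (F.u (Y ⊗ 𝟙_ C) ≫ V ◁ (ρ_ Y).hom) ⊗≫ 𝟙 _ := by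
      rw [F.c_spec]; monoidal
    _ = _ := by rw [← hn]; monoidal

/-- Freeness: a morphism from `W` to an object with half-braiding extends to `V`, compatibly with
the half-braidings. -/
theorem exists_extension {Z : C} (b : LaxHalfBraiding Z) (i : W ⟶ Z) :
    ∃ f : V ⟶ Z, F.incl ≫ f = i ∧ ∀ U, F.c U ≫ f ▷ U = U ◁ f ≫ b.c U := by
  obtain ⟨h', hh⟩ := F.exists_desc (Y := 𝟙_ C) (Z := Z)
    (fun X => (λ_ (X ⊗ W)).hom ≫ X ◁ i ≫ b.c X) (by
      intro X X' f
      calc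
        _ = (λ_ (X ⊗ W)).hom ≫ (f ▷ W ≫ X' ◁ i) ≫ b.c X' := by monoidal
        _ = (λ_ (X ⊗ W)).hom ≫ X ◁ i ≫ (f ▷ Z ≫ b.c X') := by
          rw [← whisker_exchange]; monoidal
        _ = _ := by rw [b.naturality]; monoidal)
  have key : ∀ X, F.u X ≫ ((λ_ V).inv ≫ h') ▷ X = X ◁ i ≫ b.c X := by
    intro X
    calc
      _ = 𝟙 _ ⊗≫ (𝟙_ C ◁ F.u X ≫ (α_ _ V X).inv ≫ h' ▷ X) ⊗≫ 𝟙 _ := by monoidal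
      _ = _ := by rw [hh]; monoidal
  refine ⟨(λ_ V).inv ≫ h', ?_, ?_⟩
  · have h1 := key (𝟙_ C)
    calc
      _ = 𝟙 _ ⊗≫ (F.u (𝟙_ C) ≫ ((λ_ V).inv ≫ h') ▷ (𝟙_ C)) ⊗≫ 𝟙 _ := by
        dsimp only [incl]; monoidal
      _ = _ := by rw [h1, b.unit]; monoidal
  · intro U
    apply F.hom_ext
    intro X
    calc
      _ = (U ◁ F.u X ≫ (α_ U V X).inv ≫ F.c U ▷ X) ≫ (((λ_ V).inv ≫ h') ▷ U) ▷ X := by monoidal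
      _ = 𝟙 _ ⊗≫ (F.u (U ⊗ X) ≫ ((λ_ V).inv ≫ h') ▷ (U ⊗ X)) ⊗≫ 𝟙 _ := by
        rw [F.c_spec]; monoidal
      _ = 𝟙 _ ⊗≫ U ◁ (X ◁ i ≫ b.c X) ⊗≫ b.c U ▷ X ⊗≫ 𝟙 _ := by
        rw [key, b.tensor]; monoidal
      _ = _ := by rw [← key]; monoidal

end FreeFamily
section OfPairing

variable {g g' W V : C} [ExactPairing g' g] (p : (g ⊗ W) ⊗ g' ⟶ V)

/-- The morphism `g ⊗ W ⟶ V ⊗ g` corresponding to `p : (g ⊗ W) ⊗ g' ⟶ V` under the duality of `g'`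
and `g`. -/
def ofPairing : g ⊗ W ⟶ V ⊗ g :=
  (ρ_ _).inv ≫ (g ⊗ W) ◁ (η_ g' g) ≫ (α_ _ _ _).inv ≫ p ▷ g

theorem ofPairing_evaluation :
    ofPairing p ▷ g' ≫ (α_ _ _ _).hom ≫ V ◁ (ε_ g' g) ≫ (ρ_ V).hom = p := by
  calc
    _ = 𝟙 _ ⊗≫ (g ⊗ W) ◁ (η_ g' g) ▷ g' ⊗≫ (p ▷ (g ⊗ g') ≫ V ◁ (ε_ g' g)) ⊗≫ 𝟙 _ := by
      dsimp only [ofPairing]; monoidal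
    _ = 𝟙 _ ⊗≫ (g ⊗ W) ◁ ((η_ g' g) ▷ g' ⊗≫ g' ◁ (ε_ g' g)) ⊗≫ p ⊗≫ 𝟙 _ := by
      rw [← whisker_exchange]; monoidal
    _ = _ := by rw [ExactPairing.evaluation_coevaluation'']; monoidal

/-- The morphism `Y ⊗ ((g ⊗ W) ⊗ g') ⟶ Z` corresponding to `h : Y ⊗ (g ⊗ W) ⟶ Z ⊗ g`. -/
def toPairing {Y Z : C} (h : Y ⊗ (g ⊗ W) ⟶ Z ⊗ g) : Y ⊗ ((g ⊗ W) ⊗ g') ⟶ Z :=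
  (α_ _ _ _).inv ≫ h ▷ g' ≫ (α_ _ _ _).hom ≫ Z ◁ (ε_ g' g) ≫ (ρ_ Z).hom

theorem ofPairing_desc {Y Z : C} (h : Y ⊗ (g ⊗ W) ⟶ Z ⊗ g) (h' : Y ⊗ V ⟶ Z)
    (hh : Y ◁ p ≫ h' = toPairing h) :
    Y ◁ ofPairing p ≫ (α_ Y V g).inv ≫ h' ▷ g = h := by
  calc
    _ = 𝟙 _ ⊗≫ (Y ⊗ (g ⊗ W)) ◁ (η_ g' g) ⊗≫ (Y ◁ p ≫ h') ▷ g ⊗≫ 𝟙 _ := by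
      dsimp only [ofPairing]; monoidal
    _ = 𝟙 _ ⊗≫ ((Y ⊗ (g ⊗ W)) ◁ (η_ g' g) ≫ h ▷ (g' ⊗ g)) ⊗≫ Z ◁ (ε_ g' g) ▷ g ⊗≫ 𝟙 _ := by
      rw [hh]; dsimp only [toPairing]; monoidal
    _ = 𝟙 _ ⊗≫ h ⊗≫ Z ◁ (g ◁ (η_ g' g) ⊗≫ (ε_ g' g) ▷ g) ⊗≫ 𝟙 _ := by
      rw [whisker_exchange]; monoidal
    _ = _ := by rw [ExactPairing.coevaluation_evaluation'']; monoidal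

theorem whiskerLeft_comp_eq_of_ofPairing {Y Z : C} (h : Y ⊗ (g ⊗ W) ⟶ Z ⊗ g) (h' : Y ⊗ V ⟶ Z)
    (hh : Y ◁ ofPairing p ≫ (α_ Y V g).inv ≫ h' ▷ g = h) :
    Y ◁ p ≫ h' = toPairing h := by
  rw [← hh]
  dsimp only [toPairing]
  conv_lhs => rw [← ofPairing_evaluation p]
  calc
    _ = 𝟙 _ ⊗≫ Y ◁ ofPairing p ▷ g' ⊗≫ ((Y ⊗ V) ◁ (ε_ g' g) ≫ h' ▷ (𝟙_ C)) ⊗≫ 𝟙 _ := by monoidal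
    _ = _ := by rw [whisker_exchange]; monoidal

theorem ofPairing_of_evaluation (h : g ⊗ W ⟶ V ⊗ g) :
    ofPairing (h ▷ g' ≫ (α_ _ _ _).hom ≫ V ◁ (ε_ g' g) ≫ (ρ_ V).hom) = h := by
  calc
    _ = 𝟙 _ ⊗≫ ((g ⊗ W) ◁ (η_ g' g) ≫ h ▷ (g' ⊗ g)) ⊗≫ V ◁ (ε_ g' g) ▷ g ⊗≫ 𝟙 _ := by
      dsimp only [ofPairing]; monoidal
    _ = 𝟙 _ ⊗≫ h ⊗≫ V ◁ (g ◁ (η_ g' g) ⊗≫ (ε_ g' g) ▷ g) ⊗≫ 𝟙 _ := by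
      rw [whisker_exchange]; monoidal
    _ = _ := by rw [ExactPairing.coevaluation_evaluation'']; monoidal

/-- `ofPairing` is natural for an endomorphism `r` of `g` with transpose `r'`. -/
theorem ofPairing_naturality (r : g ⟶ g) (r' : g' ⟶ g') (hr : r ▷ g' ≫ ε_ g' g = g ◁ r' ≫ ε_ g' g)
    (hp : (r ▷ W) ▷ g' ≫ p = (g ⊗ W) ◁ r' ≫ p) :
    r ▷ W ≫ ofPairing p = ofPairing p ≫ V ◁ r := by
  rw [← ofPairing_of_evaluation (g' := g') (r ▷ W ≫ ofPairing p),
    ← ofPairing_of_evaluation (g' := g') (ofPairing p ≫ V ◁ r)]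
  congr 1
  calc
    _ = (r ▷ W) ▷ g' ≫ ofPairing p ▷ g' ≫ (α_ _ _ _).hom ≫ V ◁ (ε_ g' g) ≫ (ρ_ V).hom := by
      monoidal
    _ = (g ⊗ W) ◁ r' ≫ ofPairing p ▷ g' ≫ (α_ _ _ _).hom ≫ V ◁ (ε_ g' g) ≫ (ρ_ V).hom := by
      rw [ofPairing_evaluation, hp]
    _ = ofPairing p ▷ g' ≫ (α_ _ _ _).hom ≫ V ◁ (g ◁ r' ≫ ε_ g' g) ≫ (ρ_ V).hom := by
      rw [whisker_exchange_assoc]; monoidal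
    _ = _ := by rw [← hr]; monoidal

theorem toPairing_dinatural {Y Z : C} (h : Y ⊗ (g ⊗ W) ⟶ Z ⊗ g) (r : g ⟶ g) (r' : g' ⟶ g')
    (hr : r ▷ g' ≫ ε_ g' g = g ◁ r' ≫ ε_ g' g) (hh : Y ◁ (r ▷ W) ≫ h = h ≫ Z ◁ r) :
    Y ◁ ((r ▷ W) ▷ g') ≫ toPairing h = Y ◁ ((g ⊗ W) ◁ r') ≫ toPairing h := by
  calc
    _ = 𝟙 _ ⊗≫ (Y ◁ (r ▷ W) ≫ h) ▷ g' ⊗≫ Z ◁ (ε_ g' g) ⊗≫ 𝟙 _ := by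
      dsimp only [toPairing]; monoidal
    _ = 𝟙 _ ⊗≫ h ▷ g' ⊗≫ Z ◁ (r ▷ g' ≫ ε_ g' g) ⊗≫ 𝟙 _ := by
      rw [hh]; monoidal
    _ = 𝟙 _ ⊗≫ (h ▷ g' ≫ (Z ⊗ g) ◁ r') ⊗≫ Z ◁ ε_ g' g ⊗≫ 𝟙 _ := by
      rw [hr]; monoidal
    _ = _ := by
      rw [← whisker_exchange]; dsimp only [toPairing]; monoidal

end OfPairing

end QuasiHopf
end HalfBraidings

/-! ### Actions of tensor products of algebras -/

section Actions

open TensorProduct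

namespace QuasiHopf

variable {k : Type*} [Field k] {A B A' B' : Type*} [Ring A] [Algebra k A] [Ring B] [Algebra k B]
  [Ring A'] [Algebra k A'] [Ring B'] [Algebra k B']
  {M N P Q M' N' : Type*} [AddCommGroup M] [Module k M] [AddCommGroup N] [Module k N]
  [AddCommGroup P] [Module k P] [AddCommGroup Q] [Module k Q]
  [AddCommGroup M'] [Module k M'] [AddCommGroup N'] [Module k N']

/-- The action of `A ⊗ B` on `M ⊗ N` given by actions of `A` on `M` and of `B` on `N`. -/
def tensorAction (ρ : A →ₐ[k] Module.End k M) (σ : B →ₐ[k] Module.End k N) :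
    A ⊗[k] B →ₐ[k] Module.End k (M ⊗[k] N) :=
  (Module.endTensorEndAlgHom (R := k) (S := k) (A := k) (M := M) (N := N)).comp
    (Algebra.TensorProduct.map ρ σ)

@[simp]
theorem tensorAction_tmul (ρ : A →ₐ[k] Module.End k M) (σ : B →ₐ[k] Module.End k N) (a : A) (b : B) :
    tensorAction ρ σ (a ⊗ₜ b) = TensorProduct.map (ρ a) (σ b) := by
  simp [tensorAction, Module.endTensorEndAlgHom_apply]
  rfl

theorem tensorAction_comp (ρ : A →ₐ[k] Module.End k M) (σ : B →ₐ[k] Module.End k N)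
    (f : A' →ₐ[k] A) (g : B' →ₐ[k] B) :
    tensorAction (ρ.comp f) (σ.comp g) = (tensorAction ρ σ).comp (Algebra.TensorProduct.map f g) := by
  ext <;> simp

theorem map_comp_tensorAction {ρ : A →ₐ[k] Module.End k M} {σ : B →ₐ[k] Module.End k N}
    {ρ' : A →ₐ[k] Module.End k M'} {σ' : B →ₐ[k] Module.End k N'} {f : M →ₗ[k] M'} {g : N →ₗ[k] N'}
    (hf : ∀ a, f ∘ₗ ρ a = ρ' a ∘ₗ f) (hg : ∀ b, g ∘ₗ σ b = σ' b ∘ₗ g) (t : A ⊗[k] B) :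
    TensorProduct.map f g ∘ₗ tensorAction ρ σ t = tensorAction ρ' σ' t ∘ₗ TensorProduct.map f g := by
  induction t with
  | zero => simp
  | add x y hx hy => simp only [map_add, LinearMap.comp_add, LinearMap.add_comp, hx, hy]
  | tmul a b => simp only [tensorAction_tmul, ← TensorProduct.map_comp, hf, hg]

theorem assoc_comp_tensorAction {C : Type*} [Ring C] [Algebra k C]
    (ρ : A →ₐ[k] Module.End k M) (σ : B →ₐ[k] Module.End k N)
    (τ : C →ₐ[k] Module.End k P) (t : A ⊗[k] B ⊗[k] C) (x : M ⊗[k] N ⊗[k] P) :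
    TensorProduct.assoc k M N P (tensorAction (tensorAction ρ σ) τ t x) =
      tensorAction ρ (tensorAction σ τ) (Algebra.TensorProduct.assoc k k k A B C t)
        (TensorProduct.assoc k M N P x) := by
  induction t with
  | zero => simp
  | add x y hx hy => simp only [map_add, LinearMap.add_apply, hx, hy]
  | tmul t c =>
    induction t with
    | zero => simp
    | add x y hx hy => simp only [map_add, LinearMap.add_apply, add_tmul, hx, hy]
    | tmul a b =>
      induction x with
      | zero => simp
      | add x y hx hy => simp only [map_add, hx, hy]
      | tmul x p =>
        induction x with
        | zero => simp
        | add x y hx hy => simp only [map_add, add_tmul, hx, hy]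
        | tmul m n => simp

end QuasiHopf
end Actions

/-! ### The monoidal category of modules -/

section Modules

open CategoryTheory MonoidalCategory TensorProduct

namespace QuasiHopf

variable {k : Type} [Field k] {A : Type u} [Ring A] [Algebra k A]

/-- Left modules over a quasi-bialgebra `H` on `A`, in the universe of `A`; `H` serves to define
their tensor product. -/
structure QMod (H : QuasiBialgebra k A) where
  carrier : Type u
  [addCommGroup : AddCommGroup carrier]
  [module : Module k carrier]
  ρ : A →ₐ[k] Module.End k carrier

namespace QMod

attribute [instance] QMod.addCommGroup QMod.module

variable {H : QuasiBialgebra k A}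

instance : CoeSort (QMod H) (Type u) := ⟨QMod.carrier⟩

/-- `A`-linear maps. -/
@[ext]
structure Hom (M N : QMod H) where
  lin : M →ₗ[k] N
  comm : ∀ (a : A) (m : M), lin (M.ρ a m) = N.ρ a (lin m)

instance : Category (QMod H) where
  Hom := Hom
  id M := ⟨LinearMap.id, fun _ _ => rfl⟩
  comp f g := ⟨g.lin ∘ₗ f.lin, fun a m => by simp [f.comm, g.comm]⟩

@[ext]
theorem hom_ext {M N : QMod H} {f g : M ⟶ N} (h : ∀ m, f.lin m = g.lin m) : f = g :=
  Hom.ext (LinearMap.ext h)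

@[simp] theorem id_lin (M : QMod H) : Hom.lin (𝟙 M) = LinearMap.id := rfl
@[simp] theorem comp_lin {M N P : QMod H} (f : M ⟶ N) (g : N ⟶ P) :
    (f ≫ g).lin = g.lin ∘ₗ f.lin := rfl

/-- The isomorphism given by a bijective `A`-linear map. -/
def mkIso {M N : QMod H} (e : M ≃ₗ[k] N) (h : ∀ (a : A) (m : M), e (M.ρ a m) = N.ρ a (e m)) :
    M ≅ N where
  hom := ⟨e.toLinearMap, h⟩
  inv := ⟨e.symm.toLinearMap, fun a m => by
    apply e.injective
    simp [h]⟩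
  hom_inv_id := by ext; simp
  inv_hom_id := by ext; simp

theorem comm_lin {M N : QMod H} (f : M ⟶ N) (a : A) : f.lin ∘ₗ M.ρ a = N.ρ a ∘ₗ f.lin :=
  LinearMap.ext (f.comm a)

variable (M N P Q : QMod H)

/-- The action of `A ⊗ A` on `M ⊗ N`. -/
def act₂ : A ⊗[k] A →ₐ[k] Module.End k (M ⊗[k] N) := tensorAction M.ρ N.ρ

/-- The action of `A ⊗ A ⊗ A` on `M ⊗ N ⊗ P`. -/
def act₃ : A ⊗[k] A ⊗[k] A →ₐ[k] Module.End k (M ⊗[k] N ⊗[k] P) := tensorAction (act₂ M N) P.ρ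

/-- The action of `A ⊗ A ⊗ A ⊗ A` on `M ⊗ N ⊗ P ⊗ Q`. -/
def act₄ : A ⊗[k] A ⊗[k] A ⊗[k] A →ₐ[k] Module.End k (M ⊗[k] N ⊗[k] P ⊗[k] Q) :=
  tensorAction (act₃ M N P) Q.ρ

variable {M N P Q}

@[simp] theorem act₂_tmul (a b : A) (m : M) (n : N) :
    act₂ M N (a ⊗ₜ b) (m ⊗ₜ n) = M.ρ a m ⊗ₜ N.ρ b n := by simp [act₂]

@[simp] theorem act₃_tmul (a b c : A) (m : M) (n : N) (p : P) :
    act₃ M N P (a ⊗ₜ b ⊗ₜ c) (m ⊗ₜ n ⊗ₜ p) = M.ρ a m ⊗ₜ N.ρ b n ⊗ₜ P.ρ c p := by simp [act₃]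

theorem act₄_tmul' (t : A ⊗[k] A ⊗[k] A) (c : A) (x : M ⊗[k] N ⊗[k] P) (q : Q) :
    act₄ M N P Q (t ⊗ₜ c) (x ⊗ₜ q) = act₃ M N P t x ⊗ₜ Q.ρ c q := by simp [act₄]

variable (M N P Q)

/-- The tensor product of modules over a quasi-bialgebra. -/
def tensor : QMod H where
  carrier := M ⊗[k] N
  ρ := (act₂ M N).comp H.comul

variable (H) in
/-- The trivial module; it is lifted to the universe of `A`. -/
def unit : QMod H where
  carrier := ULift.{u} k
  ρ := (Algebra.ofId k _).comp H.counit

theorem unit_ρ (a : A) (x : unit H) : (unit H).ρ a x = H.counit a • x := by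
  rfl

theorem act₂_tensor_left (t : A ⊗[k] A) :
    tensorAction ((act₂ M N).comp H.comul) P.ρ t = act₃ M N P (comulLeft H.comul t) := by
  have h := tensorAction_comp (act₂ M N) P.ρ H.comul (AlgHom.id k A)
  rw [AlgHom.comp_id] at h
  rw [h]; rfl

theorem act₃_tensor₁ (t : A ⊗[k] A ⊗[k] A) :
    tensorAction (tensorAction ((act₂ M N).comp H.comul) P.ρ) Q.ρ t =
      act₄ M N P Q (comul₁ H.comul t) := by
  have h2 : tensorAction ((act₂ M N).comp H.comul) P.ρ = (act₃ M N P).comp (comulLeft H.comul) :=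
    AlgHom.ext (act₂_tensor_left M N P)
  have h := tensorAction_comp (act₃ M N P) Q.ρ (comulLeft H.comul) (AlgHom.id k A)
  rw [AlgHom.comp_id] at h
  rw [h2, h]; rfl

theorem assoc_act₃ (t : A ⊗[k] A ⊗[k] A) (x : M ⊗[k] N ⊗[k] P) :
    TensorProduct.assoc k M N P (act₃ M N P t x) =
      tensorAction M.ρ (act₂ N P) (Algebra.TensorProduct.assoc k k k A A A t)
        (TensorProduct.assoc k M N P x) :=
  assoc_comp_tensorAction _ _ _ _ _

theorem act₂_tensor_right (t : A ⊗[k] A) (x : M ⊗[k] N ⊗[k] P) :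
    tensorAction M.ρ ((act₂ N P).comp H.comul) t (TensorProduct.assoc k M N P x) =
      TensorProduct.assoc k M N P (act₃ M N P (comulRight H.comul t) x) := by
  have h := tensorAction_comp M.ρ (act₂ N P) (AlgHom.id k A) H.comul
  rw [AlgHom.comp_id] at h
  rw [h, assoc_act₃]
  simp [comulRight, rebracket]

/-- The linear isomorphism underlying the associativity isomorphism. -/
def reassocEquiv : (M ⊗[k] N ⊗[k] P) ≃ₗ[k] M ⊗[k] (N ⊗[k] P) :=
  LinearEquiv.trans
    { act₃ M N P H.reassoc.val with
      invFun := act₃ M N P (H.reassoc⁻¹).val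
      left_inv := fun x => by
        change (act₃ M N P (H.reassoc⁻¹).val * act₃ M N P H.reassoc.val) x = x
        rw [← map_mul]; simp
      right_inv := fun x => by
        change (act₃ M N P H.reassoc.val * act₃ M N P (H.reassoc⁻¹).val) x = x
        rw [← map_mul]; simp }
    (TensorProduct.assoc k M N P)

theorem reassocEquiv_apply (x : M ⊗[k] N ⊗[k] P) : reassocEquiv M N P x =
    TensorProduct.assoc k M N P (act₃ M N P H.reassoc.val x) := rfl

theorem reassocEquiv_symm_apply (x : M ⊗[k] (N ⊗[k] P)) : (reassocEquiv M N P).symm x =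
    act₃ M N P (H.reassoc⁻¹).val ((TensorProduct.assoc k M N P).symm x) := rfl

/-- The associativity isomorphism, given by the reassociator. -/
def assoc : tensor (tensor M N) P ≅ tensor M (tensor N P) :=
  mkIso (reassocEquiv M N P)
    (by
      intro a (m : M ⊗[k] N ⊗[k] P)
      have h := congrArg (fun t => act₃ M N P t m) (H.quasi_coassoc a)
      simp only [map_mul, Module.End.mul_apply] at h
      change TensorProduct.assoc k M N P (act₃ M N P H.reassoc.val
        (tensorAction ((act₂ M N).comp H.comul) P.ρ (H.comul a) m)) =
        tensorAction M.ρ ((act₂ N P).comp H.comul) (H.comul a)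
          (TensorProduct.assoc k M N P (act₃ M N P H.reassoc.val m))
      rw [act₂_tensor_left, act₂_tensor_right, h])

variable (H) in
/-- The underlying vector space of the trivial module is the base field. -/
def unitEquiv : unit H ≃ₗ[k] k := ULift.moduleEquiv

/-- The linear isomorphism underlying the left unit isomorphism. -/
def lidEquiv : (unit H) ⊗[k] M ≃ₗ[k] M :=
  (TensorProduct.congr (unitEquiv H) (LinearEquiv.refl k M)).trans (TensorProduct.lid k M)

/-- The linear isomorphism underlying the right unit isomorphism. -/
def ridEquiv : M ⊗[k] (unit H) ≃ₗ[k] M :=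
  (TensorProduct.congr (LinearEquiv.refl k M) (unitEquiv H)).trans (TensorProduct.rid k M)

@[simp] theorem lidEquiv_tmul (x : unit H) (m : M) : lidEquiv M (x ⊗ₜ m) = unitEquiv H x • m := by
  simp [lidEquiv]

@[simp] theorem ridEquiv_tmul (x : unit H) (m : M) : ridEquiv M (m ⊗ₜ x) = unitEquiv H x • m := by
  simp [ridEquiv]

theorem lidEquiv_act₂ (t : A ⊗[k] A) (x : (unit H) ⊗[k] M) :
    lidEquiv M (act₂ (unit H) M t x) =
      M.ρ (Algebra.TensorProduct.lid k A
        (Algebra.TensorProduct.map H.counit (AlgHom.id k A) t)) (lidEquiv M x) := by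
  induction t with
  | zero => simp
  | add s t hs ht => simp only [map_add, LinearMap.add_apply, hs, ht]
  | tmul a b =>
    induction x with
    | zero => simp
    | add x y hx hy => simp only [map_add, hx, hy]
    | tmul x m => simp [unit_ρ, smul_smul, mul_comm]

theorem ridEquiv_act₂ (t : A ⊗[k] A) (x : M ⊗[k] (unit H)) :
    ridEquiv M (act₂ M (unit H) t x) =
      M.ρ (Algebra.TensorProduct.rid k k A
        (Algebra.TensorProduct.map (AlgHom.id k A) H.counit t)) (ridEquiv M x) := by
  induction t with
  | zero => simp
  | add s t hs ht => simp only [map_add, LinearMap.add_apply, hs, ht]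
  | tmul a b =>
    induction x with
    | zero => simp
    | add x y hx hy => simp only [map_add, hx, hy]
    | tmul x m => simp [unit_ρ, smul_smul, mul_comm]

/-- The left unit isomorphism. -/
def leftUnitor : tensor (unit H) M ≅ M :=
  mkIso (lidEquiv M) (by
    intro a m
    exact (lidEquiv_act₂ M (H.comul a) m).trans (by rw [H.counit_left]; rfl))

/-- The right unit isomorphism. -/
def rightUnitor : tensor M (unit H) ≅ M :=
  mkIso (ridEquiv M) (by
    intro a m
    exact (ridEquiv_act₂ M (H.comul a) m).trans (by rw [H.counit_right]; rfl))

theorem act₄_leg123 (t : A ⊗[k] A ⊗[k] A) (x : M ⊗[k] N ⊗[k] P ⊗[k] Q) :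
    act₄ M N P Q (leg123 k A t) x = TensorProduct.map (act₃ M N P t) LinearMap.id x := by
  simp [act₄, leg123, Module.End.one_eq_id]

theorem act₃_tensor₂ (t : A ⊗[k] A ⊗[k] A) (x : M ⊗[k] N ⊗[k] P ⊗[k] Q) :
    tensorAction (tensorAction M.ρ ((act₂ N P).comp H.comul)) Q.ρ t
        (TensorProduct.map (TensorProduct.assoc k M N P).toLinearMap LinearMap.id x) =
      TensorProduct.map (TensorProduct.assoc k M N P).toLinearMap LinearMap.id
        (act₄ M N P Q (comul₂ H.comul t) x) := by
  induction t with
  | zero => simp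
  | add s t hs ht => simp only [map_add, LinearMap.add_apply, hs, ht]
  | tmul t a =>
    induction x with
    | zero => simp
    | add x y hx hy => simp only [map_add, hx, hy]
    | tmul x q =>
      have h : comul₂ H.comul (t ⊗ₜ a) = comulRight H.comul t ⊗ₜ a := rfl
      rw [h, act₄_tmul', TensorProduct.map_tmul, TensorProduct.map_tmul, tensorAction_tmul,
        TensorProduct.map_tmul]
      simp only [LinearEquiv.coe_coe, LinearMap.id_apply]
      rw [act₂_tensor_right]

theorem act₃_tensor₃ (t : A ⊗[k] A ⊗[k] A) (x : M ⊗[k] N ⊗[k] P ⊗[k] Q) :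
    tensorAction (act₂ M N) ((act₂ P Q).comp H.comul) t (TensorProduct.assoc k (M ⊗[k] N) P Q x) =
      TensorProduct.assoc k (M ⊗[k] N) P Q (act₄ M N P Q (comul₃ H.comul t) x) := by
  have h := tensorAction_comp (act₂ M N) (act₂ P Q) (AlgHom.id k _) H.comul
  rw [AlgHom.comp_id] at h
  have h2 := assoc_comp_tensorAction (act₂ M N) P.ρ Q.ρ (comul₃ H.comul t) x
  rw [h]
  refine Eq.trans ?_ h2.symm
  simp [comul₃]
  rfl

theorem map_act₃ (t : A ⊗[k] A ⊗[k] A) (x : M ⊗[k] N ⊗[k] P ⊗[k] Q) :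
    TensorProduct.map LinearMap.id (act₃ N P Q t) (TensorProduct.map LinearMap.id
      (TensorProduct.assoc k N P Q).symm.toLinearMap (TensorProduct.assoc k M N (P ⊗[k] Q)
        (TensorProduct.assoc k (M ⊗[k] N) P Q x))) =
      TensorProduct.map LinearMap.id
      (TensorProduct.assoc k N P Q).symm.toLinearMap (TensorProduct.assoc k M N (P ⊗[k] Q)
        (TensorProduct.assoc k (M ⊗[k] N) P Q (act₄ M N P Q (leg234 k A t) x))) := by
  induction t with
  | zero => simp
  | add s t hs ht => simp only [map_add, LinearMap.add_apply, TensorProduct.map_add_right, hs, ht]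
  | tmul t c =>
  induction t with
  | zero => simp
  | add s t hs ht =>
    simp only [map_add, LinearMap.add_apply, add_tmul, TensorProduct.map_add_right, hs, ht]
  | tmul a b =>
  induction x with
  | zero => simp
  | add x y hx hy => simp only [map_add, hx, hy]
  | tmul x q =>
  induction x with
  | zero => simp
  | add x y hx hy => simp only [map_add, add_tmul, hx, hy]
  | tmul x p =>
  induction x with
  | zero => simp
  | add x y hx hy => simp only [map_add, add_tmul, hx, hy]
  | tmul m n =>
    rw [leg234_tmul]
    simp [act₄]

theorem assoc_pentagon (M N P Q : Type*) [AddCommGroup M] [Module k M] [AddCommGroup N]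
    [Module k N] [AddCommGroup P] [Module k P] [AddCommGroup Q] [Module k Q]
    (x : M ⊗[k] N ⊗[k] P ⊗[k] Q) :
    TensorProduct.map LinearMap.id (TensorProduct.assoc k N P Q).symm.toLinearMap
      (TensorProduct.assoc k M N (P ⊗[k] Q) (TensorProduct.assoc k (M ⊗[k] N) P Q x)) =
    TensorProduct.assoc k M (N ⊗[k] P) Q
      (TensorProduct.map (TensorProduct.assoc k M N P).toLinearMap LinearMap.id x) := by
  induction x with
  | zero => simp
  | add x y hx hy => simp only [map_add, hx, hy]
  | tmul x q =>
  induction x with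
  | zero => simp
  | add x y hx hy => simp only [map_add, add_tmul, hx, hy]
  | tmul x p =>
  induction x with
  | zero => simp
  | add x y hx hy => simp only [map_add, add_tmul, hx, hy]
  | tmul m n => simp

theorem reassocEquiv_pentagon (x : M ⊗[k] N ⊗[k] P ⊗[k] Q) :
    TensorProduct.map LinearMap.id (reassocEquiv N P Q).toLinearMap
      (TensorProduct.assoc k M (N ⊗[k] P) Q
        (tensorAction (tensorAction M.ρ ((act₂ N P).comp H.comul)) Q.ρ H.reassoc.val
          (TensorProduct.map (reassocEquiv M N P).toLinearMap LinearMap.id x))) =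
    TensorProduct.assoc k M N (P ⊗[k] Q) (tensorAction (act₂ M N) ((act₂ P Q).comp H.comul)
      H.reassoc.val (TensorProduct.assoc k (M ⊗[k] N) P Q
        (tensorAction (tensorAction ((act₂ M N).comp H.comul) P.ρ) Q.ρ H.reassoc.val x))) := by
  have h1 : TensorProduct.map (reassocEquiv M N P).toLinearMap LinearMap.id x =
      TensorProduct.map (TensorProduct.assoc k M N P).toLinearMap LinearMap.id
        (act₄ M N P Q (leg123 k A H.reassoc.val) x) := by
    rw [act₄_leg123, ← LinearMap.comp_apply, ← TensorProduct.map_comp, LinearMap.id_comp]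
    rfl
  have h2 : ∀ y : M ⊗[k] (N ⊗[k] P ⊗[k] Q),
      TensorProduct.map LinearMap.id (reassocEquiv N P Q).toLinearMap y =
      TensorProduct.map LinearMap.id (TensorProduct.assoc k N P Q).toLinearMap
      (TensorProduct.map LinearMap.id (act₃ N P Q H.reassoc.val) y) := by
    intro y
    rw [← LinearMap.comp_apply, ← TensorProduct.map_comp, LinearMap.id_comp]
    rfl
  have hp := congrArg (fun t => act₄ M N P Q t x) H.pentagon
  simp only [map_mul, Module.End.mul_apply] at hp
  rw [h1, h2, act₃_tensor₂, act₃_tensor₁, act₃_tensor₃, hp, ← assoc_pentagon, map_act₃,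
    ← LinearMap.comp_apply, ← TensorProduct.map_comp]
  simp

theorem reassocEquiv_triangle (x : M ⊗[k] unit H ⊗[k] N) :
    TensorProduct.map LinearMap.id (lidEquiv N).toLinearMap (reassocEquiv M (unit H) N x) =
      TensorProduct.map (ridEquiv M).toLinearMap LinearMap.id x := by
  have h : ∀ t : A ⊗[k] A ⊗[k] A,
      TensorProduct.map LinearMap.id (lidEquiv N).toLinearMap
        (TensorProduct.assoc k M (unit H) N (act₃ M (unit H) N t x)) =
      act₂ M N (Algebra.TensorProduct.map
      ((Algebra.TensorProduct.rid k k A).toAlgHom.comp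
        (Algebra.TensorProduct.map (AlgHom.id k A) H.counit))
      (AlgHom.id k A) t) (TensorProduct.map (ridEquiv M).toLinearMap LinearMap.id x) := by
    intro t
    induction t with
    | zero => simp
    | add s t hs ht => simp only [map_add, LinearMap.add_apply, hs, ht]
    | tmul t c =>
    induction t with
    | zero => simp
    | add s t hs ht => simp only [map_add, LinearMap.add_apply, add_tmul, hs, ht]
    | tmul a b =>
    induction x with
    | zero => simp
    | add x y hx hy => simp only [map_add, hx, hy]
    | tmul x n =>
    induction x with
    | zero => simp
    | add x y hx hy => simp only [map_add, add_tmul, hx, hy]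
    | tmul m x => simp [unit_ρ, smul_tmul', smul_smul, mul_comm]
  rw [reassocEquiv_apply, h, H.counit_reassoc]
  simp

variable {M N P Q}

/-- The tensor product of `A`-linear maps. -/
def tensorMap {M N M' N' : QMod H} (f : M ⟶ M') (g : N ⟶ N') : tensor M N ⟶ tensor M' N' :=
  ⟨TensorProduct.map f.lin g.lin, fun a m =>
    LinearMap.congr_fun (map_comp_tensorAction (comm_lin f) (comm_lin g) (H.comul a)) m⟩

theorem tensor_ext {M N P : QMod H} {f g : tensor M N ⟶ P}
    (h : ∀ (m : M) (n : N), f.lin (m ⊗ₜ n) = g.lin (m ⊗ₜ n)) : f = g :=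
  Hom.ext (TensorProduct.ext' h)

instance : MonoidalCategory (QMod H) where
  tensorObj := tensor
  whiskerLeft M _ _ f := tensorMap (𝟙 M) f
  whiskerRight f N := tensorMap f (𝟙 N)
  tensorHom f g := tensorMap f g
  tensorUnit := unit H
  associator := assoc
  leftUnitor := leftUnitor
  rightUnitor := rightUnitor
  tensorHom_def f g := tensor_ext fun m n => rfl
  id_tensorHom_id M N := tensor_ext fun m n => rfl
  tensorHom_comp_tensorHom f g h i := tensor_ext fun m n => rfl
  whiskerLeft_id M N := tensor_ext fun m n => rfl
  id_whiskerRight M N := tensor_ext fun m n => rfl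
  associator_naturality {M₁ N₁ P₁ M₂ N₂ P₂} f g h := hom_ext fun (m : M₁ ⊗[k] N₁ ⊗[k] P₁) => by
    have h1 := LinearMap.congr_fun (map_comp_tensorAction
      (fun t => map_comp_tensorAction (comm_lin f) (comm_lin g) t) (comm_lin h) H.reassoc.val) m
    change TensorProduct.assoc k M₂ N₂ P₂ (act₃ M₂ N₂ P₂ H.reassoc.val
      (TensorProduct.map (TensorProduct.map f.lin g.lin) h.lin m)) =
      TensorProduct.map f.lin (TensorProduct.map g.lin h.lin)
        (TensorProduct.assoc k M₁ N₁ P₁ (act₃ M₁ N₁ P₁ H.reassoc.val m))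
    refine (congrArg (TensorProduct.assoc k M₂ N₂ P₂) h1.symm).trans ?_
    exact (LinearMap.congr_fun (TensorProduct.map_map_comp_assoc_eq f.lin g.lin h.lin) _).symm
  leftUnitor_naturality f := tensor_ext fun x n => by
    change lidEquiv _ (x ⊗ₜ f.lin n) = f.lin (lidEquiv _ (x ⊗ₜ n))
    simp
  rightUnitor_naturality f := tensor_ext fun m x => by
    change ridEquiv _ (f.lin m ⊗ₜ x) = f.lin (ridEquiv _ (m ⊗ₜ x))
    simp
  pentagon M N P Q := hom_ext fun (m : M ⊗[k] N ⊗[k] P ⊗[k] Q) => by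
    exact reassocEquiv_pentagon M N P Q m
  triangle M N := hom_ext fun (m : M ⊗[k] unit H ⊗[k] N) => by
    exact reassocEquiv_triangle M N m

end QMod
end QuasiHopf
end Modules

/-! ### Duals of modules and invertibility of half-braidings -/

section Duals

open CategoryTheory MonoidalCategory TensorProduct

namespace QuasiHopf

variable {k : Type} [Field k] {A : Type u} [Ring A] [Algebra k A]

namespace QMod

section Evaluate

variable {H : QuasiBialgebra k A} {M N P M' N' : QMod H}

theorem whiskerRight_lin_tmul (f : M ⟶ M') (m : M) (n : N) :
    (f ▷ N).lin (m ⊗ₜ n) = f.lin m ⊗ₜ n := rfl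

theorem isIso_of_bijective (f : M ⟶ N) (h : Function.Bijective f.lin) : IsIso f := by
  have : f = (mkIso (LinearEquiv.ofBijective f.lin h) f.comm).hom := rfl
  rw [this]; infer_instance

theorem hom_inv_lin (f : M ⟶ N) [IsIso f] (m : M) : (inv f).lin (f.lin m) = m :=
  LinearMap.congr_fun (congrArg Hom.lin (IsIso.hom_inv_id f)) m

theorem inv_hom_lin (f : M ⟶ N) [IsIso f] (n : N) : f.lin ((inv f).lin n) = n :=
  LinearMap.congr_fun (congrArg Hom.lin (IsIso.inv_hom_id f)) n

/-- An algebra `B` with a homomorphism `A → B` as an `A`-module, by left multiplication. -/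
def ofAlgHom (H : QuasiBialgebra k A) {B : Type u} [Ring B] [Algebra k B] (j : A →ₐ[k] B) :
    QMod H where
  carrier := B
  ρ := (Algebra.lmul k B).comp j

/-- The identity map from an algebra to its underlying module. -/
def toMod (H : QuasiBialgebra k A) {B : Type u} [Ring B] [Algebra k B] (j : A →ₐ[k] B) :
    B ≃ₗ[k] ofAlgHom H j := LinearEquiv.refl k B

/-- The left regular module. -/
abbrev regular (H : QuasiBialgebra k A) : QMod H := ofAlgHom H (AlgHom.id k A)

/-- The identity map from the algebra to its left regular module. -/
abbrev reg (H : QuasiBialgebra k A) : A ≃ₗ[k] regular H := toMod H (AlgHom.id k A)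

theorem regular_ρ (a b : A) : (regular H).ρ a (reg H b) = reg H (a * b) := rfl

theorem regular_ρ_one (a : A) : (regular H).ρ a (reg H 1) = reg H a := by
  rw [regular_ρ, mul_one]

/-- The `A`-linear map `a ↦ a • x` from the regular module. -/
def orbit (x : M) : regular H ⟶ M :=
  ⟨M.ρ.toLinearMap.flip x ∘ₗ (reg H).symm.toLinearMap, fun a b => by
    obtain ⟨b, rfl⟩ := (reg H).surjective b
    rw [regular_ρ]
    simp⟩

theorem orbit_lin (x : M) (a : A) : (orbit x).lin (reg H a) = M.ρ a x := rfl

theorem orbit_one (x : M) : (orbit x).lin (reg H 1) = x := by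
  rw [orbit_lin]; simp

theorem regular_hom_ext {f g : regular H ⟶ M} (h : f.lin (reg H 1) = g.lin (reg H 1)) : f = g := by
  apply hom_ext
  intro b
  obtain ⟨b, rfl⟩ := (reg H).surjective b
  rw [← regular_ρ_one, f.comm, g.comm, h]

theorem orbit_ρ (a : A) (x : M) : orbit (M.ρ a x) = orbit (reg H a) ≫ orbit x := by
  apply regular_hom_ext
  rw [orbit_one, comp_lin, LinearMap.comp_apply, orbit_one, orbit_lin]

/-- The components of a half-braiding as linear maps. -/
def halfBraidingLin {V : QMod H} (b : LaxHalfBraiding V) (U : QMod H) :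
    U ⊗[k] V →ₗ[k] V ⊗[k] U := (b.c U).lin

theorem halfBraidingLin_nat {V : QMod H} (b : LaxHalfBraiding V) {U U' : QMod H} (f : U ⟶ U')
    (x : U ⊗[k] V) :
    halfBraidingLin b U' (TensorProduct.map f.lin LinearMap.id x) =
      TensorProduct.map LinearMap.id f.lin (halfBraidingLin b U x) :=
  LinearMap.congr_fun (congrArg Hom.lin (b.naturality f)) x

theorem halfBraidingLin_tmul {V : QMod H} (b : LaxHalfBraiding V) {U : QMod H} (x : U) (v : V) :
    halfBraidingLin b U (x ⊗ₜ v) = TensorProduct.map LinearMap.id (orbit x).lin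
      (halfBraidingLin b (regular H) (reg H 1 ⊗ₜ v)) := by
  rw [← halfBraidingLin_nat, TensorProduct.map_tmul, orbit_one]
  rfl

theorem orbit_comp (x : M) (f : M ⟶ N) : orbit x ≫ f = orbit (f.lin x) := by
  apply regular_hom_ext
  rw [orbit_one, comp_lin, LinearMap.comp_apply, orbit_one]

end Evaluate

section Dual

variable {H : QuasiBialgebra k A}

/-- The dual space of a module, as a module along an antihomomorphism `s`. -/
def dualAlong (X : QMod H) (s : A →ₐ[k] Aᵐᵒᵖ) : QMod H where
  carrier := Module.Dual k X
  ρ :=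
    { toFun := fun a => (X.ρ (s a).unop).dualMap
      map_one' := by ext; simp
      map_mul' := fun a b => by ext; simp
      map_zero' := by ext; simp
      map_add' := fun a b => by ext; simp
      commutes' := fun c => by ext; simp [Algebra.algebraMap_eq_smul_one] }

/-- The identification of the dual module with the dual space. -/
def toDual (X : QMod H) (s : A →ₐ[k] Aᵐᵒᵖ) : X.dualAlong s ≃ₗ[k] Module.Dual k X :=
  LinearEquiv.refl k _

theorem toDual_ρ (X : QMod H) (s : A →ₐ[k] Aᵐᵒᵖ) (a : A) (f : X.dualAlong s) (x : X) :
    toDual X s ((X.dualAlong s).ρ a f) x = toDual X s f (X.ρ (s a).unop x) := rfl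

end Dual

end QMod

namespace QuasiHopfAlgebra

variable (H : QuasiHopfAlgebra k A)

theorem antipode_one : H.antipode 1 = 1 := by
  have h := H.antipode_mul (H.antipode.symm 1) 1
  rw [mul_one, LinearEquiv.apply_symm_apply, mul_one] at h
  exact h.symm

theorem antipode_symm_mul (a b : A) :
    H.antipode.symm (a * b) = H.antipode.symm b * H.antipode.symm a := by
  rw [LinearEquiv.symm_apply_eq, H.antipode_mul]; simp

/-- The antipode as a homomorphism to the opposite algebra. -/
def antipodeOp : A →ₐ[k] Aᵐᵒᵖ :=
  AlgHom.ofLinearMap ((MulOpposite.opLinearEquiv k).toLinearMap ∘ₗ H.antipode.toLinearMap)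
    (by simp [H.antipode_one]) (fun a b => by simp [H.antipode_mul])

/-- The inverse antipode as a homomorphism to the opposite algebra. -/
def antipodeSymmOp : A →ₐ[k] Aᵐᵒᵖ :=
  AlgHom.ofLinearMap ((MulOpposite.opLinearEquiv k).toLinearMap ∘ₗ H.antipode.symm.toLinearMap)
    (by
      have : H.antipode.symm 1 = 1 := by rw [LinearEquiv.symm_apply_eq, H.antipode_one]
      simp [this]) (fun a b => by simp [H.antipode_symm_mul])

theorem unop_antipodeOp (a : A) : (H.antipodeOp a).unop = H.antipode a := rfl

end QuasiHopfAlgebra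

namespace QMod

variable {H : QuasiHopfAlgebra k A}

/-- The left dual of a module: the dual space with the action `(a f)(x) = f(S⁻¹(a) x)`. -/
abbrev dual (X : QMod H.toQuasiBialgebra) : QMod H.toQuasiBialgebra := X.dualAlong H.antipodeSymmOp

variable (X : QMod H.toQuasiBialgebra)

/-- The pairing of the left dual with the module. -/
abbrev pair : X.dual ≃ₗ[k] Module.Dual k X := toDual X H.antipodeSymmOp

theorem pair_ρ (a : A) (f : X.dual) (x : X) :
    pair X (X.dual.ρ a f) x = pair X f (X.ρ (H.antipode.symm a) x) := rfl

/-- The linear map `x ⊗ f ↦ f(S⁻¹(α) x)`. -/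
def evLin : X ⊗[k] X.dual →ₗ[k] k :=
  TensorProduct.lift (Module.Dual.eval k X) ∘ₗ
    TensorProduct.map (X.ρ (H.antipode.symm H.alpha)) (pair X).toLinearMap

theorem evLin_tmul (x : X) (f : X.dual) :
    evLin X (x ⊗ₜ[k] f) = pair X f (X.ρ (H.antipode.symm H.alpha) x) := by simp [evLin]

theorem evLin_act₂ (t : A ⊗[k] A) (x : X) (f : X.dual) :
    evLin X (act₂ X X.dual t (x ⊗ₜ[k] f)) =
      pair X f (X.ρ (H.antipode.symm (LinearMap.mul' k A
      (TensorProduct.map (LinearMap.mulRight k H.alpha ∘ₗ H.antipode.toLinearMap) LinearMap.id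
        t))) x) := by
  induction t with
  | zero => simp
  | add s t hs ht => simp only [map_add, LinearMap.add_apply, hs, ht]
  | tmul a b =>
    rw [act₂_tmul, evLin_tmul, pair_ρ]
    simp [H.antipode_symm_mul]

/-- The linear map `x ⊗ f ↦ f(S⁻¹(α) x)` with values in the trivial module. -/
def evMap : X ⊗[k] X.dual →ₗ[k] unit H.toQuasiBialgebra :=
  (unitEquiv H.toQuasiBialgebra).symm.toLinearMap ∘ₗ evLin X

theorem evMap_tmul (x : X) (f : X.dual) : evMap X (x ⊗ₜ[k] f) =
    (unitEquiv H.toQuasiBialgebra).symm (pair X f (X.ρ (H.antipode.symm H.alpha) x)) := by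
  simp [evMap, evLin_tmul]

/-- The evaluation `x ⊗ f ↦ f(S⁻¹(α) x)`. -/
def ev : X ⊗ X.dual ⟶ 𝟙_ (QMod H.toQuasiBialgebra) :=
  ⟨evMap X, fun a => by
    have : (unitEquiv H.toQuasiBialgebra).symm.toLinearMap ∘ₗ evLin X ∘ₗ
        act₂ X X.dual (H.comul a) = (H.counit a) •
          ((unitEquiv H.toQuasiBialgebra).symm.toLinearMap ∘ₗ evLin X) := by
      apply TensorProduct.ext'
      intro x f
      simp only [LinearMap.comp_apply, LinearMap.smul_apply]
      rw [evLin_act₂, H.antipode_alpha, evLin_tmul]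
      simp only [map_smul, LinearMap.smul_apply]
    exact LinearMap.congr_fun this⟩

variable [FiniteDimensional k X]

/-- The identification of `X^* ⊗ X` with the endomorphisms of `X`. -/
def dualTensorEquiv : X.dual ⊗[k] X ≃ₗ[k] (X →ₗ[k] X) :=
  (TensorProduct.congr (pair X) (LinearEquiv.refl k X)).trans
    (dualTensorHomEquiv k X X)

theorem dualTensorEquiv_tmul (f : X.dual) (x y : X) :
    dualTensorEquiv X (f ⊗ₜ[k] x) y = pair X f y • x := by
  simp [dualTensorEquiv]

theorem dualTensorEquiv_act₂_tmul (a b : A) (w : X.dual ⊗[k] X) :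
    dualTensorEquiv X (act₂ X.dual X (a ⊗ₜ b) w) =
        X.ρ b ∘ₗ dualTensorEquiv X w ∘ₗ X.ρ (H.antipode.symm a) := by
  induction w with
  | zero => simp
  | add x y hx hy => simp only [map_add, LinearMap.add_comp, LinearMap.comp_add, hx, hy]
  | tmul f x =>
    apply LinearMap.ext
    intro y
    rw [act₂_tmul, dualTensorEquiv_tmul, pair_ρ]
    simp only [LinearMap.comp_apply]
    rw [dualTensorEquiv_tmul, map_smul]

/-- The element of `X^* ⊗ X` that corresponds to the action of `S⁻¹(β)`. -/
def coevElt : X.dual ⊗[k] X := (dualTensorEquiv X).symm (X.ρ (H.antipode.symm H.beta))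

theorem act₂_coevElt (a : A) :
    act₂ X.dual X (H.comul a) (coevElt X) = H.counit a • coevElt X := by
  have h : ∀ t : A ⊗[k] A, dualTensorEquiv X (act₂ X.dual X t (coevElt X)) =
      X.ρ (H.antipode.symm (LinearMap.mul' k A
        (TensorProduct.map (LinearMap.mulRight k H.beta) H.antipode.toLinearMap t))) := by
    intro t
    induction t with
    | zero => simp
    | add s t hs ht => simp only [map_add, LinearMap.add_apply, hs, ht]
    | tmul a b =>
      rw [dualTensorEquiv_act₂_tmul, coevElt, LinearEquiv.apply_symm_apply]
      simp [H.antipode_symm_mul, Module.End.mul_eq_comp]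
  apply (dualTensorEquiv X).injective
  rw [h, H.antipode_beta, map_smul, map_smul, map_smul, coevElt, LinearEquiv.apply_symm_apply]

/-- The coevaluation. -/
def coev : 𝟙_ (QMod H.toQuasiBialgebra) ⟶ X.dual ⊗ X :=
  ⟨LinearMap.toSpanSingleton k _ (coevElt X) ∘ₗ (unitEquiv H.toQuasiBialgebra).toLinearMap,
    fun a x => by
      change unitEquiv _ ((unit _).ρ a x) • coevElt X =
        act₂ X.dual X (H.comul a) (unitEquiv _ x • coevElt X)
      rw [map_smul, act₂_coevElt, unit_ρ, map_smul, smul_smul, smul_eq_mul, mul_comm]⟩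

theorem coev_lin (x : unit H.toQuasiBialgebra) :
    (coev X).lin x = unitEquiv H.toQuasiBialgebra x • coevElt X := rfl

/-- One zigzag of the duality of `X` and its dual is the action of an element of `A` which, for the
inverse reassociator, is `1` by the antipode axioms. -/
theorem evLin_coevElt (t : A ⊗[k] A ⊗[k] A) (x : X) :
    lidEquiv X (TensorProduct.map (evMap X) LinearMap.id
      (act₃ X X.dual X t ((TensorProduct.assoc k X X.dual X).symm (x ⊗ₜ coevElt X)))) =
    X.ρ (H.antipode.symm (LinearMap.mul' k A
      (TensorProduct.map
        (LinearMap.mul' k A ∘ₗ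
          TensorProduct.map (LinearMap.mulRight k H.alpha ∘ₗ H.antipode.toLinearMap)
            (LinearMap.mulRight k H.beta))
        H.antipode.toLinearMap t))) x := by
  induction t with
  | zero => simp
  | add s t hs ht => simp only [map_add, LinearMap.add_apply, hs, ht]
  | tmul t c =>
  induction t with
  | zero => simp
  | add s t hs ht => simp only [map_add, LinearMap.add_apply, add_tmul, hs, ht]
  | tmul a b =>
    have h : ∀ w : X.dual ⊗[k] X, lidEquiv X (TensorProduct.map (evMap X) LinearMap.id
      (act₃ X X.dual X (a ⊗ₜ b ⊗ₜ c) ((TensorProduct.assoc k X X.dual X).symm (x ⊗ₜ w)))) =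
      X.ρ c (dualTensorEquiv X w (X.ρ (H.antipode.symm b) (X.ρ (H.antipode.symm H.alpha)
        (X.ρ a x)))) := by
      intro w
      induction w with
      | zero => simp
      | add w w' hx hy => simp only [map_add, tmul_add, LinearMap.add_apply, hx, hy]
      | tmul f y =>
        rw [TensorProduct.assoc_symm_tmul, act₃_tmul, TensorProduct.map_tmul, evMap_tmul,
          lidEquiv_tmul, pair_ρ, dualTensorEquiv_tmul]
        simp
    rw [h, coevElt, LinearEquiv.apply_symm_apply]
    simp [H.antipode_symm_mul]

/-- The other zigzag of the duality, for the reassociator itself. -/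
theorem pair_coevElt (t : A ⊗[k] A ⊗[k] A) (f : X.dual) (x : X) :
    pair X (ridEquiv X.dual (TensorProduct.map LinearMap.id (evMap X)
      (TensorProduct.assoc k X.dual X X.dual (act₃ X.dual X X.dual t (coevElt X ⊗ₜ f))))) x =
    pair X f (X.ρ (H.antipode.symm (LinearMap.mul' k A
      (TensorProduct.map
        (LinearMap.mul' k A ∘ₗ
          TensorProduct.map (LinearMap.mulRight k H.beta)
            (LinearMap.mulRight k H.alpha ∘ₗ H.antipode.toLinearMap))
        LinearMap.id t))) x) := by
  induction t with
  | zero => simp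
  | add s t hs ht => simp only [map_add, LinearMap.add_apply, hs, ht]
  | tmul t c =>
  induction t with
  | zero => simp
  | add s t hs ht => simp only [map_add, LinearMap.add_apply, add_tmul, hs, ht]
  | tmul a b =>
    have h : ∀ w : X.dual ⊗[k] X, pair X (ridEquiv X.dual (TensorProduct.map LinearMap.id (evMap X)
      (TensorProduct.assoc k X.dual X X.dual
        (act₃ X.dual X X.dual (a ⊗ₜ b ⊗ₜ c) (w ⊗ₜ f))))) x =
      pair X f (X.ρ (H.antipode.symm c) (X.ρ (H.antipode.symm H.alpha) (X.ρ b
        (dualTensorEquiv X w (X.ρ (H.antipode.symm a) x))))) := by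
      intro w
      induction w with
      | zero => simp
      | add w w' hx hy => simp only [map_add, add_tmul, LinearMap.add_apply, hx, hy]
      | tmul g y =>
        rw [act₃_tmul, TensorProduct.assoc_tmul, TensorProduct.map_tmul, evMap_tmul,
          ridEquiv_tmul, pair_ρ, dualTensorEquiv_tmul]
        simp only [LinearMap.id_apply, LinearEquiv.apply_symm_apply, map_smul, LinearMap.smul_apply,
          pair_ρ, smul_eq_mul]
        ring
    rw [h, coevElt, LinearEquiv.apply_symm_apply]
    simp [H.antipode_symm_mul]

/-- The left dual of a finite-dimensional module is a left dual in the category of modules. -/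
@[reducible]
def dualPairing : ExactPairing X.dual X where
  coevaluation' := coev X
  evaluation' := ev X
  coevaluation_evaluation' := by
    apply tensor_ext
    intro x c
    change TensorProduct.map (evMap X) LinearMap.id ((reassocEquiv X X.dual X).symm
      (x ⊗ₜ[k] (unitEquiv H.toQuasiBialgebra c • coevElt X))) =
        (lidEquiv X).symm (ridEquiv X (x ⊗ₜ c))
    rw [LinearEquiv.eq_symm_apply, ridEquiv_tmul, tmul_smul, map_smul, map_smul, map_smul,
      reassocEquiv_symm_apply, evLin_coevElt, H.reassoc_inv_antipode, ← H.antipode_one,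
      LinearEquiv.symm_apply_apply]
    simp
  evaluation_coevaluation' := by
    apply tensor_ext
    intro c f
    change TensorProduct.map LinearMap.id (evMap X) (reassocEquiv X.dual X X.dual
      ((unitEquiv H.toQuasiBialgebra c • coevElt X) ⊗ₜ[k] f)) =
        (ridEquiv X.dual).symm (lidEquiv X.dual (c ⊗ₜ f))
    rw [LinearEquiv.eq_symm_apply, lidEquiv_tmul, ← smul_tmul', map_smul, map_smul, map_smul]
    congr 1
    apply (pair X).injective
    apply LinearMap.ext
    intro x
    rw [reassocEquiv_apply, pair_coevElt, H.reassoc_antipode, ← H.antipode_one,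
      LinearEquiv.symm_apply_apply]
    simp

instance finiteDimensional_dual : FiniteDimensional k X.dual :=
  inferInstanceAs (FiniteDimensional k (Module.Dual k X))

section Regular

variable (H) in
/-- The dual space of `A` with the action `(a f)(b) = f(S(a) b)`, a right dual of the regular
module. -/
abbrev regularDual : QMod H.toQuasiBialgebra :=
  (regular H.toQuasiBialgebra).dualAlong H.antipodeOp

variable [FiniteDimensional k A]

instance : FiniteDimensional k (regular H.toQuasiBialgebra) :=
  inferInstanceAs (FiniteDimensional k A)

instance : FiniteDimensional k (regularDual H) :=
  inferInstanceAs (FiniteDimensional k (Module.Dual k A))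

variable (H) in
/-- The regular module is the left dual of its right dual. -/
def regularIso : regular H.toQuasiBialgebra ≅ (regularDual H).dual :=
  mkIso ((Module.evalEquiv k (regular H.toQuasiBialgebra)).trans
    ((toDual _ H.antipodeOp).dualMap.trans (pair (regularDual H)).symm)) (by
      intro a b
      apply (pair (regularDual H)).injective
      apply LinearMap.ext
      intro f
      rw [pair_ρ]
      simp only [LinearEquiv.trans_apply, LinearEquiv.apply_symm_apply, LinearEquiv.dualMap_apply,
        Module.evalEquiv_apply, Module.Dual.eval_apply]
      rw [toDual_ρ, H.unop_antipodeOp, LinearEquiv.apply_symm_apply])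

variable (H) in
/-- The duality of the regular module with its right dual. -/
@[reducible]
def regularPairing : ExactPairing (regular H.toQuasiBialgebra) (regularDual H) :=
  let _ := dualPairing (regularDual H)
  exactPairingCongrLeft (regularIso H)

/-- All half-braidings on modules over a finite-dimensional quasi-Hopf algebra are invertible. The
module `U` may be infinite-dimensional and need not have a dual; the regular module has one, and
it generates `U`. -/
theorem isIso_halfBraiding {V : QMod H.toQuasiBialgebra} (b : LaxHalfBraiding V)
    (U : QMod H.toQuasiBialgebra) : IsIso (b.c U) := by
  let _ := regularPairing H
  have hI : IsIso (b.c (regular H.toQuasiBialgebra)) := b.isIso_c _ (regularDual H)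
  let d : V ⊗[k] regular H.toQuasiBialgebra →ₗ[k] regular H.toQuasiBialgebra ⊗[k] V :=
    (inv (b.c (regular H.toQuasiBialgebra))).lin
  let orb : U →ₗ[k] regular H.toQuasiBialgebra →ₗ[k] U :=
    (LinearMap.lcomp k U (reg H.toQuasiBialgebra).symm.toLinearMap) ∘ₗ U.ρ.toLinearMap.flip
  have orb_eq : ∀ x, orb x = (orbit x).lin := fun x => rfl
  -- the inverse on `V ⊗ U` is forced by naturality: `v ⊗ x ↦ (r_x ⊗ id) (d (v ⊗ 1))`, where
  -- `r_x : A → U` is the orbit map and `d` is the inverse for the regular module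
  let e : V ⊗[k] U →ₗ[k] U ⊗[k] V := TensorProduct.lift (LinearMap.mk₂ k
    (fun v x => TensorProduct.map (orb x) LinearMap.id (d (v ⊗ₜ reg H.toQuasiBialgebra 1)))
    (fun v v' x => by simp [add_tmul]) (fun c v x => by rw [← smul_tmul', map_smul, map_smul])
    (fun v x x' => by simp [TensorProduct.map_add_left])
    (fun c v x => by simp [TensorProduct.map_smul_left]))
  have e_tmul : ∀ v x, e (v ⊗ₜ x) =
      TensorProduct.map (orb x) LinearMap.id (d (v ⊗ₜ reg H.toQuasiBialgebra 1)) := by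
    intro v x; simp [e]
  have nat : ∀ x : U, ∀ y : regular H.toQuasiBialgebra ⊗[k] V,
      halfBraidingLin b U (TensorProduct.map (orb x) LinearMap.id y) =
      TensorProduct.map LinearMap.id (orb x) (halfBraidingLin b _ y) := fun x y =>
    halfBraidingLin_nat b (orbit x) y
  have natd : ∀ a : A, ∀ y : V ⊗[k] regular H.toQuasiBialgebra,
      d (TensorProduct.map LinearMap.id (orbit (reg H.toQuasiBialgebra a)).lin y) =
      TensorProduct.map (orbit (reg H.toQuasiBialgebra a)).lin LinearMap.id (d y) := by
    intro a y
    have h := b.naturality (orbit (reg H.toQuasiBialgebra a))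
    rw [← IsIso.inv_comp_eq] at h
    have h2 : inv (b.c (regular _)) ≫ orbit (reg H.toQuasiBialgebra a) ▷ V =
        V ◁ orbit (reg H.toQuasiBialgebra a) ≫ inv (b.c (regular _)) := by
      rw [IsIso.eq_comp_inv, Category.assoc, h]
    exact (LinearMap.congr_fun (congrArg Hom.lin h2) y).symm
  have ed : ∀ x : U, ∀ y : V ⊗[k] regular H.toQuasiBialgebra,
      e (TensorProduct.map LinearMap.id (orb x) y) =
        TensorProduct.map (orb x) LinearMap.id (d y) := by
    intro x y
    induction y with
    | zero => simp
    | add y y' h h' => simp only [map_add, h, h']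
    | tmul v a =>
      obtain ⟨a, rfl⟩ := (reg H.toQuasiBialgebra).surjective a
      have h := natd a (v ⊗ₜ reg H.toQuasiBialgebra 1)
      rw [TensorProduct.map_tmul, orbit_one] at h
      rw [TensorProduct.map_tmul, e_tmul, LinearMap.id_apply]
      rw [LinearMap.id_apply] at h
      rw [h, orb_eq, orb_eq, orbit_lin, orbit_ρ, comp_lin]
      exact LinearMap.congr_fun (LinearMap.rTensor_comp V _ _) _
  apply isIso_of_bijective
  have h1 : ∀ y : V ⊗[k] U, halfBraidingLin b U (e y) = y := by
    intro y
    induction y with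
    | zero => simp
    | add y y' h h' => rw [map_add, map_add, h, h']
    | tmul v x =>
      have h : halfBraidingLin b (regular _) (d (v ⊗ₜ reg H.toQuasiBialgebra 1)) =
        v ⊗ₜ reg H.toQuasiBialgebra 1 := inv_hom_lin _ _
      rw [e_tmul, nat, h, TensorProduct.map_tmul, orb_eq, orbit_one]
      rfl
  have h2 : ∀ y : U ⊗[k] V, e (halfBraidingLin b U y) = y := by
    intro y
    induction y with
    | zero => simp
    | add y y' h h' => rw [map_add, map_add, h, h']
    | tmul x v =>
      have h := nat x (reg H.toQuasiBialgebra 1 ⊗ₜ v)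
      rw [TensorProduct.map_tmul, orb_eq, orbit_one, LinearMap.id_apply] at h
      have h' : d (halfBraidingLin b (regular _) (reg H.toQuasiBialgebra 1 ⊗ₜ[k] v)) =
        reg H.toQuasiBialgebra 1 ⊗ₜ v := hom_inv_lin _ _
      rw [h, ← orb_eq, ed, h', TensorProduct.map_tmul, orb_eq, orbit_one]
      rfl
  exact ⟨fun x y hxy => by rw [← h2 x, ← h2 y]; exact congrArg e hxy, fun y => ⟨e y, h1 y⟩⟩

end Regular

end QMod
end QuasiHopf
end Duals

/-! ### The free module with a half-braiding -/

section FreeModule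

open CategoryTheory MonoidalCategory TensorProduct

namespace QuasiHopf
namespace QMod

variable {k : Type} [Field k] {A : Type u} [Ring A] [Algebra k A] {H : QuasiHopfAlgebra k A}

/-- The transpose of an `A`-linear map. -/
def transpose {X Y : QMod H.toQuasiBialgebra} (f : X ⟶ Y) : Y.dual ⟶ X.dual :=
  ⟨(pair X).symm.toLinearMap ∘ₗ f.lin.dualMap ∘ₗ (pair Y).toLinearMap, fun a m => by
    apply (pair X).injective
    apply LinearMap.ext
    intro x
    rw [pair_ρ]
    simp only [LinearMap.comp_apply, LinearEquiv.coe_coe, LinearEquiv.apply_symm_apply,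
      LinearMap.dualMap_apply]
    rw [pair_ρ, f.comm]⟩

theorem pair_transpose {X Y : QMod H.toQuasiBialgebra} (f : X ⟶ Y) (m : Y.dual) (x : X) :
    pair X ((transpose f).lin m) x = pair Y m (f.lin x) := rfl

theorem transpose_ev {X Y : QMod H.toQuasiBialgebra} (f : X ⟶ Y) :
    X ◁ transpose f ≫ ev X = f ▷ Y.dual ≫ ev Y := by
  apply tensor_ext
  intro x m
  change evMap X (x ⊗ₜ (transpose f).lin m) = evMap Y (f.lin x ⊗ₜ m)
  rw [evMap_tmul, evMap_tmul, pair_transpose, f.comm]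

theorem eq_of_pair {X : QMod H.toQuasiBialgebra} {z z' : X}
    (h : ∀ m, pair X m z = pair X m z') : z = z' := by
  rw [← sub_eq_zero, ← Module.forall_dual_apply_eq_zero_iff k]
  intro ψ
  have := h ((pair X).symm ψ)
  rw [LinearEquiv.apply_symm_apply] at this
  rw [map_sub, this, sub_self]

/-- The module structure transported along a linear retraction whose kernel is invariant. -/
def ofRetraction (H : QuasiBialgebra k A) {M : Type*} {V : Type u} [AddCommGroup M] [Module k M]
    [AddCommGroup V] [Module k V] (σ : A →ₐ[k] Module.End k M)
    (p : M →ₗ[k] V) (s : V →ₗ[k] M) (hs : ∀ v, p (s v) = v)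
    (h : ∀ a x, p (σ a (s (p x))) = p (σ a x)) : QMod H where
  carrier := V
  ρ :=
    { toFun := fun a => p ∘ₗ σ a ∘ₗ s
      map_one' := by ext; simp [hs]
      map_mul' := fun a b => by ext; simp [h]
      map_zero' := by ext; simp
      map_add' := fun a b => by ext; simp
      commutes' := fun c => by ext; simp [Algebra.algebraMap_eq_smul_one, hs] }

variable (W : QMod H.toQuasiBialgebra)

/-- The linear map `(a ⊗ w) ⊗ f ↦ f(· a) ⊗ w`. -/
def freeProjLin : (regular H.toQuasiBialgebra ⊗[k] W) ⊗[k] (regular H.toQuasiBialgebra).dual →ₗ[k]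
    Module.Dual k A ⊗[k] W :=
  TensorProduct.map (TensorProduct.lift
      ((Module.Dual.transpose ∘ₗ (LinearMap.mul k A).flip).compl₁₂
        (reg H.toQuasiBialgebra).symm.toLinearMap
        ((reg H.toQuasiBialgebra).toLinearMap.dualMap ∘ₗ
          (pair (regular H.toQuasiBialgebra)).toLinearMap))) LinearMap.id ∘ₗ
    (TensorProduct.rightComm k _ _ _).toLinearMap

/-- The functional `b ↦ f(b a)`. -/
def mulRightDual (a : A) (f : (regular H.toQuasiBialgebra).dual) : Module.Dual k A :=
  (pair _ f ∘ₗ (reg H.toQuasiBialgebra).toLinearMap) ∘ₗ LinearMap.mulRight k a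

theorem freeProjLin_tmul (a : A) (w : W) (f : (regular H.toQuasiBialgebra).dual) :
    freeProjLin W ((reg H.toQuasiBialgebra a ⊗ₜ w) ⊗ₜ f) = mulRightDual a f ⊗ₜ w := by
  simp [freeProjLin]
  rfl

/-- The linear section `f ⊗ w ↦ (1 ⊗ w) ⊗ f`. -/
def freeSection : Module.Dual k A ⊗[k] W →ₗ[k]
    (regular H.toQuasiBialgebra ⊗[k] W) ⊗[k] (regular H.toQuasiBialgebra).dual :=
  (TensorProduct.rightComm k _ _ _).toLinearMap ∘ₗ
    TensorProduct.map (TensorProduct.mk k _ _ (reg H.toQuasiBialgebra 1) ∘ₗ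
      (pair (regular H.toQuasiBialgebra)).symm.toLinearMap ∘ₗ
        (reg H.toQuasiBialgebra).symm.toLinearMap.dualMap) LinearMap.id

/-- A functional on `A` as an element of the dual of the regular module. -/
def ofFunctional (f : Module.Dual k A) : (regular H.toQuasiBialgebra).dual :=
  (pair (regular H.toQuasiBialgebra)).symm (f ∘ₗ (reg H.toQuasiBialgebra).symm.toLinearMap)

theorem pair_ofFunctional (f : Module.Dual k A) (a : A) :
    pair (regular H.toQuasiBialgebra) (ofFunctional f) (reg _ a) = f a := rfl

theorem freeSection_tmul (f : Module.Dual k A) (w : W) :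
    freeSection W (f ⊗ₜ w) = (reg H.toQuasiBialgebra 1 ⊗ₜ w) ⊗ₜ ofFunctional f := by
  simp [freeSection]
  rfl

theorem freeProjLin_section (x : Module.Dual k A ⊗[k] W) :
    freeProjLin W (freeSection W x) = x := by
  induction x with
  | zero => simp
  | add x y hx hy => simp only [map_add, hx, hy]
  | tmul f w =>
    rw [freeSection_tmul, freeProjLin_tmul]
    congr 1
    apply LinearMap.ext
    intro b
    change f (b * 1) = f b
    rw [mul_one]

/-- The action of `A ⊗ A ⊗ A` preserves the kernel of the projection to `Dual A ⊗ W`. -/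
theorem freeProjLin_act₃ (t : A ⊗[k] A ⊗[k] A)
    (x : (regular H.toQuasiBialgebra ⊗[k] W) ⊗[k] (regular H.toQuasiBialgebra).dual) :
    freeProjLin W (act₃ _ W _ t (freeSection W (freeProjLin W x))) =
      freeProjLin W (act₃ _ W _ t x) := by
  induction t with
  | zero => simp
  | add s t hs ht => simp only [map_add, LinearMap.add_apply, hs, ht]
  | tmul t c =>
  induction t with
  | zero => simp
  | add s t hs ht => simp only [map_add, LinearMap.add_apply, add_tmul, hs, ht]
  | tmul a b =>
  induction x with
  | zero => simp
  | add x y hx hy => simp only [map_add, hx, hy]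
  | tmul x f =>
  induction x with
  | zero => simp
  | add x y hx hy => simp only [map_add, add_tmul, hx, hy]
  | tmul g w =>
    obtain ⟨g, rfl⟩ := (reg H.toQuasiBialgebra).surjective g
    rw [freeProjLin_tmul, freeSection_tmul, act₃_tmul, act₃_tmul, regular_ρ, regular_ρ,
      freeProjLin_tmul, freeProjLin_tmul]
    congr 1
    apply LinearMap.ext
    intro x
    change pair _ f (reg _ ((H.antipode.symm c * (x * (a * 1))) * g)) =
      pair _ f (reg _ (H.antipode.symm c * (x * (a * g))))
    simp only [mul_one, mul_assoc]

theorem tensor_tensor_ρ {H : QuasiBialgebra k A} (M N P : QMod H) (a : A) (x : M ⊗[k] N ⊗[k] P) :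
    (tensor (tensor M N) P).ρ a x = act₃ M N P (comulLeft H.comul (H.comul a)) x :=
  LinearMap.congr_fun (act₂_tensor_left _ _ _ _) x

/-- The free object with half-braiding on `W`, as a module. Its underlying vector space is
`Â ⊗ W`. -/
def freeMod : QMod H.toQuasiBialgebra :=
  ofRetraction H.toQuasiBialgebra
    ((act₃ (regular H.toQuasiBialgebra) W (regular H.toQuasiBialgebra).dual).comp
      ((comulLeft H.comul).comp H.comul))
    (V := Module.Dual k A ⊗[k] W) (p := freeProjLin W) (s := freeSection W)
    (freeProjLin_section W) (fun a x => freeProjLin_act₃ W (comulLeft H.comul (H.comul a)) x)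

/-- The identification of the free object with its underlying vector space. -/
def toFree : Module.Dual k A ⊗[k] W ≃ₗ[k] (freeMod W).carrier := LinearEquiv.refl k _

/-- The `A`-linear projection `(a ⊗ w) ⊗ f ↦ f(· a) ⊗ w` on the free object. -/
def freeProj : (regular H.toQuasiBialgebra ⊗ W) ⊗ (regular H.toQuasiBialgebra).dual ⟶ freeMod W :=
  ⟨(toFree W).toLinearMap ∘ₗ freeProjLin W, fun a x =>
    (congrArg (freeProjLin W) (tensor_tensor_ρ _ _ _ a x)).trans
      (freeProjLin_act₃ W _ x).symm⟩

theorem freeProj_dinatural (r : regular H.toQuasiBialgebra ⟶ regular H.toQuasiBialgebra) :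
    (r ▷ W) ▷ _ ≫ freeProj W = (_ ⊗ W) ◁ transpose r ≫ freeProj W := by
  apply hom_ext
  intro (x : (regular H.toQuasiBialgebra ⊗[k] W) ⊗[k] (regular H.toQuasiBialgebra).dual)
  change toFree W (freeProjLin W (TensorProduct.map (TensorProduct.map r.lin LinearMap.id)
    LinearMap.id x)) = toFree W (freeProjLin W (TensorProduct.map LinearMap.id (transpose r).lin x))
  congr 1
  induction x with
  | zero => simp
  | add x y hx hy => simp only [map_add, hx, hy]
  | tmul x f =>
  induction x with
  | zero => simp
  | add x y hx hy => simp only [map_add, add_tmul, hx, hy]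
  | tmul g w =>
    obtain ⟨g, rfl⟩ := (reg H.toQuasiBialgebra).surjective g
    obtain ⟨a, ha⟩ := (reg H.toQuasiBialgebra).surjective (r.lin (reg _ 1))
    have hr : ∀ b, r.lin (reg _ b) = reg _ (b * a) := by
      intro b
      rw [← regular_ρ_one, r.comm, ← ha, regular_ρ]
    rw [TensorProduct.map_tmul, TensorProduct.map_tmul, TensorProduct.map_tmul, hr,
      LinearMap.id_apply, LinearMap.id_apply, freeProjLin_tmul]
    refine Eq.trans ?_ (freeProjLin_tmul W g w _).symm
    congr 1
    apply LinearMap.ext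
    intro x
    change pair _ f (reg _ (x * (g * a))) = pair _ f (r.lin (reg _ (x * g)))
    rw [hr, mul_assoc]

theorem transpose_orbit (a : A) (f : (regular H.toQuasiBialgebra).dual) :
    (transpose (orbit (reg H.toQuasiBialgebra a))).lin f = ofFunctional (mulRightDual a f) := rfl

theorem freeProjLin_surjective : Function.Surjective (freeProjLin W) :=
  fun x => ⟨_, freeProjLin_section W x⟩

theorem hom_ext_orbit {X Y Z : QMod H.toQuasiBialgebra} (f g : Y ⊗ (X ⊗ W) ⟶ Z)
    (h : ∀ x : X, Y ◁ (orbit x ▷ W) ≫ f = Y ◁ (orbit x ▷ W) ≫ g) : f = g := by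
  let f' : Y ⊗[k] (X ⊗[k] W) →ₗ[k] Z := f.lin
  let g' : Y ⊗[k] (X ⊗[k] W) →ₗ[k] Z := g.lin
  have key : f' = g' := by
    apply TensorProduct.ext
    apply LinearMap.ext
    intro y
    apply TensorProduct.ext'
    intro x w
    have h1 : f' (y ⊗ₜ ((orbit x).lin (reg _ 1) ⊗ₜ w)) = g' (y ⊗ₜ ((orbit x).lin (reg _ 1) ⊗ₜ w)) :=
      LinearMap.congr_fun (congrArg Hom.lin (h x)) (y ⊗ₜ[k] (reg H.toQuasiBialgebra 1 ⊗ₜ[k] w))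
    rw [orbit_one] at h1
    exact h1
  exact Hom.ext key

theorem eq_of_whiskerLeft_freeProj {Y Z : QMod H.toQuasiBialgebra} (h h' : Y ⊗ freeMod W ⟶ Z)
    (hh : Y ◁ freeProj W ≫ h = Y ◁ freeProj W ≫ h') : h = h' := by
  have hsurj : Function.Surjective (TensorProduct.map (LinearMap.id : Y →ₗ[k] Y)
      ((toFree W).toLinearMap ∘ₗ freeProjLin W)) :=
    TensorProduct.map_surjective Function.surjective_id
      ((toFree W).surjective.comp (freeProjLin_surjective W))
  apply hom_ext
  intro x
  obtain ⟨x, rfl⟩ := hsurj x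
  exact LinearMap.congr_fun (congrArg Hom.lin hh) x

section Universal

variable [FiniteDimensional k A]

/-- The component at the regular module of the universal family of the free object. -/
def freeFamilyReg : regular H.toQuasiBialgebra ⊗ W ⟶ freeMod W ⊗ regular H.toQuasiBialgebra :=
  let _ := dualPairing (regular H.toQuasiBialgebra)
  ofPairing (freeProj W)

theorem freeFamilyReg_naturality (r : regular H.toQuasiBialgebra ⟶ regular H.toQuasiBialgebra) :
    r ▷ W ≫ freeFamilyReg W = freeFamilyReg W ≫ freeMod W ◁ r := by
  let _ := dualPairing (regular H.toQuasiBialgebra)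
  exact ofPairing_naturality (freeProj W) r (transpose r) (transpose_ev r).symm
    (freeProj_dinatural W r)

/-- The linear map underlying `freeFamilyReg`. -/
def freeFamilyRegLin : regular H.toQuasiBialgebra ⊗[k] W →ₗ[k]
    freeMod W ⊗[k] regular H.toQuasiBialgebra := (freeFamilyReg W).lin

/-- The linear map underlying the universal family of the free object. -/
def freeFamilyLin (X : QMod H.toQuasiBialgebra) : X ⊗[k] W →ₗ[k] freeMod W ⊗[k] X :=
  TensorProduct.lift (LinearMap.mk₂ k
    (fun x w => TensorProduct.map LinearMap.id (orbit x).lin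
      (freeFamilyRegLin W (reg H.toQuasiBialgebra 1 ⊗ₜ w)))
    (fun x x' w => by
      have : (orbit (x + x')).lin = (orbit x).lin + (orbit x').lin := by
        simp [orbit, LinearMap.add_comp]
      rw [this, TensorProduct.map_add_right, LinearMap.add_apply])
    (fun c x w => by
      have : (orbit (c • x)).lin = c • (orbit x).lin := by
        simp [orbit, LinearMap.smul_comp]
      rw [this, TensorProduct.map_smul_right, LinearMap.smul_apply])
    (fun x w w' => by rw [tmul_add, map_add, map_add])
    (fun c x w => by rw [tmul_smul, map_smul, map_smul]))

theorem freeFamilyLin_tmul (X : QMod H.toQuasiBialgebra) (x : X) (w : W) :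
    freeFamilyLin W X (x ⊗ₜ w) = TensorProduct.map LinearMap.id (orbit x).lin
      (freeFamilyRegLin W (reg H.toQuasiBialgebra 1 ⊗ₜ w)) := by
  simp [freeFamilyLin]

theorem freeFamilyLin_nat {X X' : QMod H.toQuasiBialgebra} (f : X ⟶ X') (x : X ⊗[k] W) :
    freeFamilyLin W X' (TensorProduct.map f.lin LinearMap.id x) =
      TensorProduct.map LinearMap.id f.lin (freeFamilyLin W X x) := by
  induction x with
  | zero => simp
  | add x y hx hy => simp only [map_add, hx, hy]
  | tmul x w =>
    rw [TensorProduct.map_tmul, freeFamilyLin_tmul, freeFamilyLin_tmul, ← orbit_comp, comp_lin,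
      LinearMap.id_apply]
    exact LinearMap.congr_fun (LinearMap.lTensor_comp (freeMod W) f.lin (orbit x).lin) _

theorem freeFamilyLin_regular (x : regular H.toQuasiBialgebra ⊗[k] W) :
    freeFamilyLin W (regular H.toQuasiBialgebra) x = freeFamilyRegLin W x := by
  induction x with
  | zero => simp
  | add x y hx hy => simp only [map_add, hx, hy]
  | tmul x w =>
    rw [freeFamilyLin_tmul]
    have h := LinearMap.congr_fun (congrArg Hom.lin (freeFamilyReg_naturality W (orbit x)))
      (reg H.toQuasiBialgebra 1 ⊗ₜ w)
    refine h.symm.trans ?_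
    change freeFamilyRegLin W ((orbit x).lin (reg H.toQuasiBialgebra 1) ⊗ₜ w) = _
    rw [orbit_one]

/-- The universal family of the free object. -/
def freeFamilyHom (X : QMod H.toQuasiBialgebra) : X ⊗ W ⟶ freeMod W ⊗ X :=
  ⟨freeFamilyLin W X, fun a => by
    have : freeFamilyLin W X ∘ₗ act₂ X W (H.comul a) =
        act₂ (freeMod W) X (H.comul a) ∘ₗ freeFamilyLin W X := by
      apply TensorProduct.ext'
      intro x w
      have h1 : act₂ X W (H.comul a) (x ⊗ₜ w) = TensorProduct.map (orbit x).lin LinearMap.id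
          (act₂ _ W (H.comul a) (reg H.toQuasiBialgebra 1 ⊗ₜ w)) := by
        have h := (orbit x ▷ W).comm a (reg H.toQuasiBialgebra 1 ⊗ₜ w)
        have h2 : (orbit x ▷ W).lin (reg H.toQuasiBialgebra 1 ⊗ₜ w) = x ⊗ₜ w := by
          rw [whiskerRight_lin_tmul, orbit_one]
        rw [h2] at h
        exact h.symm
      rw [LinearMap.comp_apply, LinearMap.comp_apply, h1, freeFamilyLin_nat,
        freeFamilyLin_regular, freeFamilyLin_tmul]
      have h3 := (freeFamilyReg W).comm a (reg H.toQuasiBialgebra 1 ⊗ₜ w)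
      have h4 := (freeMod W ◁ orbit x).comm a
        (freeFamilyRegLin W (reg H.toQuasiBialgebra 1 ⊗ₜ w))
      exact (congrArg (TensorProduct.map LinearMap.id (orbit x).lin) h3).trans h4
    exact LinearMap.congr_fun this⟩

theorem freeFamilyHom_regular :
    freeFamilyHom W (regular H.toQuasiBialgebra) = freeFamilyReg W :=
  hom_ext (freeFamilyLin_regular W)

theorem freeFamilyHom_nat {X X' : QMod H.toQuasiBialgebra} (f : X ⟶ X') :
    f ▷ W ≫ freeFamilyHom W X' = freeFamilyHom W X ≫ freeMod W ◁ f :=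
  hom_ext (freeFamilyLin_nat W f)

variable {Y Z : QMod H.toQuasiBialgebra}

/-- An endomorphism-natural `h : Y ⊗ (A ⊗ W) ⟶ Z ⊗ A` factors through the free module: by
dinaturality its adjoint on `Y ⊗ ((A ⊗ W) ⊗ A^∨)` respects the relation that identifies
`(a ⊗ w) ⊗ f` with `(1 ⊗ w) ⊗ f(· a)`. -/
theorem exists_of_toPairing
    (h : Y ⊗ (regular H.toQuasiBialgebra ⊗ W) ⟶ Z ⊗ regular H.toQuasiBialgebra)
    (hn : ∀ r : regular H.toQuasiBialgebra ⟶ regular H.toQuasiBialgebra,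
      Y ◁ (r ▷ W) ≫ h = h ≫ Z ◁ r) :
    letI := dualPairing (regular H.toQuasiBialgebra)
    ∃ h' : Y ⊗ freeMod W ⟶ Z, Y ◁ freeProj W ≫ h' = toPairing h := by
  let _ := dualPairing (regular H.toQuasiBialgebra)
  let p : Y ⊗[k] ((regular H.toQuasiBialgebra ⊗[k] W) ⊗[k] (regular H.toQuasiBialgebra).dual)
    →ₗ[k] Z := (toPairing h : Y ⊗ ((regular H.toQuasiBialgebra ⊗ W) ⊗
      (regular H.toQuasiBialgebra).dual) ⟶ Z).lin
  let h' : Y ⊗[k] freeMod W →ₗ[k] Z := p ∘ₗ TensorProduct.map LinearMap.id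
    (freeSection W ∘ₗ (toFree W).symm.toLinearMap)
  have hp : ∀ y : Y, ∀ x, p (y ⊗ₜ freeSection W (freeProjLin W x)) = p (y ⊗ₜ x) := by
    intro y x
    induction x with
    | zero => simp
    | add x x' hx hx' => simp only [map_add, tmul_add, hx, hx']
    | tmul x f =>
    induction x with
    | zero => simp
    | add x x' hx hx' => simp only [map_add, tmul_add, add_tmul, hx, hx']
    | tmul x w =>
      obtain ⟨a, rfl⟩ := (reg H.toQuasiBialgebra).surjective x
      -- move the right multiplication by `a` from the factor `A` to the factor `A^∨`
      have hd := toPairing_dinatural h (orbit (reg H.toQuasiBialgebra a))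
        (transpose (orbit (reg H.toQuasiBialgebra a))) (transpose_ev _).symm (hn _)
      have hd' := LinearMap.congr_fun (congrArg Hom.lin hd)
        (y ⊗ₜ[k] ((reg H.toQuasiBialgebra 1 ⊗ₜ[k] w) ⊗ₜ[k] f))
      have hd2 : p (y ⊗ₜ (((orbit (reg H.toQuasiBialgebra a)).lin (reg H.toQuasiBialgebra 1) ⊗ₜ w)
        ⊗ₜ f)) = p (y ⊗ₜ ((reg H.toQuasiBialgebra 1 ⊗ₜ w) ⊗ₜ
          (transpose (orbit (reg H.toQuasiBialgebra a))).lin f)) := hd'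
      rw [freeProjLin_tmul, freeSection_tmul, ← transpose_orbit, ← hd2, orbit_one]
  have hfac : ∀ x, h' (TensorProduct.map LinearMap.id
      ((toFree W).toLinearMap ∘ₗ freeProjLin W) x) = p x := by
    intro x
    induction x with
    | zero => simp
    | add x x' hx hx' => simp only [map_add, hx, hx']
    | tmul y x =>
      simp only [h', LinearMap.comp_apply, TensorProduct.map_tmul, LinearMap.id_apply]
      simp only [LinearEquiv.coe_coe, LinearEquiv.symm_apply_apply]
      exact hp y x
  have hsurj : Function.Surjective (TensorProduct.map (LinearMap.id : Y →ₗ[k] Y)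
      ((toFree W).toLinearMap ∘ₗ freeProjLin W)) :=
    TensorProduct.map_surjective Function.surjective_id
      ((toFree W).surjective.comp (freeProjLin_surjective W))
  refine ⟨⟨h', fun a x => ?_⟩, hom_ext hfac⟩
  obtain ⟨x, rfl⟩ := hsurj x
  have h1 := (Y ◁ freeProj W).comm a x
  have h2 := (toPairing h : Y ⊗ ((regular H.toQuasiBialgebra ⊗ W) ⊗
      (regular H.toQuasiBialgebra).dual) ⟶ Z).comm a x
  refine (congrArg h' h1.symm).trans ?_
  refine (hfac _).trans (h2.trans ?_)
  exact congrArg (Z.ρ a) (hfac x).symm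

/-- The free object with half-braiding on `W`. -/
def freeFamily : FreeFamily W (freeMod W) where
  u := freeFamilyHom W
  naturality := freeFamilyHom_nat W
  exists_desc {Y Z} h hn := by
    let _ := dualPairing (regular H.toQuasiBialgebra)
    obtain ⟨h', hh⟩ := exists_of_toPairing W (h (regular _)) (fun r => hn r)
    have h1 := ofPairing_desc (freeProj W) (h (regular _)) h' hh
    refine ⟨h', fun X => ?_⟩
    have key : ∀ x : X, Y ◁ (orbit x ▷ W) ≫ (Y ◁ freeFamilyHom W X ≫ (α_ _ _ X).inv ≫ h' ▷ X) =
        Y ◁ (orbit x ▷ W) ≫ h X := by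
      intro x
      rw [hn]
      rw [← h1]
      calc
        _ = Y ◁ (orbit x ▷ W ≫ freeFamilyHom W X) ≫ (α_ _ _ X).inv ≫ h' ▷ X := by monoidal
        _ = Y ◁ freeFamilyReg W ≫ (α_ _ _ _).inv ≫ ((Y ⊗ freeMod W) ◁ orbit x ≫ h' ▷ X) := by
          rw [freeFamilyHom_nat, freeFamilyHom_regular]; monoidal
        _ = _ := by rw [whisker_exchange]; simp [freeFamilyReg]
    exact hom_ext_orbit W _ _ key
  hom_ext {Y Z} h h' hh := by
    let _ := dualPairing (regular H.toQuasiBialgebra)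
    apply eq_of_whiskerLeft_freeProj
    have h1 := hh (regular _)
    rw [freeFamilyHom_regular] at h1
    rw [whiskerLeft_comp_eq_of_ofPairing (freeProj W) _ h' rfl,
      whiskerLeft_comp_eq_of_ofPairing (freeProj W) _ h rfl]
    exact congrArg toPairing h1

end Universal

end QMod
end QuasiHopf
end FreeModule

/-! ### The algebra of the double -/

section DoubleAlgebra

open CategoryTheory MonoidalCategory TensorProduct

namespace QuasiHopf
namespace QMod

variable {k : Type} [Field k] {A : Type u} [Ring A] [Algebra k A]

section Slice

variable {H : QuasiBialgebra k A} (M : Type*) [AddCommGroup M] [Module k M]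

/-- The linear map `m ⊗ a ↦ ψ(a) m`. -/
def slice : Module.Dual k A →ₗ[k] M ⊗[k] regular H →ₗ[k] M :=
  LinearMap.compRight k (TensorProduct.rid k M).toLinearMap ∘ₗ LinearMap.lTensorHom M ∘ₗ
    (reg H).symm.toLinearMap.dualMap

variable {M}

theorem slice_tmul (ψ : Module.Dual k A) (m : M) (a : A) :
    slice M ψ (m ⊗ₜ reg H a) = ψ a • m := by
  simp [slice]

theorem slice_map {N : Type*} [AddCommGroup N] [Module k N] (f : M →ₗ[k] N)
    (ψ : Module.Dual k A) (x : M ⊗[k] regular H) :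
    slice N ψ (TensorProduct.map f LinearMap.id x) = f (slice M ψ x) := by
  induction x with
  | zero => simp
  | add x y hx hy => simp only [map_add, hx, hy]
  | tmul m a =>
    obtain ⟨a, rfl⟩ := (reg H).surjective a
    rw [TensorProduct.map_tmul, LinearMap.id_apply, slice_tmul, slice_tmul, map_smul]

theorem sum_slice {ι : Type*} [Fintype ι] (b : Module.Basis ι k A) (x : M ⊗[k] regular H) :
    ∑ i, slice M (b.coord i) x ⊗ₜ reg H (b i) = x := by
  induction x with
  | zero => simp
  | add x y hx hy =>
    conv_rhs => rw [← hx, ← hy]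
    simp only [map_add, add_tmul, Finset.sum_add_distrib]
  | tmul m a =>
    obtain ⟨a, rfl⟩ := (reg H).surjective a
    simp only [slice_tmul, smul_tmul]
    rw [← TensorProduct.tmul_sum]
    simp only [← map_smul, ← map_sum, Module.Basis.coord_apply, Module.Basis.sum_repr]

end Slice

variable {H : QuasiBialgebra k A}

/-- The action of the dual space on an object of the centre. -/
def dualAct (X : Center (QMod H)) : Module.Dual k A →ₗ[k] Module.End k X.1 :=
  LinearMap.lcomp k X.1 (halfBraidingLin (LaxHalfBraiding.ofCenter X) (regular H) ∘ₗ
    TensorProduct.mk k (regular H) X.1 (reg H 1)) ∘ₗ slice X.1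

theorem dualAct_apply (X : Center (QMod H)) (ψ : Module.Dual k A) (x : X.1) :
    dualAct X ψ x = slice X.1 ψ (halfBraidingLin (LaxHalfBraiding.ofCenter X) (regular H)
      (reg H 1 ⊗ₜ x)) := rfl

theorem center_hom_halfBraidingLin {X Y : Center (QMod H)} (f : X ⟶ Y) (U : QMod H)
    (t : U ⊗[k] X.1) :
    TensorProduct.map f.f.lin LinearMap.id (halfBraidingLin (LaxHalfBraiding.ofCenter X) U t) =
      halfBraidingLin (LaxHalfBraiding.ofCenter Y) U (TensorProduct.map LinearMap.id f.f.lin t) := by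
  have h : (X.2.β U).inv ≫ f.f ▷ U = U ◁ f.f ≫ (Y.2.β U).inv := by
    rw [Iso.inv_comp_eq, ← Category.assoc, Iso.eq_comp_inv, f.comm]
  exact LinearMap.congr_fun (congrArg Hom.lin h) t

theorem center_hom_dualAct {X Y : Center (QMod H)} (f : X ⟶ Y) (ψ : Module.Dual k A) (x : X.1) :
    f.f.lin (dualAct X ψ x) = dualAct Y ψ (f.f.lin x) := by
  rw [dualAct_apply, dualAct_apply, ← slice_map, center_hom_halfBraidingLin,
    TensorProduct.map_tmul, LinearMap.id_apply]

end QMod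

variable {k : Type} [Field k] {A : Type u} [Ring A] [Algebra k A] [FiniteDimensional k A]
variable (H : QuasiHopfAlgebra k A)

open QMod

/-- The free object of the centre on the regular module. -/
def freeCenter : Center (QMod H.toQuasiBialgebra) :=
  (freeFamily (regular H.toQuasiBialgebra)).laxHalfBraiding.toCenter (isIso_halfBraiding _)

/-- The vector that generates the free object. -/
def freeGen : (freeCenter H).1 :=
  (freeFamily (regular H.toQuasiBialgebra)).incl.lin (reg H.toQuasiBialgebra 1)

/-- The generator of the free object can be mapped to every vector of every object. -/
theorem exists_hom_freeCenter (X : Center (QMod H.toQuasiBialgebra)) (x : X.1) :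
    ∃ f : freeCenter H ⟶ X, f.f.lin (freeGen H) = x := by
  obtain ⟨f, hf, h⟩ := (freeFamily (regular H.toQuasiBialgebra)).exists_extension
    (LaxHalfBraiding.ofCenter X) (orbit x)
  refine ⟨⟨f, fun U => ?_⟩, ?_⟩
  · have hI := isIso_halfBraiding (freeFamily (regular H.toQuasiBialgebra)).laxHalfBraiding U
    have h1 : f ▷ U ≫ (X.2.β U).hom =
        inv ((freeFamily (regular H.toQuasiBialgebra)).laxHalfBraiding.c U) ≫ U ◁ f := by
      rw [IsIso.eq_inv_comp, ← Category.assoc]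
      refine (congrArg (· ≫ (X.2.β U).hom) (h U)).trans ?_
      change (_ ≫ (X.2.β U).inv) ≫ (X.2.β U).hom = _
      simp
    exact h1
  · have h2 := LinearMap.congr_fun (congrArg Hom.lin hf) (reg H.toQuasiBialgebra 1)
    exact h2.trans (orbit_one x)

/-- The algebra of endomorphisms of the free object generated by the actions of `A` and of its
dual space: the quantum double. -/
def doubleSubalgebra : Subalgebra k (Module.End k (freeCenter H).1) :=
  Algebra.adjoin k (Set.range (freeCenter H).1.ρ ∪ Set.range (dualAct (freeCenter H)))

/-- The quantum double. -/
def Double : Type u := ↥(doubleSubalgebra H)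

instance : Ring (Double H) := inferInstanceAs (Ring ↥(doubleSubalgebra H))

instance : Algebra k (Double H) := inferInstanceAs (Algebra k ↥(doubleSubalgebra H))

/-- The double as an algebra of endomorphisms of the free object. -/
def doubleVal : Double H →ₐ[k] Module.End k (freeCenter H).1 := (doubleSubalgebra H).val

/-- The inclusion of `A` in its double. -/
def inclDouble : A →ₐ[k] Double H :=
  (freeCenter H).1.ρ.codRestrict (doubleSubalgebra H)
    (fun a => Algebra.subset_adjoin (Or.inl ⟨a, rfl⟩))

/-- The inclusion of the dual space of `A` in the double. -/
def dualInclDouble : Module.Dual k A →ₗ[k] Double H :=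
  (dualAct (freeCenter H)).codRestrict (Subalgebra.toSubmodule (doubleSubalgebra H))
    (fun ψ => Algebra.subset_adjoin (Or.inr ⟨ψ, rfl⟩))

theorem adjoin_double :
    Algebra.adjoin k (Set.range (inclDouble H) ∪ Set.range (dualInclDouble H)) = ⊤ := by
  have h := Algebra.adjoin_adjoin_coe_preimage (R := k)
    (s := Set.range (freeCenter H).1.ρ ∪ Set.range (dualAct (freeCenter H)))
  refine Eq.trans ?_ h
  congr 1
  ext x
  simp only [Set.mem_union, Set.mem_range]
  constructor
  · rintro (⟨a, rfl⟩ | ⟨ψ, rfl⟩)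
    · exact Or.inl ⟨a, rfl⟩
    · exact Or.inr ⟨ψ, rfl⟩
  · rintro (⟨a, h⟩ | ⟨ψ, h⟩)
    · exact Or.inl ⟨a, Subtype.ext h⟩
    · exact Or.inr ⟨ψ, Subtype.ext h⟩

variable {H} in
/-- An induction principle for the double. -/
theorem double_induction {p : Double H → Prop} (h₁ : ∀ a, p (inclDouble H a))
    (h₂ : ∀ ψ, p (dualInclDouble H ψ)) (hadd : ∀ x y, p x → p y → p (x + y))
    (hmul : ∀ x y, p x → p y → p (x * y)) (x : Double H) : p x := by
  have hx : x ∈ Algebra.adjoin k (Set.range (inclDouble H) ∪ Set.range (dualInclDouble H)) := by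
    rw [adjoin_double]; trivial
  induction hx using Algebra.adjoin_induction with
  | mem x hx =>
    rcases hx with ⟨a, rfl⟩ | ⟨ψ, rfl⟩
    exacts [h₁ a, h₂ ψ]
  | algebraMap r => rw [← (inclDouble H).commutes]; exact h₁ _
  | add x y _ _ hx hy => exact hadd x y hx hy
  | mul x y _ _ hx hy => exact hmul x y hx hy

/-- An element of the double commutes with morphisms of the centre, so it acts compatibly on every
object that receives morphisms from the free one. -/
theorem exists_act (X : Center (QMod H.toQuasiBialgebra)) (x : Double H) :
    ∃ b : Module.End k X.1,
      ∀ (f : freeCenter H ⟶ X) v, f.f.lin (doubleVal H x v) = b (f.f.lin v) := by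
  induction x using double_induction with
  | h₁ a => exact ⟨X.1.ρ a, fun f v => f.f.comm a v⟩
  | h₂ ψ => exact ⟨dualAct X ψ, fun f v => center_hom_dualAct f ψ v⟩
  | hadd x y hx hy =>
    obtain ⟨b, hb⟩ := hx
    obtain ⟨c, hc⟩ := hy
    exact ⟨b + c, fun f v => by
      rw [map_add, LinearMap.add_apply, map_add, hb, hc, LinearMap.add_apply]⟩
  | hmul x y hx hy =>
    obtain ⟨b, hb⟩ := hx
    obtain ⟨c, hc⟩ := hy
    exact ⟨b * c, fun f v => by
      rw [map_mul, Module.End.mul_apply, hb, hc, Module.End.mul_apply]⟩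

/-- The action of an element of the double on an object of the centre. -/
def actElt (X : Center (QMod H.toQuasiBialgebra)) (x : Double H) : Module.End k X.1 :=
  (exists_act H X x).choose

variable {H}

theorem actElt_hom {X : Center (QMod H.toQuasiBialgebra)} (x : Double H) (f : freeCenter H ⟶ X)
    (v : (freeCenter H).1) : f.f.lin (doubleVal H x v) = actElt H X x (f.f.lin v) :=
  (exists_act H X x).choose_spec f v

theorem actElt_eq {X : Center (QMod H.toQuasiBialgebra)} (x : Double H) (b : Module.End k X.1)
    (h : ∀ (f : freeCenter H ⟶ X) v, f.f.lin (doubleVal H x v) = b (f.f.lin v)) :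
    actElt H X x = b := by
  apply LinearMap.ext
  intro z
  obtain ⟨f, rfl⟩ := exists_hom_freeCenter H X z
  rw [← h, actElt_hom]

/-- The action of the double on an object of the centre. -/
def act (X : Center (QMod H.toQuasiBialgebra)) : Double H →ₐ[k] Module.End k X.1 where
  toFun := actElt H X
  map_one' := actElt_eq _ _ (fun f v => rfl)
  map_mul' x y := actElt_eq _ _ (fun f v => by
    rw [map_mul, Module.End.mul_apply, actElt_hom, actElt_hom, Module.End.mul_apply])
  map_zero' := actElt_eq _ _ (fun f v => by simp)
  map_add' x y := actElt_eq _ _ (fun f v => by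
    rw [map_add, LinearMap.add_apply, map_add, actElt_hom, actElt_hom,
      LinearMap.add_apply])
  commutes' r := actElt_eq _ _ (fun f v => by
    rw [AlgHom.commutes, Module.algebraMap_end_apply, Module.algebraMap_end_apply,
      map_smul])

theorem act_inclDouble (X : Center (QMod H.toQuasiBialgebra)) (a : A) :
    act X (inclDouble H a) = X.1.ρ a :=
  actElt_eq _ _ (fun f v => f.f.comm a v)

theorem act_dualInclDouble (X : Center (QMod H.toQuasiBialgebra)) (ψ : Module.Dual k A) :
    act X (dualInclDouble H ψ) = dualAct X ψ :=
  actElt_eq _ _ (fun f v => center_hom_dualAct f ψ v)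

theorem act_freeCenter (x : Double H) : act (freeCenter H) x = doubleVal H x :=
  LinearMap.ext fun v => (actElt_hom x (𝟙 _) v).symm

theorem center_hom_act {X Y : Center (QMod H.toQuasiBialgebra)} (f : X ⟶ Y) (x : Double H)
    (z : X.1) : f.f.lin (act X x z) = act Y x (f.f.lin z) := by
  induction x using double_induction generalizing z with
  | h₁ a => rw [act_inclDouble, act_inclDouble, f.f.comm]
  | h₂ ψ => rw [act_dualInclDouble, act_dualInclDouble, center_hom_dualAct]
  | hadd x y hx hy => simp only [map_add, LinearMap.add_apply, hx, hy]
  | hmul x y hx hy => simp only [map_mul, Module.End.mul_apply, hx, hy]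

end QuasiHopf
end DoubleAlgebra

/-! ### Bijectivity of the map `μ` -/

section MuMap

open CategoryTheory MonoidalCategory TensorProduct

namespace QuasiHopf

/-- The functional `c ↦ ψ(b c)` as a function of `b`. -/
def mulLeftDual {k : Type v} [Field k] {A : Type u} [Ring A] [Algebra k A] (ψ : Module.Dual k A) :
    A →ₗ[k] Module.Dual k A := (LinearMap.mul k A).compr₂ ψ

theorem mulLeftDual_apply {k : Type v} [Field k] {A : Type u} [Ring A] [Algebra k A]
    (ψ : Module.Dual k A) (b c : A) : mulLeftDual ψ b c = ψ (b * c) := rfl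

theorem muMap_tmul {k : Type v} [Field k] {A : Type u} [Ring A] [Algebra k A]
    [FiniteDimensional k A] (H : QuasiHopfAlgebra k A) {D : Type w} [Ring D] [Algebra k D]
    (i : A →ₐ[k] D) (δ : Module.Dual k A →ₗ[k] D) (ψ : Module.Dual k A) (a : A) :
    muMap H i δ (ψ ⊗ₜ a) = LinearMap.mul' k D
      (TensorProduct.map i.toLinearMap (δ ∘ₗ mulLeftDual ψ) H.qRho) * i a := by
  have h : ∀ t : A ⊗[k] A, LinearMap.mul' k D (TensorProduct.map (i.toLinearMap ∘ₗ
      (TensorProduct.rid k A).toLinearMap ∘ₗ LinearMap.applyₗ t ∘ₗ LinearMap.lTensorHom A) δ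
        (dualComul ψ)) = LinearMap.mul' k D
      (TensorProduct.map i.toLinearMap (δ ∘ₗ mulLeftDual ψ) t) := by
    intro t
    induction t with
    | zero => simp
    | add s t hs ht =>
      have e : LinearMap.applyₗ (R := k) (M₂ := A ⊗[k] k) (s + t) =
          LinearMap.applyₗ s + LinearMap.applyₗ t := map_add _ _ _
      rw [e, LinearMap.add_comp, LinearMap.comp_add, LinearMap.comp_add, TensorProduct.map_add_left,
        LinearMap.add_apply, map_add, hs, ht, map_add, map_add]
    | tmul a b =>
      have h1 : ∀ s : Module.Dual k A ⊗[k] Module.Dual k A,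
          LinearMap.mul' k D (TensorProduct.map (i.toLinearMap ∘ₗ
          (TensorProduct.rid k A).toLinearMap ∘ₗ LinearMap.applyₗ (a ⊗ₜ b) ∘ₗ
            LinearMap.lTensorHom A) δ s) =
            i a * δ (TensorProduct.curry (TensorProduct.dualDistrib k A A s) b) := by
        intro s
        induction s with
        | zero =>
          have : TensorProduct.curry (TensorProduct.dualDistrib k A A 0) b = 0 := by
            ext; simp
          rw [this]
          simp
        | add s t hs ht =>
          have : TensorProduct.curry (TensorProduct.dualDistrib k A A (s + t)) b =
              TensorProduct.curry (TensorProduct.dualDistrib k A A s) b +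
              TensorProduct.curry (TensorProduct.dualDistrib k A A t) b := by
            ext; simp
          rw [map_add, map_add, hs, ht, this, map_add, mul_add]
        | tmul ξ χ =>
          have : TensorProduct.curry (TensorProduct.dualDistrib k A A (ξ ⊗ₜ χ)) b = ξ b • χ := by
            ext; simp
          rw [this]
          simp
      have h2 : TensorProduct.curry (TensorProduct.dualDistrib k A A (dualComul ψ)) b =
          mulLeftDual ψ b := by
        ext c
        rw [TensorProduct.curry_apply, dualDistrib_dualComul, mulLeftDual_apply]
      rw [h1, h2]
      simp
  change LinearMap.mul' k D (TensorProduct.map (i.toLinearMap ∘ₗ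
      (TensorProduct.rid k A).toLinearMap ∘ₗ LinearMap.applyₗ H.qRho ∘ₗ LinearMap.lTensorHom A) δ
        (dualComul ψ)) * i a = _
  rw [h]

variable {k : Type} [Field k] {A : Type u} [Ring A] [Algebra k A] [FiniteDimensional k A]
variable {H : QuasiHopfAlgebra k A}

open QMod

theorem evMap_act₃_freeCenter (t : A ⊗[k] A ⊗[k] A) (ψ : Module.Dual k A) (v : (freeCenter H).1) :
    ridEquiv (freeCenter H).1 (TensorProduct.map LinearMap.id (evMap (regular H.toQuasiBialgebra))
      (TensorProduct.assoc k _ _ _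
        (act₃ (freeCenter H).1 (regular H.toQuasiBialgebra) (regular H.toQuasiBialgebra).dual t
        (halfBraidingLin (LaxHalfBraiding.ofCenter (freeCenter H)) (regular H.toQuasiBialgebra)
          (reg H.toQuasiBialgebra 1 ⊗ₜ v) ⊗ₜ ofFunctional ψ)))) =
    doubleVal H (LinearMap.mul' k (Double H)
      (TensorProduct.map (inclDouble H).toLinearMap (dualInclDouble H ∘ₗ mulLeftDual ψ)
        (TensorProduct.map LinearMap.id
          (LinearMap.mul' k A ∘ₗ
            TensorProduct.map (H.antipode.symm.toLinearMap ∘ₗ LinearMap.mulLeft k H.alpha)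
              LinearMap.id ∘ₗ
            (TensorProduct.comm k A A).toLinearMap)
          (TensorProduct.assoc k A A A t)))) v := by
  induction t with
  | zero => simp
  | add s t hs ht =>
    simp only [map_add, LinearMap.add_apply, hs, ht, map_add]
  | tmul t c =>
  induction t with
  | zero => simp
  | add s t hs ht =>
    simp only [map_add, add_tmul, LinearMap.add_apply, hs, ht, map_add]
  | tmul a b =>
    have h : doubleVal H (LinearMap.mul' k (Double H)
      (TensorProduct.map (inclDouble H).toLinearMap (dualInclDouble H ∘ₗ mulLeftDual ψ)
        (TensorProduct.map LinearMap.id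
          (LinearMap.mul' k A ∘ₗ
            TensorProduct.map (H.antipode.symm.toLinearMap ∘ₗ LinearMap.mulLeft k H.alpha)
              LinearMap.id ∘ₗ
            (TensorProduct.comm k A A).toLinearMap)
          (TensorProduct.assoc k A A A (a ⊗ₜ b ⊗ₜ c))))) v =
        (freeCenter H).1.ρ a (slice (freeCenter H).1
          (mulLeftDual ψ (H.antipode.symm (H.alpha * c) * b))
          (halfBraidingLin (LaxHalfBraiding.ofCenter (freeCenter H)) (regular H.toQuasiBialgebra)
          (reg H.toQuasiBialgebra 1 ⊗ₜ v))) := by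
      simp only [TensorProduct.assoc_tmul, TensorProduct.map_tmul, LinearMap.comp_apply,
        LinearEquiv.coe_coe, TensorProduct.comm_tmul, LinearMap.mul'_apply, LinearMap.id_apply,
        LinearMap.mulLeft_apply]
      rfl
    rw [h]
    generalize halfBraidingLin (LaxHalfBraiding.ofCenter (freeCenter H))
      (regular H.toQuasiBialgebra) (reg H.toQuasiBialgebra 1 ⊗ₜ v) = u
    induction u with
    | zero => simp
    | add u u' hu hu' => simp only [map_add, add_tmul, hu, hu']
    | tmul w d =>
      obtain ⟨d, rfl⟩ := (reg H.toQuasiBialgebra).surjective d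
      rw [act₃_tmul, TensorProduct.assoc_tmul, TensorProduct.map_tmul, evMap_tmul, ridEquiv_tmul,
        slice_tmul, regular_ρ, regular_ρ, pair_ρ, regular_ρ, pair_ofFunctional, mulLeftDual_apply,
        H.antipode_symm_mul]
      simp [mul_assoc]

/-- The element `μ(ψ ⊗ a)` of the double sends the generator of the free object to `ψ ⊗ a`. The
factor `q_ρ` in `μ` undoes the reassociator and the `α` in the evaluation of `A^∨` in the
adjunction between the universal map `A ⊗ W ⟶ V ⊗ A` and the projection `(A ⊗ W) ⊗ A^∨ ⟶ V`. -/
theorem muMap_freeGen (ψ : Module.Dual k A) (a : A) :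
    doubleVal H (muMap H (inclDouble H) (dualInclDouble H) (ψ ⊗ₜ a)) (freeGen H) =
      toFree (regular H.toQuasiBialgebra) (ψ ⊗ₜ reg H.toQuasiBialgebra a) := by
  let W := regular H.toQuasiBialgebra
  let v : (freeCenter H).1 := (freeFamily W).incl.lin (reg H.toQuasiBialgebra a)
  have hv : doubleVal H (inclDouble H a) (freeGen H) = v := by
    have h := (freeFamily W).incl.comm a (reg H.toQuasiBialgebra 1)
    rw [regular_ρ_one] at h
    exact h.symm
  have hu : freeFamilyRegLin W (reg H.toQuasiBialgebra 1 ⊗ₜ reg H.toQuasiBialgebra a) =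
      halfBraidingLin (LaxHalfBraiding.ofCenter (freeCenter H)) (regular H.toQuasiBialgebra)
        (reg H.toQuasiBialgebra 1 ⊗ₜ v) := by
    have h := (freeFamily W).incl_c W
    have h2 : (freeFamily W).u W = freeFamilyReg W := freeFamilyHom_regular W
    rw [h2] at h
    exact (LinearMap.congr_fun (congrArg Hom.lin h)
      (reg H.toQuasiBialgebra 1 ⊗ₜ[k] reg H.toQuasiBialgebra a)).symm
  have hp : freeProjLin W ((reg H.toQuasiBialgebra 1 ⊗ₜ reg H.toQuasiBialgebra a) ⊗ₜ
      ofFunctional ψ) = ψ ⊗ₜ reg H.toQuasiBialgebra a := by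
    rw [← freeSection_tmul, freeProjLin_section]
  let _ := dualPairing W
  -- the universal map followed by the evaluation is the projection
  have he := LinearMap.congr_fun (congrArg Hom.lin (ofPairing_evaluation (freeProj W)))
    ((reg H.toQuasiBialgebra 1 ⊗ₜ[k] reg H.toQuasiBialgebra a) ⊗ₜ[k] ofFunctional ψ)
  have he' : ridEquiv (freeMod W) (TensorProduct.map LinearMap.id (evMap W)
      (reassocEquiv (freeMod W) W W.dual (freeFamilyRegLin W
        (reg H.toQuasiBialgebra 1 ⊗ₜ reg H.toQuasiBialgebra a) ⊗ₜ ofFunctional ψ))) =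
      toFree W (freeProjLin W ((reg H.toQuasiBialgebra 1 ⊗ₜ reg H.toQuasiBialgebra a) ⊗ₜ
      ofFunctional ψ)) := he
  rw [hp, hu, reassocEquiv_apply] at he'
  rw [muMap_tmul, map_mul, Module.End.mul_apply, hv, ← he']
  exact (evMap_act₃_freeCenter H.reassoc.val ψ v).symm

variable (H) in
/-- The map `x ↦ x v` for the generator `v` of the free object. -/
def toFreeCenterLin : Double H →ₗ[k] (freeCenter H).1 :=
  LinearMap.applyₗ (freeGen H) ∘ₗ (doubleVal H).toLinearMap

theorem doubleVal_injective : Function.Injective (doubleVal H) := Subtype.val_injective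

/-- An element of the double that kills the generator kills the free object, since the endomorphisms
of the free object in the centre move the generator to every vector. -/
theorem toFreeCenterLin_injective : Function.Injective (toFreeCenterLin H) := by
  rw [injective_iff_map_eq_zero]
  intro x hx
  have hx' : doubleVal H x (freeGen H) = 0 := hx
  apply doubleVal_injective
  apply LinearMap.ext
  intro z
  obtain ⟨f, rfl⟩ := exists_hom_freeCenter H _ z
  rw [← act_freeCenter, ← center_hom_act, act_freeCenter, hx']
  simp

theorem toFreeCenterLin_muMap (t : Module.Dual k A ⊗[k] A) :
    toFreeCenterLin H (muMap H (inclDouble H) (dualInclDouble H) t) =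
      toFree (regular H.toQuasiBialgebra)
        (TensorProduct.map LinearMap.id (reg H.toQuasiBialgebra).toLinearMap t) := by
  induction t with
  | zero => simp; rfl
  | add s t hs ht => rw [map_add, map_add, hs, ht, map_add, map_add]; rfl
  | tmul ψ a => exact muMap_freeGen ψ a

theorem toFreeCenterLin_comp_muMap_bijective :
    Function.Bijective (toFreeCenterLin H ∘ muMap H (inclDouble H) (dualInclDouble H)) := by
  have h := ((TensorProduct.congr (LinearEquiv.refl k (Module.Dual k A))
    (reg H.toQuasiBialgebra)).trans (toFree (regular H.toQuasiBialgebra))).bijective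
  have e : toFreeCenterLin H ∘ muMap H (inclDouble H) (dualInclDouble H) = fun t =>
      toFree (regular H.toQuasiBialgebra)
        (TensorProduct.map LinearMap.id (reg H.toQuasiBialgebra).toLinearMap t) :=
    funext toFreeCenterLin_muMap
  rw [e]
  exact h

theorem muMap_double_bijective :
    Function.Bijective (muMap H (inclDouble H) (dualInclDouble H)) := by
  have h := toFreeCenterLin_comp_muMap_bijective (H := H)
  refine ⟨h.1.of_comp, fun x => ?_⟩
  obtain ⟨t, ht⟩ := h.2 (toFreeCenterLin H x)
  exact ⟨t, toFreeCenterLin_injective ht⟩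

instance finiteDimensional_double : FiniteDimensional k (Double H) :=
  Module.Finite.of_surjective (muMap H (inclDouble H) (dualInclDouble H))
    muMap_double_bijective.2

variable (H) in
/-- The isomorphism `x ↦ x v` from the double to the free object, for its generator `v`. -/
def toFreeCenter : Double H ≃ₗ[k] (freeCenter H).1 :=
  LinearEquiv.ofBijective (toFreeCenterLin H) ⟨toFreeCenterLin_injective,
    toFreeCenterLin_comp_muMap_bijective.2.of_comp⟩

theorem toFreeCenter_one : toFreeCenter H 1 = freeGen H := rfl

theorem act_toFreeCenter (x y : Double H) :
    act (freeCenter H) x (toFreeCenter H y) = toFreeCenter H (x * y) := by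
  rw [act_freeCenter]; rfl

theorem inclDouble_injective : Function.Injective (inclDouble H) := by
  rw [injective_iff_map_eq_zero]
  intro a ha
  rw [← Module.forall_dual_apply_eq_zero_iff k]
  intro ψ
  have h : muMap H (inclDouble H) (dualInclDouble H) (ψ ⊗ₜ a) = 0 := by
    rw [muMap_tmul, ha, mul_zero]
  have h2 : ψ ⊗ₜ[k] a = 0 := muMap_double_bijective.1 (h.trans (map_zero _).symm)
  have h3 := congrArg (contractLeft k A) h2
  simpa using h3

end QuasiHopf
end MuMap

/-! ### Transport of tensor identities along homomorphisms -/

section Transfer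

open TensorProduct

namespace QuasiHopf

variable {k : Type u} [Field k] {A : Type v} [Ring A] [Algebra k A] {B : Type w} [Ring B]
  [Algebra k B]

/-- `f ⊗ f`. -/
abbrev map₂ (f : A →ₐ[k] B) : A ⊗[k] A →ₐ[k] B ⊗[k] B := Algebra.TensorProduct.map f f

/-- `f ⊗ f ⊗ f`. -/
abbrev map₃ (f : A →ₐ[k] B) : A ⊗[k] A ⊗[k] A →ₐ[k] B ⊗[k] B ⊗[k] B :=
  Algebra.TensorProduct.map (map₂ f) f

/-- `f ⊗ f ⊗ f ⊗ f`. -/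
abbrev map₄ (f : A →ₐ[k] B) : A ⊗[k] A ⊗[k] A ⊗[k] A →ₐ[k] B ⊗[k] B ⊗[k] B ⊗[k] B :=
  Algebra.TensorProduct.map (map₃ f) f

variable (f : A →ₐ[k] B)

/-- To compare linear maps on `A ⊗ A ⊗ A` it suffices to compare them on pure tensors. -/
theorem eq_on_tmul₃ {M : Type*} [AddCommGroup M] [Module k M] {F G : A ⊗[k] A ⊗[k] A →ₗ[k] M}
    (h : ∀ a b c, F (a ⊗ₜ b ⊗ₜ c) = G (a ⊗ₜ b ⊗ₜ c)) (t : A ⊗[k] A ⊗[k] A) : F t = G t := by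
  induction t with
  | zero => simp
  | add s t hs ht => rw [map_add, map_add, hs, ht]
  | tmul t c =>
  induction t with
  | zero => simp
  | add s t hs ht => rw [add_tmul, map_add, map_add, hs, ht]
  | tmul a b => exact h a b c

theorem perm213_map₃ (t : A ⊗[k] A ⊗[k] A) :
    perm213 k B (map₃ f t) = map₃ f (perm213 k A t) :=
  eq_on_tmul₃ (F := (perm213 k B).toLinearMap ∘ₗ (map₃ f).toLinearMap)
    (G := (map₃ f).toLinearMap ∘ₗ (perm213 k A).toLinearMap) (fun _ _ _ => rfl) t

theorem perm231_map₃ (t : A ⊗[k] A ⊗[k] A) :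
    perm231 k B (map₃ f t) = map₃ f (perm231 k A t) :=
  eq_on_tmul₃ (F := (perm231 k B).toLinearMap ∘ₗ (map₃ f).toLinearMap)
    (G := (map₃ f).toLinearMap ∘ₗ (perm231 k A).toLinearMap) (fun _ _ _ => rfl) t

theorem leg123_map₃ (t : A ⊗[k] A ⊗[k] A) :
    leg123 k B (map₃ f t) = map₄ f (leg123 k A t) := by
  simp [leg123]

theorem leg234_map₃ (t : A ⊗[k] A ⊗[k] A) :
    leg234 k B (map₃ f t) = map₄ f (leg234 k A t) :=
  eq_on_tmul₃ (M := B ⊗[k] B ⊗[k] B ⊗[k] B) (F := (leg234 k B).toLinearMap ∘ₗ (map₃ f).toLinearMap)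
    (G := (map₄ f).toLinearMap ∘ₗ (leg234 k A).toLinearMap) (fun a b c => by
      change leg234 k B (f a ⊗ₜ f b ⊗ₜ f c) = map₄ f (leg234 k A (a ⊗ₜ b ⊗ₜ c))
      rw [leg234_tmul, leg234_tmul]
      simp) t

theorem leg12_map₂ (t : A ⊗[k] A) : leg12 k B (map₂ f t) = map₃ f (leg12 k A t) := by
  simp [leg12]

theorem leg13_map₂ (t : A ⊗[k] A) : leg13 k B (map₂ f t) = map₃ f (leg13 k A t) := by
  induction t with
  | zero => simp
  | add s t hs ht => simp only [map_add, hs, ht]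
  | tmul a b => simp [leg13_tmul]

variable {f} {Δ : A →ₐ[k] A ⊗[k] A} {Δ' : B →ₐ[k] B ⊗[k] B}

theorem comulLeft_map₂ (h : ∀ a, Δ' (f a) = map₂ f (Δ a)) (t : A ⊗[k] A) :
    comulLeft Δ' (map₂ f t) = map₃ f (comulLeft Δ t) := by
  induction t with
  | zero => simp
  | add s t hs ht => simp only [map_add, hs, ht]
  | tmul a b => simp [comulLeft, h]

theorem rebracket_map (t : A ⊗[k] (A ⊗[k] A)) :
    rebracket k B (Algebra.TensorProduct.map f (map₂ f) t) = map₃ f (rebracket k A t) := by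
  induction t with
  | zero => simp
  | add s t hs ht => simp only [map_add, hs, ht]
  | tmul a t =>
  induction t with
  | zero => simp
  | add s t hs ht => simp only [tmul_add, map_add, hs, ht]
  | tmul b c => rfl

theorem comulRight_map₂ (h : ∀ a, Δ' (f a) = map₂ f (Δ a)) (t : A ⊗[k] A) :
    comulRight Δ' (map₂ f t) = map₃ f (comulRight Δ t) := by
  induction t with
  | zero => simp
  | add s t hs ht => simp only [map_add, hs, ht]
  | tmul a b =>
    simp only [comulRight, AlgHom.comp_apply, Algebra.TensorProduct.map_tmul, AlgHom.id_apply]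
    rw [h, ← rebracket_map]
    simp

theorem comul₁_map₃ (h : ∀ a, Δ' (f a) = map₂ f (Δ a)) (t : A ⊗[k] A ⊗[k] A) :
    comul₁ Δ' (map₃ f t) = map₄ f (comul₁ Δ t) := by
  induction t with
  | zero => simp
  | add s t hs ht => simp only [map_add, hs, ht]
  | tmul t c =>
    have := comulLeft_map₂ h t
    simp [comul₁, this]

theorem comul₂_map₃ (h : ∀ a, Δ' (f a) = map₂ f (Δ a)) (t : A ⊗[k] A ⊗[k] A) :
    comul₂ Δ' (map₃ f t) = map₄ f (comul₂ Δ t) := by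
  induction t with
  | zero => simp
  | add s t hs ht => simp only [map_add, hs, ht]
  | tmul t c =>
    have := comulRight_map₂ h t
    simp [comul₂, this]

theorem comul₃_map₃ (h : ∀ a, Δ' (f a) = map₂ f (Δ a)) (t : A ⊗[k] A ⊗[k] A) :
    comul₃ Δ' (map₃ f t) = map₄ f (comul₃ Δ t) := by
  have h1 : ∀ s : A ⊗[k] A ⊗[k] (A ⊗[k] A),
      (Algebra.TensorProduct.assoc k k k (B ⊗[k] B) B B).symm
        (Algebra.TensorProduct.map (map₂ f) (map₂ f) s) =
      map₄ f ((Algebra.TensorProduct.assoc k k k (A ⊗[k] A) A A).symm s) := by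
    intro s
    induction s with
    | zero => simp
    | add s t hs ht => simp only [map_add, hs, ht]
    | tmul a s =>
    induction s with
    | zero => simp
    | add s t hs ht => simp only [tmul_add, map_add, hs, ht]
    | tmul b c => simp
  induction t with
  | zero => simp
  | add s t hs ht => simp only [map_add, hs, ht]
  | tmul t c =>
    have h2 := h1 (t ⊗ₜ Δ c)
    simp only [Algebra.TensorProduct.map_tmul] at h2
    simp only [comul₃, AlgHom.comp_apply, Algebra.TensorProduct.map_tmul, AlgHom.id_apply]
    rw [h]
    exact h2

theorem pentagon_map (h : ∀ a, Δ' (f a) = map₂ f (Δ a)) {Φ : A ⊗[k] A ⊗[k] A}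
    (hΦ : comul₃ Δ Φ * comul₁ Δ Φ = leg234 k A Φ * comul₂ Δ Φ * leg123 k A Φ) :
    comul₃ Δ' (map₃ f Φ) * comul₁ Δ' (map₃ f Φ) =
      leg234 k B (map₃ f Φ) * comul₂ Δ' (map₃ f Φ) * leg123 k B (map₃ f Φ) := by
  rw [comul₃_map₃ h, comul₁_map₃ h, comul₂_map₃ h, leg234_map₃, leg123_map₃,
    ← map_mul, ← map_mul, ← map_mul, hΦ]

theorem counit_reassoc_map {ε : A →ₐ[k] k} {ε' : B →ₐ[k] k} (h : ∀ a, ε' (f a) = ε a)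
    (t : A ⊗[k] A ⊗[k] A) :
    Algebra.TensorProduct.map ((Algebra.TensorProduct.rid k k B).toAlgHom.comp
        (Algebra.TensorProduct.map (AlgHom.id k B) ε')) (AlgHom.id k B) (map₃ f t) =
      map₂ f (Algebra.TensorProduct.map ((Algebra.TensorProduct.rid k k A).toAlgHom.comp
        (Algebra.TensorProduct.map (AlgHom.id k A) ε)) (AlgHom.id k A) t) :=
  eq_on_tmul₃ (F := (Algebra.TensorProduct.map ((Algebra.TensorProduct.rid k k B).toAlgHom.comp
        (Algebra.TensorProduct.map (AlgHom.id k B) ε')) (AlgHom.id k B)).toLinearMap ∘ₗ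
          (map₃ f).toLinearMap)
    (G := (map₂ f).toLinearMap ∘ₗ (Algebra.TensorProduct.map
      ((Algebra.TensorProduct.rid k k A).toAlgHom.comp
        (Algebra.TensorProduct.map (AlgHom.id k A) ε)) (AlgHom.id k A)).toLinearMap)
        (fun a b c => by simp [h]) t

/-- `tensorAction` along two homomorphisms. -/
theorem tensorAction_map {M N : Type*} [AddCommGroup M]
    [Module k M] [AddCommGroup N] [Module k N] (ρ : B →ₐ[k] Module.End k M)
    (σ : B →ₐ[k] Module.End k N) (f : A →ₐ[k] B)
    (t : A ⊗[k] A) :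
    tensorAction ρ σ (map₂ f t) = tensorAction (ρ.comp f) (σ.comp f) t := by
  rw [tensorAction_comp]; rfl

end QuasiHopf
end Transfer

/-! ### The coproduct and the counit of the double -/

section DoubleBialgebra

open CategoryTheory MonoidalCategory TensorProduct

namespace QuasiHopf

variable {k : Type} [Field k] {A : Type u} [Ring A] [Algebra k A] [FiniteDimensional k A]
variable {H : QuasiHopfAlgebra k A}

open QMod

theorem exists_hom_apply (X : Center (QMod H.toQuasiBialgebra)) (x : X.1) :
    ∃ f : freeCenter H ⟶ X, ∀ y, f.f.lin (toFreeCenter H y) = act X y x := by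
  obtain ⟨f, hf⟩ := exists_hom_freeCenter H X x
  refine ⟨f, fun y => ?_⟩
  rw [← hf, ← center_hom_act, ← toFreeCenter_one, act_toFreeCenter, mul_one]

variable (H) in
/-- The isomorphism from `D ⊗ D` to the tensor square of the free object. -/
def toFree₂ : Double H ⊗[k] Double H ≃ₗ[k] (freeCenter H).1 ⊗[k] (freeCenter H).1 :=
  TensorProduct.congr (toFreeCenter H) (toFreeCenter H)

theorem toFree₂_tmul (x y : Double H) :
    toFree₂ H (x ⊗ₜ y) = toFreeCenter H x ⊗ₜ toFreeCenter H y := rfl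

theorem tensorAction_toFree₂ (s t : Double H ⊗[k] Double H) :
    tensorAction (act (freeCenter H)) (act (freeCenter H)) s (toFree₂ H t) =
      toFree₂ H (s * t) := by
  induction s with
  | zero => simp
  | add s s' hs hs' => simp only [map_add, LinearMap.add_apply, add_mul, hs, hs']
  | tmul x y =>
  induction t with
  | zero => simp
  | add s s' hs hs' => simp only [map_add, mul_add, hs, hs']
  | tmul x' y' =>
    rw [toFree₂_tmul, tensorAction_tmul, TensorProduct.map_tmul, act_toFreeCenter,
      act_toFreeCenter, ← toFree₂_tmul, Algebra.TensorProduct.tmul_mul_tmul]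

/-- The action on a tensor product of objects of the centre. -/
def actTensor (X Y : Center (QMod H.toQuasiBialgebra)) :
    Double H →ₐ[k] Module.End k (X.1 ⊗[k] Y.1) := act (X ⊗ Y)

/-- The underlying linear map of the coproduct of the double. -/
def comulElt (x : Double H) : Double H ⊗[k] Double H :=
  (toFree₂ H).symm (actTensor _ _ x (toFree₂ H 1))

theorem actTensor_one (x : Double H) :
    actTensor _ _ x (toFree₂ H 1) = toFree₂ H (comulElt x) := by
  rw [comulElt, LinearEquiv.apply_symm_apply]

theorem actTensor_apply {X Y : Center (QMod H.toQuasiBialgebra)} (x : Double H)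
    (t : X.1 ⊗[k] Y.1) :
    actTensor X Y x t = tensorAction (act X) (act Y) (comulElt x) t := by
  induction t with
  | zero => simp
  | add s s' hs hs' => simp only [map_add, hs, hs']
  | tmul p q =>
    obtain ⟨f, hf⟩ := exists_hom_apply X p
    obtain ⟨g, hg⟩ := exists_hom_apply Y q
    have h1 : ∀ s, TensorProduct.map f.f.lin g.f.lin (toFree₂ H s) =
        tensorAction (act X) (act Y) s (p ⊗ₜ q) := by
      intro s
      induction s with
      | zero => simp
      | add s s' hs hs' => simp only [map_add, LinearMap.add_apply, hs, hs']
      | tmul x y => rw [toFree₂_tmul, TensorProduct.map_tmul, hf, hg]; simp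
    have h2 : TensorProduct.map f.f.lin g.f.lin (actTensor _ _ x (toFree₂ H 1)) =
        actTensor X Y x (TensorProduct.map f.f.lin g.f.lin (toFree₂ H 1)) :=
      center_hom_act (f ⊗ₘ g) x (toFree₂ H 1)
    rw [actTensor_one, h1, h1, map_one] at h2
    exact h2.symm

variable (H) in
/-- The coproduct of the double. -/
def doubleComul : Double H →ₐ[k] Double H ⊗[k] Double H :=
  AlgHom.ofLinearMap ((toFree₂ H).symm.toLinearMap ∘ₗ LinearMap.applyₗ (toFree₂ H 1) ∘ₗ
    (actTensor (freeCenter H) (freeCenter H)).toLinearMap)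
    (by simp)
    (fun x y => by
      change comulElt (x * y) = comulElt x * comulElt y
      apply (toFree₂ H).injective
      rw [← actTensor_one, map_mul, Module.End.mul_apply, actTensor_one, actTensor_apply,
        tensorAction_toFree₂])

theorem actTensor_eq (X Y : Center (QMod H.toQuasiBialgebra)) :
    actTensor X Y = (tensorAction (act X) (act Y)).comp (doubleComul H) :=
  AlgHom.ext fun x => LinearMap.ext fun t => actTensor_apply x t

theorem act_comp_inclDouble (X : Center (QMod H.toQuasiBialgebra)) :
    (act X).comp (inclDouble H) = X.1.ρ := AlgHom.ext (act_inclDouble X)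

theorem doubleComul_inclDouble (a : A) :
    doubleComul H (inclDouble H a) = map₂ (inclDouble H) (H.comul a) := by
  apply (toFree₂ H).injective
  have h : toFree₂ H (doubleComul H (inclDouble H a)) =
    actTensor _ _ (inclDouble H a) (toFree₂ H 1) := (actTensor_one _).symm
  rw [h, ← mul_one (map₂ (inclDouble H) (H.comul a)), ← tensorAction_toFree₂, tensorAction_map,
    act_comp_inclDouble]
  exact LinearMap.congr_fun (act_inclDouble (freeCenter H ⊗ freeCenter H) a) _

/-- The action on the unit object of the centre. -/
def actUnit : Double H →ₐ[k] Module.End k (unit H.toQuasiBialgebra) :=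
  act (𝟙_ (Center (QMod H.toQuasiBialgebra)))

theorem actUnit_apply (x : Double H) (c : unit H.toQuasiBialgebra) : actUnit x c =
    unitEquiv _ (actUnit x ((unitEquiv _).symm 1)) • c := by
  obtain ⟨c, rfl⟩ := (unitEquiv H.toQuasiBialgebra).symm.surjective c
  apply (unitEquiv H.toQuasiBialgebra).injective
  conv_lhs => rw [← mul_one c, ← smul_eq_mul, map_smul, map_smul, map_smul]
  rw [map_smul, LinearEquiv.apply_symm_apply, smul_eq_mul, smul_eq_mul, mul_comm]

variable (H) in
/-- The counit of the double. -/
def doubleCounit : Double H →ₐ[k] k :=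
  AlgHom.ofLinearMap ((unitEquiv _).toLinearMap ∘ₗ
    LinearMap.applyₗ ((unitEquiv H.toQuasiBialgebra).symm 1) ∘ₗ actUnit.toLinearMap)
    (by simp)
    (fun x y => by
      change unitEquiv _ (actUnit (x * y) ((unitEquiv _).symm 1)) = _
      rw [map_mul, Module.End.mul_apply, actUnit_apply, map_smul, smul_eq_mul, mul_comm]
      rw [mul_comm]
      rfl)

theorem actUnit_eq (x : Double H) (c : unit H.toQuasiBialgebra) :
    actUnit x c = doubleCounit H x • c := actUnit_apply x c

theorem doubleCounit_inclDouble (a : A) : doubleCounit H (inclDouble H a) = H.counit a := by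
  change unitEquiv _ (act (𝟙_ (Center (QMod H.toQuasiBialgebra))) (inclDouble H a)
    ((unitEquiv _).symm 1)) = _
  rw [act_inclDouble]
  change unitEquiv _ ((unit _).ρ a ((unitEquiv _).symm 1)) = _
  rw [unit_ρ, map_smul, LinearEquiv.apply_symm_apply, smul_eq_mul, mul_one]

theorem lidEquiv_tensorAction (X : Center (QMod H.toQuasiBialgebra))
    (s : Double H ⊗[k] Double H) (t : unit H.toQuasiBialgebra ⊗[k] X.1) :
    lidEquiv X.1 (tensorAction actUnit (act X) s t) =
      act X (Algebra.TensorProduct.lid k _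
        (Algebra.TensorProduct.map (doubleCounit H) (AlgHom.id k _) s)) (lidEquiv X.1 t) := by
  induction s with
  | zero => simp
  | add s s' hs hs' => simp only [map_add, LinearMap.add_apply, hs, hs']
  | tmul x y =>
  induction t with
  | zero => simp
  | add s s' hs hs' => simp only [map_add, hs, hs']
  | tmul c z => simp [actUnit_eq, smul_smul, mul_comm]

theorem ridEquiv_tensorAction (X : Center (QMod H.toQuasiBialgebra))
    (s : Double H ⊗[k] Double H) (t : X.1 ⊗[k] unit H.toQuasiBialgebra) :
    ridEquiv X.1 (tensorAction (act X) actUnit s t) =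
      act X (Algebra.TensorProduct.rid k k _
        (Algebra.TensorProduct.map (AlgHom.id k _) (doubleCounit H) s)) (ridEquiv X.1 t) := by
  induction s with
  | zero => simp
  | add s s' hs hs' => simp only [map_add, LinearMap.add_apply, hs, hs']
  | tmul x y =>
  induction t with
  | zero => simp
  | add s s' hs hs' => simp only [map_add, hs, hs']
  | tmul c z => simp [actUnit_eq, smul_smul, mul_comm]

theorem doubleCounit_left (x : Double H) : Algebra.TensorProduct.lid k _
    (Algebra.TensorProduct.map (doubleCounit H) (AlgHom.id k _) (doubleComul H x)) = x := by
  apply (toFreeCenter H).injective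
  have h := center_hom_act (λ_ (freeCenter H)).hom x
    ((lidEquiv (freeCenter H).1).symm (toFreeCenter H 1))
  have h2 : lidEquiv (freeCenter H).1 (tensorAction actUnit (act (freeCenter H)) (comulElt x)
      ((lidEquiv (freeCenter H).1).symm (toFreeCenter H 1))) = act (freeCenter H) x
      (lidEquiv (freeCenter H).1 ((lidEquiv (freeCenter H).1).symm (toFreeCenter H 1))) :=
    (congrArg (lidEquiv (freeCenter H).1) (actTensor_apply x _).symm).trans h
  rw [LinearEquiv.apply_symm_apply, act_toFreeCenter, mul_one] at h2
  refine Eq.trans ?_ h2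
  have h3 := lidEquiv_tensorAction (freeCenter H) (comulElt x)
    ((lidEquiv (freeCenter H).1).symm (toFreeCenter H 1))
  rw [LinearEquiv.apply_symm_apply, act_toFreeCenter, mul_one] at h3
  exact h3.symm

theorem doubleCounit_right (x : Double H) : Algebra.TensorProduct.rid k k _
    (Algebra.TensorProduct.map (AlgHom.id k _) (doubleCounit H) (doubleComul H x)) = x := by
  apply (toFreeCenter H).injective
  have h := center_hom_act (ρ_ (freeCenter H)).hom x
    ((ridEquiv (freeCenter H).1).symm (toFreeCenter H 1))
  have h2 : ridEquiv (freeCenter H).1 (tensorAction (act (freeCenter H)) actUnit (comulElt x)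
      ((ridEquiv (freeCenter H).1).symm (toFreeCenter H 1))) = act (freeCenter H) x
      (ridEquiv (freeCenter H).1 ((ridEquiv (freeCenter H).1).symm (toFreeCenter H 1))) :=
    (congrArg (ridEquiv (freeCenter H).1) (actTensor_apply x _).symm).trans h
  rw [LinearEquiv.apply_symm_apply, act_toFreeCenter, mul_one] at h2
  refine Eq.trans ?_ h2
  have h3 := ridEquiv_tensorAction (freeCenter H) (comulElt x)
    ((ridEquiv (freeCenter H).1).symm (toFreeCenter H 1))
  rw [LinearEquiv.apply_symm_apply, act_toFreeCenter, mul_one] at h3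
  exact h3.symm

end QuasiHopf
end DoubleBialgebra

/-! ### The reassociator of the double -/

section DoubleRMatrix

open CategoryTheory MonoidalCategory TensorProduct

namespace QuasiHopf

variable {k : Type} [Field k] {A : Type u} [Ring A] [Algebra k A] [FiniteDimensional k A]
variable {H : QuasiHopfAlgebra k A}

open QMod

variable (H) in
/-- The isomorphism from `D ⊗ D ⊗ D` to the tensor cube of the free object. -/
def toFree₃ : Double H ⊗[k] Double H ⊗[k] Double H ≃ₗ[k]
    (freeCenter H).1 ⊗[k] (freeCenter H).1 ⊗[k] (freeCenter H).1 :=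
  TensorProduct.congr (toFree₂ H) (toFreeCenter H)

theorem toFree₃_tmul (t : Double H ⊗[k] Double H) (x : Double H) :
    toFree₃ H (t ⊗ₜ x) = toFree₂ H t ⊗ₜ toFreeCenter H x := rfl

/-- The action of `D ⊗ D ⊗ D` on the tensor cube of the free object. -/
def tripleAct : Double H ⊗[k] Double H ⊗[k] Double H →ₐ[k]
    Module.End k ((freeCenter H).1 ⊗[k] (freeCenter H).1 ⊗[k] (freeCenter H).1) :=
  tensorAction (tensorAction (act (freeCenter H)) (act (freeCenter H))) (act (freeCenter H))

theorem tripleAct_toFree₃ (s t : Double H ⊗[k] Double H ⊗[k] Double H) :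
    tripleAct s (toFree₃ H t) = toFree₃ H (s * t) := by
  induction s with
  | zero => simp
  | add s s' hs hs' => simp only [map_add, LinearMap.add_apply, add_mul, hs, hs']
  | tmul x y =>
  induction t with
  | zero => simp
  | add s s' hs hs' => simp only [map_add, mul_add, hs, hs']
  | tmul x' y' =>
    rw [tripleAct, toFree₃_tmul, tensorAction_tmul, TensorProduct.map_tmul, tensorAction_toFree₂,
      act_toFreeCenter, ← toFree₃_tmul, Algebra.TensorProduct.tmul_mul_tmul]

theorem act₃_freeCenter (t : A ⊗[k] A ⊗[k] A) :
    act₃ (freeCenter H).1 (freeCenter H).1 (freeCenter H).1 t =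
      tripleAct (map₃ (inclDouble H) t) := by
  have h := tensorAction_comp (tensorAction (act (freeCenter H)) (act (freeCenter H)))
    (act (freeCenter H)) (map₂ (inclDouble H)) (inclDouble H)
  have h2 := tensorAction_comp (act (freeCenter H))
    (act (freeCenter H)) (inclDouble H) (inclDouble H)
  rw [← h2, act_comp_inclDouble] at h
  exact (AlgHom.congr_fun h t)

theorem reassocEquiv_toFree₃ (t : Double H ⊗[k] Double H ⊗[k] Double H) :
    reassocEquiv (freeCenter H).1 (freeCenter H).1 (freeCenter H).1 (toFree₃ H t) =
      TensorProduct.assoc k _ _ _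
        (toFree₃ H (map₃ (inclDouble H) H.reassoc.val * t)) := by
  rw [reassocEquiv_apply, act₃_freeCenter, tripleAct_toFree₃]

theorem reassocEquiv_symm_toFree₃ (t : Double H ⊗[k] Double H ⊗[k] Double H) :
    (reassocEquiv (freeCenter H).1 (freeCenter H).1 (freeCenter H).1).symm
      (TensorProduct.assoc k _ _ _ (toFree₃ H t)) =
        toFree₃ H (map₃ (inclDouble H) (H.reassoc⁻¹).val * t) := by
  rw [reassocEquiv_symm_apply, act₃_freeCenter, LinearEquiv.symm_apply_apply, tripleAct_toFree₃]

theorem tensorAction_tensor_left (s : Double H ⊗[k] Double H)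
    (t : Double H ⊗[k] Double H ⊗[k] Double H) :
    tensorAction (actTensor (freeCenter H) (freeCenter H)) (act (freeCenter H)) s (toFree₃ H t) =
      toFree₃ H (comulLeft (doubleComul H) s * t) := by
  have h := tensorAction_comp (tensorAction (act (freeCenter H)) (act (freeCenter H)))
    (act (freeCenter H)) (doubleComul H) (AlgHom.id k (Double H))
  rw [← actTensor_eq, AlgHom.comp_id] at h
  exact (LinearMap.congr_fun (AlgHom.congr_fun h s) (toFree₃ H t)).trans
    (tripleAct_toFree₃ _ t)

theorem actTensor_tensor_left (x : Double H) :
    actTensor (freeCenter H ⊗ freeCenter H) (freeCenter H) x (toFree₃ H 1) =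
      toFree₃ H (comulLeft (doubleComul H) (doubleComul H x)) := by
  have h2 := AlgHom.congr_fun (actTensor_eq (freeCenter H ⊗ freeCenter H) (freeCenter H)) x
  have h3 := LinearMap.congr_fun h2 (toFree₃ H 1)
  refine h3.trans ((tensorAction_tensor_left (doubleComul H x) 1).trans ?_)
  rw [mul_one]

theorem tensorAction_tensor_right (s : Double H ⊗[k] Double H)
    (t : Double H ⊗[k] Double H ⊗[k] Double H) :
    tensorAction (act (freeCenter H)) (actTensor (freeCenter H) (freeCenter H)) s
      (TensorProduct.assoc k _ _ _ (toFree₃ H t)) =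
      TensorProduct.assoc k _ _ _ (toFree₃ H (comulRight (doubleComul H) s * t)) := by
  have h := tensorAction_comp (act (freeCenter H))
    (tensorAction (act (freeCenter H)) (act (freeCenter H))) (AlgHom.id k (Double H))
    (doubleComul H)
  rw [← actTensor_eq, AlgHom.comp_id] at h
  refine (LinearMap.congr_fun (AlgHom.congr_fun h s) _).trans ?_
  rw [← tripleAct_toFree₃]
  have h2 := assoc_comp_tensorAction (act (freeCenter H)) (act (freeCenter H)) (act (freeCenter H))
    (comulRight (doubleComul H) s) (toFree₃ H t)
  refine Eq.trans ?_ h2.symm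
  simp [comulRight, rebracket]

theorem double_quasi_coassoc (x : Double H) :
    comulRight (doubleComul H) (doubleComul H x) * map₃ (inclDouble H) H.reassoc.val =
      map₃ (inclDouble H) H.reassoc.val * comulLeft (doubleComul H) (doubleComul H x) := by
  have h := center_hom_act (α_ (freeCenter H) (freeCenter H) (freeCenter H)).hom x (toFree₃ H 1)
  have h1 : reassocEquiv (freeCenter H).1 (freeCenter H).1 (freeCenter H).1
      (actTensor (freeCenter H ⊗ freeCenter H) (freeCenter H) x (toFree₃ H 1)) =
      actTensor (freeCenter H) (freeCenter H ⊗ freeCenter H) x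
        (reassocEquiv (freeCenter H).1 (freeCenter H).1 (freeCenter H).1 (toFree₃ H 1)) := h
  rw [actTensor_tensor_left, reassocEquiv_toFree₃, reassocEquiv_toFree₃, mul_one] at h1
  have h2 := LinearMap.congr_fun (AlgHom.congr_fun
    (actTensor_eq (freeCenter H) (freeCenter H ⊗ freeCenter H)) x)
      (TensorProduct.assoc k _ _ _ (toFree₃ H (map₃ (inclDouble H) H.reassoc.val)))
  have h3 := h1.trans (h2.trans (tensorAction_tensor_right _ _))
  exact ((toFree₃ H).injective ((TensorProduct.assoc k _ _ _).injective h3)).symm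

variable (H) in
/-- The quasi-bialgebra structure of the double. -/
def doubleQuasiBialgebra : QuasiBialgebra k (Double H) where
  comul := doubleComul H
  counit := doubleCounit H
  reassoc := Units.map (map₃ (inclDouble H)).toMonoidHom H.reassoc
  quasi_coassoc := double_quasi_coassoc
  pentagon := pentagon_map doubleComul_inclDouble H.pentagon
  counit_left := doubleCounit_left
  counit_right := doubleCounit_right
  counit_reassoc := by
    have h := counit_reassoc_map (f := inclDouble H) doubleCounit_inclDouble H.reassoc.val
    rw [H.counit_reassoc, map_one] at h
    exact h

end QuasiHopf
end DoubleRMatrix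

/-! ### The R-matrix of the double -/

section DoubleQuasitriangular

open CategoryTheory MonoidalCategory TensorProduct

namespace QuasiHopf

section Perm

variable {k : Type u} [Field k] {A : Type v} [Ring A] [Algebra k A]

theorem perm213_perm213 (t : A ⊗[k] A ⊗[k] A) : perm213 k A (perm213 k A t) = t :=
  eq_on_tmul₃ (F := (perm213 k A).toLinearMap ∘ₗ (perm213 k A).toLinearMap)
    (G := LinearMap.id) (fun _ _ _ => rfl) t

theorem perm132_perm132 (t : A ⊗[k] A ⊗[k] A) : perm132 k A (perm132 k A t) = t :=
  eq_on_tmul₃ (F := (perm132 k A).toLinearMap ∘ₗ (perm132 k A).toLinearMap)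
    (G := LinearMap.id) (fun _ _ _ => rfl) t

theorem perm132_leg12 (t : A ⊗[k] A) : perm132 k A (leg12 k A t) = leg13 k A t := by
  induction t with
  | zero => simp
  | add s t hs ht => simp only [map_add, hs, ht]
  | tmul a b => rfl

theorem perm213_leg23 (t : A ⊗[k] A) : perm213 k A (leg23 k A t) = leg13 k A t := by
  induction t with
  | zero => simp
  | add s t hs ht => simp only [map_add, hs, ht]
  | tmul a b => rfl

theorem eq_of_perm231 {s Φ Φ' : A ⊗[k] A ⊗[k] A} {R : A ⊗[k] A}
    (h : perm231 k A s =
      Φ * perm213 k A (leg12 k A R * (Φ' * perm132 k A (leg23 k A R * Φ)))) :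
    s = perm312 k A Φ * leg13 k A R * perm132 k A Φ' * leg23 k A R * Φ := by
  have h1 : perm312 k A (perm231 k A s) = s := by
    simp only [perm312, perm231, AlgHom.comp_apply, perm213_perm213, perm132_perm132]
  rw [← h1, h]
  simp only [perm312, AlgHom.comp_apply, map_mul, perm213_perm213, perm132_perm132, perm132_leg12,
    mul_assoc]

theorem eq_of_perm312 {s Φ Φ' : A ⊗[k] A ⊗[k] A} {R : A ⊗[k] A}
    (h : perm312 k A s =
      Φ' * perm132 k A (leg23 k A R * (Φ * perm213 k A (leg12 k A R * Φ')))) :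
    s = perm231 k A Φ' * leg13 k A R * perm213 k A Φ * leg12 k A R * Φ' := by
  have h1 : perm231 k A (perm312 k A s) = s := by
    simp only [perm312, perm231, AlgHom.comp_apply, perm213_perm213, perm132_perm132]
  rw [← h1, h]
  simp only [perm231, AlgHom.comp_apply, map_mul, perm213_perm213, perm132_perm132, perm213_leg23,
    mul_assoc]

end Perm

variable {k : Type} [Field k] {A : Type u} [Ring A] [Algebra k A] [FiniteDimensional k A]
variable {H : QuasiHopfAlgebra k A}

open QMod

variable (H) in
/-- The R-matrix of the double. -/
abbrev doubleR : Double H ⊗[k] Double H := rMatrix (inclDouble H) (dualInclDouble H)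

theorem doubleR_eq : doubleR H = ∑ μ, inclDouble H (Module.finBasis k A μ) ⊗ₜ[k]
    dualInclDouble H ((Module.finBasis k A).coord μ) := rfl

/-- The half-braidings are given by the action of the R-matrix. -/
theorem halfBraidingLin_eq (X Y : Center (QMod H.toQuasiBialgebra)) (t : Y.1 ⊗[k] X.1) :
    halfBraidingLin (LaxHalfBraiding.ofCenter X) Y.1 t =
      TensorProduct.comm k _ _ (tensorAction (act Y) (act X) (doubleR H) t) := by
  induction t with
  | zero => simp
  | add s s' hs hs' => simp only [map_add, hs, hs']
  | tmul y x =>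
    rw [halfBraidingLin_tmul,
      ← sum_slice (Module.finBasis k A) (halfBraidingLin (LaxHalfBraiding.ofCenter X) _ _)]
    rw [doubleR_eq, map_sum, map_sum, LinearMap.sum_apply, map_sum]
    apply Finset.sum_congr rfl
    intro μ _
    rw [← dualAct_apply, TensorProduct.map_tmul, orbit_lin, tensorAction_tmul,
      TensorProduct.map_tmul, act_inclDouble, act_dualInclDouble]
    rfl

theorem comm_toFree₂ (t : Double H ⊗[k] Double H) :
    TensorProduct.comm k _ _ (toFree₂ H t) = toFree₂ H (Algebra.TensorProduct.comm k _ _ t) := by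
  induction t with
  | zero => simp
  | add s s' hs hs' => simp only [map_add, hs, hs']
  | tmul x y => rfl

/-- The half-braiding of the free object with itself. -/
def freeBraiding : (freeCenter H).1 ⊗[k] (freeCenter H).1 →ₗ[k]
    (freeCenter H).1 ⊗[k] (freeCenter H).1 :=
  halfBraidingLin (LaxHalfBraiding.ofCenter (freeCenter H)) (freeCenter H).1

theorem freeBraiding_toFree₂ (t : Double H ⊗[k] Double H) :
    freeBraiding (toFree₂ H t) =
      toFree₂ H (Algebra.TensorProduct.comm k _ _ (doubleR H * t)) := by
  rw [freeBraiding, halfBraidingLin_eq, tensorAction_toFree₂, comm_toFree₂]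

theorem freeBraiding_actTensor (x : Double H) (t : (freeCenter H).1 ⊗[k] (freeCenter H).1) :
    freeBraiding (actTensor (freeCenter H) (freeCenter H) x t) =
      actTensor (freeCenter H) (freeCenter H) x (freeBraiding t) := by
  have h := center_hom_act (β_ (freeCenter H) (freeCenter H)).inv x t
  have h1 : (β_ (freeCenter H) (freeCenter H)).inv.f =
      ((freeCenter H).2.β (freeCenter H).1).inv := IsIso.Iso.inv_hom _
  rw [h1] at h
  exact h

theorem double_flip (x : Double H) :
    Algebra.TensorProduct.comm k _ _ (doubleComul H x) * doubleR H =
      doubleR H * doubleComul H x := by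
  have h := freeBraiding_actTensor x (toFree₂ H 1)
  rw [actTensor_one, freeBraiding_toFree₂, freeBraiding_toFree₂, actTensor_apply,
    tensorAction_toFree₂, mul_one] at h
  have h1 := congrArg (Algebra.TensorProduct.comm k _ _) ((toFree₂ H).injective h)
  have h2 : ∀ t : Double H ⊗[k] Double H, Algebra.TensorProduct.comm k _ _
      (Algebra.TensorProduct.comm k _ _ t) = t := by
    intro t
    induction t with
    | zero => simp
    | add s s' hs hs' => simp only [map_add, hs, hs']
    | tmul x y => rfl
  rw [h2, map_mul, h2] at h1
  exact h1.symm

theorem freeBraiding_bijective : Function.Bijective (freeBraiding (H := H)) := by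
  have h : ∀ t, freeBraiding (H := H)
      (((freeCenter H).2.β (freeCenter H).1).hom.lin t) = t := fun t =>
    LinearMap.congr_fun (congrArg Hom.lin ((freeCenter H).2.β (freeCenter H).1).hom_inv_id) t
  have h' : ∀ t, ((freeCenter H).2.β (freeCenter H).1).hom.lin (freeBraiding (H := H) t) = t :=
    fun t =>
    LinearMap.congr_fun (congrArg Hom.lin ((freeCenter H).2.β (freeCenter H).1).inv_hom_id) t
  exact ⟨fun s t hst => by rw [← h' s, ← h' t, hst], fun t => ⟨_, h t⟩⟩

theorem double_isUnit : IsUnit (doubleR H) := by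
  have hb : Function.Bijective fun t => doubleR H * t := by
    have h : (fun t => doubleR H * t) = (Algebra.TensorProduct.comm k _ _).symm ∘
        (toFree₂ H).symm ∘ freeBraiding ∘ toFree₂ H := by
      ext t
      simp only [Function.comp_apply, freeBraiding_toFree₂, LinearEquiv.symm_apply_apply,
        AlgEquiv.symm_apply_apply]
    rw [h]
    exact (Algebra.TensorProduct.comm k _ _).symm.bijective.comp ((toFree₂ H).symm.bijective.comp
      (freeBraiding_bijective.comp (toFree₂ H).bijective))
  obtain ⟨t, ht⟩ := hb.2 1
  have ht' : doubleR H * t = 1 := ht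
  refine ⟨⟨doubleR H, t, ht', hb.1 ?_⟩, rfl⟩
  change doubleR H * (t * doubleR H) = doubleR H * 1
  rw [← mul_assoc, ht', one_mul, mul_one]

theorem map_freeBraiding_left (t : Double H ⊗[k] Double H ⊗[k] Double H) :
    TensorProduct.map freeBraiding LinearMap.id (toFree₃ H t) =
      toFree₃ H (perm213 k _ (leg12 k _ (doubleR H) * t)) := by
  induction t with
  | zero => simp
  | add s s' hs hs' => simp only [map_add, mul_add, hs, hs']
  | tmul t x =>
    rw [toFree₃_tmul, TensorProduct.map_tmul, freeBraiding_toFree₂, leg12,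
      Algebra.TensorProduct.includeLeft_apply, Algebra.TensorProduct.tmul_mul_tmul, one_mul]
    rfl

theorem map_freeBraiding_right (t : Double H ⊗[k] Double H ⊗[k] Double H) :
    TensorProduct.map LinearMap.id freeBraiding (TensorProduct.assoc k _ _ _ (toFree₃ H t)) =
      TensorProduct.assoc k _ _ _
        (toFree₃ H (perm132 k _ (leg23 k _ (doubleR H) * t))) := by
  induction t with
  | zero => simp
  | add s s' hs hs' => simp only [map_add, mul_add, hs, hs']
  | tmul t z =>
  induction t with
  | zero => simp
  | add s s' hs hs' => simp only [map_add, add_tmul, mul_add, hs, hs']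
  | tmul x y =>
    have h1 : TensorProduct.assoc k _ _ _ (toFree₃ H (x ⊗ₜ y ⊗ₜ z)) =
      toFreeCenter H x ⊗ₜ toFree₂ H (y ⊗ₜ z) := rfl
    rw [h1, TensorProduct.map_tmul, freeBraiding_toFree₂, LinearMap.id_apply]
    generalize doubleR H = R
    induction R with
    | zero => simp
    | add s s' hs hs' => simp only [map_add, add_mul, tmul_add, hs, hs']
    | tmul r s =>
      rw [leg23_tmul, Algebra.TensorProduct.tmul_mul_tmul, Algebra.TensorProduct.tmul_mul_tmul,
        Algebra.TensorProduct.tmul_mul_tmul, one_mul]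
      rfl

theorem comm_toFree₃ (t : Double H ⊗[k] Double H ⊗[k] Double H) :
    TensorProduct.comm k _ _ (toFree₃ H t) =
      TensorProduct.assoc k _ _ _ (toFree₃ H (perm231 k _ t)) :=
  eq_on_tmul₃ (F := (TensorProduct.comm k _ _).toLinearMap ∘ₗ (toFree₃ H).toLinearMap)
    (G := (TensorProduct.assoc k _ _ _).toLinearMap ∘ₗ (toFree₃ H).toLinearMap ∘ₗ
      (perm231 k _).toLinearMap) (fun _ _ _ => rfl) t

theorem comm_assoc_toFree₃ (t : Double H ⊗[k] Double H ⊗[k] Double H) :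
    TensorProduct.comm k _ _ (TensorProduct.assoc k _ _ _ (toFree₃ H t)) =
      toFree₃ H (perm312 k _ t) :=
  eq_on_tmul₃ (F := (TensorProduct.comm k _ _).toLinearMap ∘ₗ
    (TensorProduct.assoc k _ _ _).toLinearMap ∘ₗ (toFree₃ H).toLinearMap)
    (G := (toFree₃ H).toLinearMap ∘ₗ (perm312 k _).toLinearMap) (fun _ _ _ => rfl) t

theorem double_hexagon_left :
    comulLeft (doubleComul H) (doubleR H) =
      perm312 k _ (map₃ (inclDouble H) H.reassoc.val) * leg13 k _ (doubleR H) *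
        perm132 k _ (map₃ (inclDouble H) (H.reassoc⁻¹).val) *
        leg23 k _ (doubleR H) * map₃ (inclDouble H) H.reassoc.val := by
  apply eq_of_perm231
  have h := LinearMap.congr_fun (congrArg Hom.lin ((LaxHalfBraiding.ofCenter (freeCenter H)).tensor
    (freeCenter H).1 (freeCenter H).1)) (toFree₃ H 1)
  have h1 : halfBraidingLin (LaxHalfBraiding.ofCenter (freeCenter H))
      (freeCenter H ⊗ freeCenter H).1 (toFree₃ H 1) =
      reassocEquiv _ _ _ (TensorProduct.map freeBraiding LinearMap.id
        ((reassocEquiv (freeCenter H).1 (freeCenter H).1 (freeCenter H).1).symm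
          (TensorProduct.map LinearMap.id freeBraiding
            (reassocEquiv (freeCenter H).1 (freeCenter H).1 (freeCenter H).1 (toFree₃ H 1))))) := h
  rw [reassocEquiv_toFree₃, map_freeBraiding_right, reassocEquiv_symm_toFree₃,
    map_freeBraiding_left, reassocEquiv_toFree₃, mul_one] at h1
  have h2 := halfBraidingLin_eq (freeCenter H) (freeCenter H ⊗ freeCenter H) (toFree₃ H 1)
  have h3 := tensorAction_tensor_left (doubleR H) 1
  have h4 := (comm_toFree₃ (comulLeft (doubleComul H) (doubleR H) * 1)).symm.trans
    ((congrArg (TensorProduct.comm k _ _) h3.symm).trans (h2.symm.trans h1))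
  rw [mul_one] at h4
  exact (toFree₃ H).injective ((TensorProduct.assoc k _ _ _).injective h4)

theorem double_hexagon_right :
    comulRight (doubleComul H) (doubleR H) =
      perm231 k _ (map₃ (inclDouble H) (H.reassoc⁻¹).val) * leg13 k _ (doubleR H) *
        perm213 k _ (map₃ (inclDouble H) H.reassoc.val) *
        leg12 k _ (doubleR H) * map₃ (inclDouble H) (H.reassoc⁻¹).val := by
  apply eq_of_perm312
  -- the half-braiding of a tensor product in the centre is composed of those of the factors
  have h1 : halfBraidingLin (LaxHalfBraiding.ofCenter (freeCenter H ⊗ freeCenter H))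
      (freeCenter H).1 (TensorProduct.assoc k _ _ _ (toFree₃ H 1)) =
      (reassocEquiv _ _ _).symm (TensorProduct.map LinearMap.id freeBraiding
        (reassocEquiv (freeCenter H).1 (freeCenter H).1 (freeCenter H).1
          (TensorProduct.map freeBraiding LinearMap.id
            ((reassocEquiv (freeCenter H).1 (freeCenter H).1 (freeCenter H).1).symm
              (TensorProduct.assoc k _ _ _ (toFree₃ H 1)))))) := rfl
  rw [reassocEquiv_symm_toFree₃, map_freeBraiding_left, reassocEquiv_toFree₃,
    map_freeBraiding_right, reassocEquiv_symm_toFree₃, mul_one] at h1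
  have h2 := halfBraidingLin_eq (freeCenter H ⊗ freeCenter H) (freeCenter H)
    (TensorProduct.assoc k _ _ _ (toFree₃ H 1))
  have h3 := tensorAction_tensor_right (doubleR H) 1
  have h4 := (comm_assoc_toFree₃ (comulRight (doubleComul H) (doubleR H) * 1)).symm.trans
    ((congrArg (TensorProduct.comm k _ _) h3.symm).trans (h2.symm.trans h1))
  rw [mul_one] at h4
  exact (toFree₃ H).injective h4

end QuasiHopf
end DoubleQuasitriangular

/-! ### The antipode of the double -/

section DoubleAntipode

open CategoryTheory MonoidalCategory TensorProduct

namespace QuasiHopf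

variable {k : Type} [Field k] {A : Type u} [Ring A] [Algebra k A] [FiniteDimensional k A]
variable {H : QuasiHopfAlgebra k A}

open QMod

instance finiteDimensional_freeCenter : FiniteDimensional k (freeCenter H).1 :=
  Module.Finite.equiv (toFreeCenter H)

/-- The left dual of a finite-dimensional object of the centre. -/
def dualCenter (X : Center (QMod H.toQuasiBialgebra)) [FiniteDimensional k X.1] :
    Center (QMod H.toQuasiBialgebra) :=
  letI := dualPairing X.1
  leftDualCenter X X.1.dual (fun U => isIso_halfBraiding _ U)

instance (X : Center (QMod H.toQuasiBialgebra)) [FiniteDimensional k X.1] :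
    FiniteDimensional k (dualCenter X).1 :=
  inferInstanceAs (FiniteDimensional k X.1.dual)

/-- The duality of an object of the centre and its left dual. -/
@[reducible]
def dualCenterPairing (X : Center (QMod H.toQuasiBialgebra)) [FiniteDimensional k X.1] :
    ExactPairing (dualCenter X) X :=
  letI := dualPairing X.1
  leftDualPairing X X.1.dual (fun U => isIso_halfBraiding _ U)

/-- The action of the double on the dual of an object of the centre. -/
def actDual (X : Center (QMod H.toQuasiBialgebra)) [FiniteDimensional k X.1] :
    Double H →ₐ[k] Module.End k X.1.dual := act (dualCenter X)

theorem actDual_inclDouble (X : Center (QMod H.toQuasiBialgebra)) [FiniteDimensional k X.1]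
    (a : A) : actDual X (inclDouble H a) = X.1.dual.ρ a := act_inclDouble (dualCenter X) a

theorem transpose_actDual {X Y : Center (QMod H.toQuasiBialgebra)} [FiniteDimensional k X.1]
    [FiniteDimensional k Y.1] (f : X ⟶ Y) (x : Double H) (m : Y.1.dual) :
    (transpose f.f).lin (actDual Y x m) = actDual X x ((transpose f.f).lin m) := by
  let _ := dualCenterPairing X
  let _ := dualCenterPairing Y
  obtain ⟨g, hg⟩ := exists_center_transpose (P := dualCenter X) (P' := dualCenter Y) f
    (transpose f.f) (transpose_ev f.f)
  have h := center_hom_act g x m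
  rw [hg] at h
  exact h

/-- The inverse antipode of the double as a linear map: the double acts on the dual of the free
object by the transpose of `S⁻¹(x)`. -/
def antipodeInvLin : Double H →ₗ[k] Double H :=
  (toFreeCenter H).symm.toLinearMap ∘ₗ (Module.evalEquiv k (freeCenter H).1).symm.toLinearMap ∘ₗ
    (pair (freeCenter H).1).symm.toLinearMap.dualMap ∘ₗ
    (LinearMap.compRight k (LinearMap.applyₗ (toFreeCenter H 1) ∘ₗ
      (pair (freeCenter H).1).toLinearMap)) ∘ₗ (actDual (freeCenter H)).toLinearMap

theorem pair_antipodeInvLin (x : Double H) (m : (freeCenter H).1.dual) :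
    pair _ m (toFreeCenter H (antipodeInvLin x)) = pair _ (actDual _ x m) (toFreeCenter H 1) := by
  rw [antipodeInvLin]
  simp only [LinearMap.comp_apply, LinearEquiv.coe_coe, LinearEquiv.apply_symm_apply]
  rw [Module.apply_evalEquiv_symm_apply]
  simp

theorem pair_actDual (X : Center (QMod H.toQuasiBialgebra)) [FiniteDimensional k X.1]
    (x : Double H) (m : X.1.dual) (z : X.1) :
    pair _ (actDual X x m) z = pair _ m (act X (antipodeInvLin x) z) := by
  obtain ⟨f, hf⟩ := exists_hom_apply X z
  have h1 : f.f.lin (toFreeCenter H 1) = z := by rw [hf]; simp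
  rw [← hf, ← pair_transpose, pair_antipodeInvLin, ← transpose_actDual, pair_transpose, h1]

theorem antipodeInvLin_mul (x y : Double H) :
    antipodeInvLin (x * y) = antipodeInvLin y * antipodeInvLin x := by
  apply (toFreeCenter H).injective
  apply eq_of_pair
  intro m
  rw [pair_antipodeInvLin, map_mul, Module.End.mul_apply, pair_actDual, pair_actDual,
    act_toFreeCenter, mul_one, act_toFreeCenter]

theorem antipodeInvLin_inclDouble (a : A) :
    antipodeInvLin (inclDouble H a) = inclDouble H (H.antipode.symm a) := by
  apply (toFreeCenter H).injective
  apply eq_of_pair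
  intro m
  rw [pair_antipodeInvLin, actDual_inclDouble, pair_ρ, ← act_inclDouble, act_toFreeCenter, mul_one]

/-- If `S⁻¹(x) = 0` then `x` acts by zero on all duals of finite-dimensional objects. The free object
is such a dual, because the centre is braided and so left duals are right duals. -/
theorem antipodeInvLin_injective : Function.Injective (antipodeInvLin (H := H)) := by
  rw [injective_iff_map_eq_zero]
  intro x hx
  have h0 : ∀ (X : Center (QMod H.toQuasiBialgebra)) [FiniteDimensional k X.1],
      actDual X x = 0 := by
    intro X _
    apply LinearMap.ext
    intro m
    apply (pair X.1).injective
    apply LinearMap.ext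
    intro z
    rw [pair_actDual, hx]
    simp
  let _ := dualCenterPairing (freeCenter H)
  let e : freeCenter H ≅ dualCenter (dualCenter (freeCenter H)) :=
    leftDualIso (BraidedCategory.exactPairing_swap (dualCenter (freeCenter H)) (freeCenter H))
      (dualCenterPairing (dualCenter (freeCenter H)))
  have h1 := center_hom_act e.hom x (toFreeCenter H 1)
  have h2 : act (dualCenter (dualCenter (freeCenter H))) x = 0 := h0 (dualCenter (freeCenter H))
  rw [act_toFreeCenter, mul_one, h2, LinearMap.zero_apply] at h1
  have h3 := LinearMap.congr_fun (congrArg Hom.lin (congrArg Center.Hom.f e.hom_inv_id))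
    (toFreeCenter H x)
  have h4 : e.inv.f.lin (e.hom.f.lin (toFreeCenter H x)) = toFreeCenter H x := h3
  rw [h1, map_zero] at h4
  exact (LinearEquiv.map_eq_zero_iff _).1 h4.symm

variable (H) in
/-- The antipode of the double. -/
def doubleAntipode : Double H ≃ₗ[k] Double H :=
  (LinearEquiv.ofInjectiveEndo antipodeInvLin antipodeInvLin_injective).symm

theorem doubleAntipode_symm_apply (x : Double H) :
    (doubleAntipode H).symm x = antipodeInvLin x := rfl

theorem antipodeInvLin_doubleAntipode (x : Double H) :
    antipodeInvLin (doubleAntipode H x) = x :=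
  (doubleAntipode H).symm_apply_apply x

theorem doubleAntipode_mul (x y : Double H) :
    doubleAntipode H (x * y) = doubleAntipode H y * doubleAntipode H x := by
  apply (doubleAntipode H).symm.injective
  rw [LinearEquiv.symm_apply_apply, doubleAntipode_symm_apply, antipodeInvLin_mul,
    antipodeInvLin_doubleAntipode, antipodeInvLin_doubleAntipode]

theorem doubleAntipode_inclDouble (a : A) :
    doubleAntipode H (inclDouble H a) = inclDouble H (H.antipode a) := by
  apply (doubleAntipode H).symm.injective
  rw [LinearEquiv.symm_apply_apply, doubleAntipode_symm_apply, antipodeInvLin_inclDouble,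
    LinearEquiv.symm_apply_apply]

theorem evMap_tensorAction (s : Double H ⊗[k] Double H) (m : (freeCenter H).1.dual) :
    unitEquiv _ (evMap (freeCenter H).1 (tensorAction (act (freeCenter H))
      (actDual (freeCenter H)) s (toFreeCenter H 1 ⊗ₜ m))) =
    pair _ m (toFreeCenter H (antipodeInvLin (LinearMap.mul' k _
      (TensorProduct.map (LinearMap.mulRight k (inclDouble H H.alpha) ∘ₗ
        (doubleAntipode H).toLinearMap) LinearMap.id s)))) := by
  induction s with
  | zero => simp
  | add s s' hs hs' => simp only [map_add, LinearMap.add_apply, hs, hs']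
  | tmul x y =>
    rw [tensorAction_tmul, TensorProduct.map_tmul, evMap_tmul, LinearEquiv.apply_symm_apply,
      pair_actDual, ← act_inclDouble, act_toFreeCenter, act_toFreeCenter, act_toFreeCenter]
    simp only [TensorProduct.map_tmul, LinearMap.comp_apply, LinearEquiv.coe_coe,
      LinearMap.mul'_apply, LinearMap.mulRight_apply, LinearMap.id_apply, antipodeInvLin_mul,
      antipodeInvLin_doubleAntipode, antipodeInvLin_inclDouble, mul_one]

theorem doubleAntipode_alpha (x : Double H) :
    LinearMap.mul' k _ (TensorProduct.map (LinearMap.mulRight k (inclDouble H H.alpha) ∘ₗ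
        (doubleAntipode H).toLinearMap) LinearMap.id (doubleComul H x)) =
      doubleCounit H x • inclDouble H H.alpha := by
  apply antipodeInvLin_injective
  apply (toFreeCenter H).injective
  apply eq_of_pair
  intro m
  rw [← evMap_tensorAction]
  let _ := dualCenterPairing (freeCenter H)
  have h := center_hom_act (ExactPairing.evaluation (dualCenter (freeCenter H)) (freeCenter H)) x
    (toFreeCenter H 1 ⊗ₜ[k] m)
  have h1 : evMap (freeCenter H).1 (actTensor (freeCenter H) (dualCenter (freeCenter H)) x
      (toFreeCenter H 1 ⊗ₜ[k] m)) = actUnit x (evMap (freeCenter H).1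
        (toFreeCenter H 1 ⊗ₜ[k] m)) := h
  have h2 : evMap (freeCenter H).1 (tensorAction (act (freeCenter H)) (actDual (freeCenter H))
      (doubleComul H x) (toFreeCenter H 1 ⊗ₜ[k] m)) = actUnit x (evMap (freeCenter H).1
        (toFreeCenter H 1 ⊗ₜ[k] m)) :=
    (congrArg (evMap (freeCenter H).1) (actTensor_apply x _).symm).trans h1
  rw [h2, actUnit_eq, map_smul, evMap_tmul, LinearEquiv.apply_symm_apply, ← act_inclDouble,
    act_toFreeCenter, mul_one, map_smul, map_smul, map_smul, antipodeInvLin_inclDouble]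

theorem dualTensorEquiv_tensorAction (s : Double H ⊗[k] Double H) :
    dualTensorEquiv (freeCenter H).1 (tensorAction (actDual (freeCenter H))
      (act (freeCenter H)) s (coevElt (freeCenter H).1)) (toFreeCenter H 1) =
    toFreeCenter H (antipodeInvLin (LinearMap.mul' k _
      (TensorProduct.map (LinearMap.mulRight k (inclDouble H H.beta))
        (doubleAntipode H).toLinearMap s))) := by
  induction s with
  | zero => simp
  | add s s' hs hs' => simp only [map_add, LinearMap.add_apply, hs, hs']
  | tmul x y =>
    have h : ∀ t, dualTensorEquiv (freeCenter H).1 (tensorAction (actDual (freeCenter H))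
        (act (freeCenter H)) (x ⊗ₜ y) t) (toFreeCenter H 1) =
        act (freeCenter H) y (dualTensorEquiv (freeCenter H).1 t
          (act (freeCenter H) (antipodeInvLin x) (toFreeCenter H 1))) := by
      intro t
      induction t with
      | zero => simp
      | add s s' hs hs' => simp only [map_add, LinearMap.add_apply, hs, hs']
      | tmul m z =>
        rw [tensorAction_tmul, TensorProduct.map_tmul, dualTensorEquiv_tmul, pair_actDual,
          dualTensorEquiv_tmul, map_smul]
    rw [h, coevElt, LinearEquiv.apply_symm_apply, ← act_inclDouble, act_toFreeCenter,
      act_toFreeCenter, act_toFreeCenter]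
    simp only [TensorProduct.map_tmul, LinearEquiv.coe_coe,
      LinearMap.mul'_apply, LinearMap.mulRight_apply, antipodeInvLin_mul,
      antipodeInvLin_doubleAntipode, antipodeInvLin_inclDouble, mul_one]

theorem doubleAntipode_beta (x : Double H) :
    LinearMap.mul' k _ (TensorProduct.map (LinearMap.mulRight k (inclDouble H H.beta))
        (doubleAntipode H).toLinearMap (doubleComul H x)) =
      doubleCounit H x • inclDouble H H.beta := by
  apply antipodeInvLin_injective
  apply (toFreeCenter H).injective
  rw [← dualTensorEquiv_tensorAction]
  let _ := dualCenterPairing (freeCenter H)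
  have h := center_hom_act (ExactPairing.coevaluation (dualCenter (freeCenter H)) (freeCenter H)) x
    ((unitEquiv H.toQuasiBialgebra).symm 1)
  have h0 : (coev (freeCenter H).1).lin ((unitEquiv H.toQuasiBialgebra).symm 1) =
      coevElt (freeCenter H).1 := by
    rw [coev_lin, LinearEquiv.apply_symm_apply, one_smul]
  have h1 : (coev (freeCenter H).1).lin (actUnit x ((unitEquiv H.toQuasiBialgebra).symm 1)) =
      actTensor (dualCenter (freeCenter H)) (freeCenter H) x
        ((coev (freeCenter H).1).lin ((unitEquiv H.toQuasiBialgebra).symm 1)) := h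
  rw [h0, actUnit_eq, map_smul, h0] at h1
  have h2 : tensorAction (actDual (freeCenter H)) (act (freeCenter H))
      (doubleComul H x) (coevElt (freeCenter H).1) = doubleCounit H x • coevElt (freeCenter H).1 :=
    (actTensor_apply x _).symm.trans h1.symm
  rw [h2, map_smul, LinearMap.smul_apply, coevElt, LinearEquiv.apply_symm_apply, ← act_inclDouble,
    act_toFreeCenter, mul_one, map_smul, map_smul, antipodeInvLin_inclDouble]

variable (H) in
/-- The quasi-Hopf algebra structure of the double. -/
def doubleQuasiHopf : QuasiHopfAlgebra k (Double H) where
  toQuasiBialgebra := doubleQuasiBialgebra H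
  antipode := doubleAntipode H
  alpha := inclDouble H H.alpha
  beta := inclDouble H H.beta
  antipode_mul := doubleAntipode_mul
  antipode_alpha := doubleAntipode_alpha
  antipode_beta := doubleAntipode_beta
  reassoc_antipode := by
    have h : ∀ t : A ⊗[k] A ⊗[k] A, LinearMap.mul' k (Double H)
      (TensorProduct.map
        (LinearMap.mul' k (Double H) ∘ₗ
          TensorProduct.map (LinearMap.mulRight k (inclDouble H H.beta))
            (LinearMap.mulRight k (inclDouble H H.alpha) ∘ₗ (doubleAntipode H).toLinearMap))
        LinearMap.id (map₃ (inclDouble H) t)) = inclDouble H (LinearMap.mul' k A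
      (TensorProduct.map
        (LinearMap.mul' k A ∘ₗ
          TensorProduct.map (LinearMap.mulRight k H.beta)
            (LinearMap.mulRight k H.alpha ∘ₗ H.antipode.toLinearMap))
        LinearMap.id t)) := by
      intro t
      induction t with
      | zero => simp
      | add s t hs ht => simp only [map_add, hs, ht]
      | tmul t c =>
      induction t with
      | zero => simp
      | add s t hs ht => simp only [map_add, add_tmul, hs, ht]
      | tmul a b => simp [doubleAntipode_inclDouble]
    exact (h H.reassoc.val).trans (by rw [H.reassoc_antipode, map_one])
  reassoc_inv_antipode := by
    have h : ∀ t : A ⊗[k] A ⊗[k] A, LinearMap.mul' k (Double H)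
      (TensorProduct.map
        (LinearMap.mul' k (Double H) ∘ₗ
          TensorProduct.map (LinearMap.mulRight k (inclDouble H H.alpha) ∘ₗ
            (doubleAntipode H).toLinearMap) (LinearMap.mulRight k (inclDouble H H.beta)))
        (doubleAntipode H).toLinearMap (map₃ (inclDouble H) t)) =
      inclDouble H (LinearMap.mul' k A
      (TensorProduct.map
        (LinearMap.mul' k A ∘ₗ
          TensorProduct.map (LinearMap.mulRight k H.alpha ∘ₗ H.antipode.toLinearMap)
            (LinearMap.mulRight k H.beta))
        H.antipode.toLinearMap t)) := by
      intro t
      induction t with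
      | zero => simp
      | add s t hs ht => simp only [map_add, hs, ht]
      | tmul t c =>
      induction t with
      | zero => simp
      | add s t hs ht => simp only [map_add, add_tmul, hs, ht]
      | tmul a b => simp [doubleAntipode_inclDouble]
    exact (h (H.reassoc⁻¹).val).trans (by rw [H.reassoc_inv_antipode, map_one])

/-- The double is an extension with quasitriangular R-matrix. -/
theorem isDoubleExtension_double :
    IsDoubleExtension H (doubleQuasiHopf H) (inclDouble H) (dualInclDouble H) where
  isHom :=
    { map_comul := doubleComul_inclDouble
      map_counit := doubleCounit_inclDouble
      map_reassoc := rfl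
      map_antipode := doubleAntipode_inclDouble
      map_alpha := rfl
      map_beta := rfl }
  injective := inclDouble_injective
  generates := adjoin_double H
  quasitriangular :=
    { isUnit := double_isUnit
      flip := double_flip
      hexagon_left := double_hexagon_left
      hexagon_right := double_hexagon_right }

end QuasiHopf
end DoubleAntipode

/-! ### The regular module of an extension -/

section ExtensionModule

open CategoryTheory MonoidalCategory TensorProduct

namespace QuasiHopf

variable {k : Type} [Field k] {A : Type u} [Ring A] [Algebra k A]

namespace QMod

variable {H : QuasiBialgebra k A} {E : Type u} [Ring E] [Algebra k E] (j : A →ₐ[k] E)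

variable (H) in
/-- The action of an algebra `E` with a homomorphism `A → E` on the `A`-module `E`. -/
def lmulMod : E →ₐ[k] Module.End k (ofAlgHom H j) := Algebra.lmul k E

theorem lmulMod_toMod (x y : E) : lmulMod H j x (toMod H j y) = toMod H j (x * y) := rfl

variable (H) in
/-- The identification of `E ⊗ E` with the tensor square of the module `E`. -/
def toMod₂ : E ⊗[k] E ≃ₗ[k] ofAlgHom H j ⊗[k] ofAlgHom H j :=
  TensorProduct.congr (toMod H j) (toMod H j)

variable (H) in
/-- The identification of `E ⊗ E ⊗ E` with the tensor cube of the module `E`. -/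
def toMod₃ : E ⊗[k] E ⊗[k] E ≃ₗ[k] ofAlgHom H j ⊗[k] ofAlgHom H j ⊗[k] ofAlgHom H j :=
  TensorProduct.congr (toMod₂ H j) (toMod H j)

theorem toMod₂_tmul (x y : E) : toMod₂ H j (x ⊗ₜ y) = toMod H j x ⊗ₜ toMod H j y := rfl

theorem toMod₃_tmul (t : E ⊗[k] E) (x : E) :
    toMod₃ H j (t ⊗ₜ x) = toMod₂ H j t ⊗ₜ toMod H j x := rfl

variable (H) in
/-- The action of `E ⊗ E` on the tensor square of the module `E`. -/
def lmulMod₂ : E ⊗[k] E →ₐ[k] Module.End k (ofAlgHom H j ⊗[k] ofAlgHom H j) :=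
  tensorAction (lmulMod H j) (lmulMod H j)

variable (H) in
/-- The action of `E ⊗ E ⊗ E` on the tensor cube of the module `E`. -/
def lmulMod₃ : E ⊗[k] E ⊗[k] E →ₐ[k]
    Module.End k (ofAlgHom H j ⊗[k] ofAlgHom H j ⊗[k] ofAlgHom H j) :=
  tensorAction (lmulMod₂ H j) (lmulMod H j)

theorem lmulMod₂_toMod₂ (s t : E ⊗[k] E) :
    lmulMod₂ H j s (toMod₂ H j t) = toMod₂ H j (s * t) := by
  induction s with
  | zero => simp
  | add s s' hs hs' => simp only [map_add, LinearMap.add_apply, add_mul, hs, hs']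
  | tmul x y =>
  induction t with
  | zero => simp
  | add s s' hs hs' => simp only [map_add, mul_add, hs, hs']
  | tmul x' y' =>
    rw [lmulMod₂, toMod₂_tmul, tensorAction_tmul, TensorProduct.map_tmul, lmulMod_toMod,
      lmulMod_toMod, ← toMod₂_tmul, Algebra.TensorProduct.tmul_mul_tmul]

theorem lmulMod₃_toMod₃ (s t : E ⊗[k] E ⊗[k] E) :
    lmulMod₃ H j s (toMod₃ H j t) = toMod₃ H j (s * t) := by
  induction s with
  | zero => simp
  | add s s' hs hs' => simp only [map_add, LinearMap.add_apply, add_mul, hs, hs']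
  | tmul x y =>
  induction t with
  | zero => simp
  | add s s' hs hs' => simp only [map_add, mul_add, hs, hs']
  | tmul x' y' =>
    rw [lmulMod₃, toMod₃_tmul, tensorAction_tmul, TensorProduct.map_tmul, lmulMod₂_toMod₂,
      lmulMod_toMod, ← toMod₃_tmul, Algebra.TensorProduct.tmul_mul_tmul]

theorem act₂_ofAlgHom (t : A ⊗[k] A) :
    act₂ (ofAlgHom H j) (ofAlgHom H j) t = lmulMod₂ H j (map₂ j t) :=
  AlgHom.congr_fun (tensorAction_comp (lmulMod H j) (lmulMod H j) j j) t

theorem act₃_ofAlgHom (t : A ⊗[k] A ⊗[k] A) :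
    act₃ (ofAlgHom H j) (ofAlgHom H j) (ofAlgHom H j) t = lmulMod₃ H j (map₃ j t) := by
  have h := tensorAction_comp (lmulMod₂ H j) (lmulMod H j) (map₂ j) j
  have h2 : (lmulMod₂ H j).comp (map₂ j) = act₂ (ofAlgHom H j) (ofAlgHom H j) :=
    AlgHom.ext fun t => (act₂_ofAlgHom j t).symm
  rw [h2] at h
  exact AlgHom.congr_fun h t

theorem reassocEquiv_toMod₃ (t : E ⊗[k] E ⊗[k] E) :
    reassocEquiv (ofAlgHom H j) (ofAlgHom H j) (ofAlgHom H j) (toMod₃ H j t) =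
      TensorProduct.assoc k _ _ _ (toMod₃ H j (map₃ j H.reassoc.val * t)) := by
  rw [reassocEquiv_apply, act₃_ofAlgHom, lmulMod₃_toMod₃]

theorem reassocEquiv_symm_toMod₃ (t : E ⊗[k] E ⊗[k] E) :
    (reassocEquiv (ofAlgHom H j) (ofAlgHom H j) (ofAlgHom H j)).symm
      (TensorProduct.assoc k _ _ _ (toMod₃ H j t)) =
        toMod₃ H j (map₃ j (H.reassoc⁻¹).val * t) := by
  rw [reassocEquiv_symm_apply, act₃_ofAlgHom, LinearEquiv.symm_apply_apply, lmulMod₃_toMod₃]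

theorem comm_toMod₂ (t : E ⊗[k] E) :
    TensorProduct.comm k _ _ (toMod₂ H j t) = toMod₂ H j (Algebra.TensorProduct.comm k _ _ t) := by
  induction t with
  | zero => simp
  | add s s' hs hs' => simp only [map_add, hs, hs']
  | tmul x y => rfl

theorem comm_toMod₃ (t : E ⊗[k] E ⊗[k] E) :
    TensorProduct.comm k _ _ (toMod₃ H j t) =
      TensorProduct.assoc k _ _ _ (toMod₃ H j (perm231 k _ t)) :=
  eq_on_tmul₃ (F := (TensorProduct.comm k _ _).toLinearMap ∘ₗ (toMod₃ H j).toLinearMap)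
    (G := (TensorProduct.assoc k _ _ _).toLinearMap ∘ₗ (toMod₃ H j).toLinearMap ∘ₗ
      (perm231 k _).toLinearMap) (fun _ _ _ => rfl) t

/-- The family of linear maps `U ⊗ E → E ⊗ U` given by an element of `A ⊗ E`. -/
def braidingOf (T : A ⊗[k] E) (U : QMod H) : U ⊗[k] ofAlgHom H j →ₗ[k] ofAlgHom H j ⊗[k] U :=
  (TensorProduct.comm k _ _).toLinearMap ∘ₗ tensorAction U.ρ (lmulMod H j) T

theorem braidingOf_nat (T : A ⊗[k] E) {U U' : QMod H} (f : U ⟶ U') (x : U ⊗[k] ofAlgHom H j) :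
    braidingOf j T U' (TensorProduct.map f.lin LinearMap.id x) =
      TensorProduct.map LinearMap.id f.lin (braidingOf j T U x) := by
  have h := LinearMap.congr_fun (map_comp_tensorAction (comm_lin f)
    (f := f.lin) (g := LinearMap.id) (σ := lmulMod H j) (σ' := lmulMod H j) (fun _ => rfl) T) x
  have h2 : ∀ y : U ⊗[k] ofAlgHom H j,
      TensorProduct.comm k _ _ (TensorProduct.map f.lin LinearMap.id y) =
        TensorProduct.map LinearMap.id f.lin (TensorProduct.comm k _ _ y) := fun y => by
    rw [TensorProduct.map_comm]
  exact (congrArg (TensorProduct.comm k _ _) h.symm).trans (h2 _)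

variable (T : A ⊗[k] E)

theorem braidingOf_act₂ (a : A) (h : T * Algebra.TensorProduct.map (AlgHom.id k A) j (H.comul a) =
      Algebra.TensorProduct.map (AlgHom.id k A) j
        (Algebra.TensorProduct.comm k A A (H.comul a)) * T) (U : QMod H)
    (x : U ⊗[k] ofAlgHom H j) :
    braidingOf j T U (act₂ U (ofAlgHom H j) (H.comul a) x) =
      act₂ (ofAlgHom H j) U (H.comul a) (braidingOf j T U x) := by
  have h1 : ∀ t, act₂ U (ofAlgHom H j) t = tensorAction U.ρ (lmulMod H j)
      (Algebra.TensorProduct.map (AlgHom.id k A) j t) := fun t =>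
    AlgHom.congr_fun (tensorAction_comp U.ρ (lmulMod H j) (AlgHom.id k A) j) t
  have h2 : ∀ (t : A ⊗[k] A) (y : U ⊗[k] ofAlgHom H j),
      act₂ (ofAlgHom H j) U t (TensorProduct.comm k _ _ y) =
        TensorProduct.comm k _ _ (act₂ U (ofAlgHom H j) (Algebra.TensorProduct.comm k A A t) y) := by
    intro t y
    induction t with
    | zero => simp
    | add s s' hs hs' => simp only [map_add, LinearMap.add_apply, hs, hs']
    | tmul a b =>
    induction y with
    | zero => simp
    | add s s' hs hs' => simp only [map_add, hs, hs']
    | tmul x y => simp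
  simp only [braidingOf, LinearMap.comp_apply, LinearEquiv.coe_coe]
  rw [h2, h1, h1, ← Module.End.mul_apply, ← Module.End.mul_apply, ← map_mul, ← map_mul, h]

theorem braidingOf_toMod₂ (t : E ⊗[k] E) :
    braidingOf j T (ofAlgHom H j) (toMod₂ H j t) = toMod₂ H j (Algebra.TensorProduct.comm k _ _
      (Algebra.TensorProduct.map j (AlgHom.id k E) T * t)) := by
  have h : tensorAction (ofAlgHom H j).ρ (lmulMod H j) T =
      lmulMod₂ H j (Algebra.TensorProduct.map j (AlgHom.id k E) T) :=
    AlgHom.congr_fun (tensorAction_comp (lmulMod H j) (lmulMod H j) j (AlgHom.id k E)) T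
  rw [braidingOf, LinearMap.comp_apply, h, lmulMod₂_toMod₂]
  exact comm_toMod₂ j _

theorem map_braidingOf_left (t : E ⊗[k] E ⊗[k] E) :
    TensorProduct.map (braidingOf j T (ofAlgHom H j)) LinearMap.id (toMod₃ H j t) =
      toMod₃ H j (perm213 k _ (leg12 k _ (Algebra.TensorProduct.map j (AlgHom.id k E) T) * t)) := by
  induction t with
  | zero => simp
  | add s s' hs hs' => simp only [map_add, mul_add, hs, hs']
  | tmul t x =>
    rw [toMod₃_tmul, TensorProduct.map_tmul, braidingOf_toMod₂, leg12,
      Algebra.TensorProduct.includeLeft_apply, Algebra.TensorProduct.tmul_mul_tmul, one_mul]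
    rfl

theorem map_braidingOf_right (t : E ⊗[k] E ⊗[k] E) :
    TensorProduct.map LinearMap.id (braidingOf j T (ofAlgHom H j))
        (TensorProduct.assoc k _ _ _ (toMod₃ H j t)) =
      TensorProduct.assoc k _ _ _
        (toMod₃ H j (perm132 k _
          (leg23 k _ (Algebra.TensorProduct.map j (AlgHom.id k E) T) * t))) := by
  induction t with
  | zero => simp
  | add s s' hs hs' => simp only [map_add, mul_add, hs, hs']
  | tmul t z =>
  induction t with
  | zero => simp
  | add s s' hs hs' => simp only [map_add, add_tmul, mul_add, hs, hs']
  | tmul x y =>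
    have h1 : TensorProduct.assoc k _ _ _ (toMod₃ H j (x ⊗ₜ y ⊗ₜ z)) =
      toMod H j x ⊗ₜ toMod₂ H j (y ⊗ₜ z) := rfl
    rw [h1, TensorProduct.map_tmul, braidingOf_toMod₂, LinearMap.id_apply]
    generalize Algebra.TensorProduct.map j (AlgHom.id k E) T = R
    induction R with
    | zero => simp
    | add s s' hs hs' => simp only [map_add, add_mul, tmul_add, hs, hs']
    | tmul r s =>
      rw [leg23_tmul, Algebra.TensorProduct.tmul_mul_tmul, Algebra.TensorProduct.tmul_mul_tmul,
        Algebra.TensorProduct.tmul_mul_tmul, one_mul]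
      rfl

theorem braidingOf_tensor {Δ : E →ₐ[k] E ⊗[k] E} (hΔ : ∀ a, Δ (j a) = map₂ j (H.comul a))
    (t : E ⊗[k] E ⊗[k] E) :
    braidingOf j T (tensor (ofAlgHom H j) (ofAlgHom H j)) (toMod₃ H j t) =
      TensorProduct.assoc k _ _ _ (toMod₃ H j (perm231 k _
        (comulLeft Δ (Algebra.TensorProduct.map j (AlgHom.id k E) T) * t))) := by
  have h1 : (act₂ (ofAlgHom H j) (ofAlgHom H j)).comp H.comul =
      (lmulMod₂ H j).comp (Δ.comp j) := AlgHom.ext fun a =>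
    (act₂_ofAlgHom j _).trans (congrArg (lmulMod₂ H j) (hΔ a).symm)
  have h2 : tensorAction ((act₂ (ofAlgHom H j) (ofAlgHom H j)).comp H.comul) (lmulMod H j) T =
      lmulMod₃ H j (comulLeft Δ (Algebra.TensorProduct.map j (AlgHom.id k E) T)) := by
    have h3 := tensorAction_comp (lmulMod₂ H j) (lmulMod H j) (Δ.comp j) (AlgHom.id k E)
    have h4 : Algebra.TensorProduct.map (Δ.comp j) (AlgHom.id k E) =
        (comulLeft Δ).comp (Algebra.TensorProduct.map j (AlgHom.id k E)) := by
      ext <;> simp [comulLeft]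
    rw [h1]
    refine (AlgHom.congr_fun h3 T).trans ?_
    rw [h4]
    rfl
  have h5 : braidingOf j T (tensor (ofAlgHom H j) (ofAlgHom H j)) (toMod₃ H j t) =
      TensorProduct.comm k _ _ (tensorAction ((act₂ (ofAlgHom H j) (ofAlgHom H j)).comp H.comul)
        (lmulMod H j) T (toMod₃ H j t)) := rfl
  rw [h5, h2, lmulMod₃_toMod₃]
  exact comm_toMod₃ j _

end QMod

end QuasiHopf
end ExtensionModule

/-! ### The half-braiding of a double extension -/

section ExtensionBraiding

open CategoryTheory MonoidalCategory TensorProduct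

namespace QuasiHopf

/-- The right hand side of the tensor axiom of a half-braiding is natural. -/
theorem hexagon_naturality {C : Type u} [Category.{v} C] [MonoidalCategory C] {V : C}
    (c : ∀ U : C, U ⊗ V ⟶ V ⊗ U)
    (naturality : ∀ {U U' : C} (f : U ⟶ U'), f ▷ V ≫ c U' = c U ≫ V ◁ f) {U U' W W' : C}
    (f : U ⟶ U') (g : W ⟶ W') :
    (f ⊗ₘ g) ▷ V ≫ (α_ U' W' V).hom ≫ U' ◁ c W' ≫ (α_ U' V W').inv ≫ c U' ▷ W' ≫
        (α_ V U' W').hom =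
      ((α_ U W V).hom ≫ U ◁ c W ≫ (α_ U V W).inv ≫ c U ▷ W ≫ (α_ V U W).hom) ≫
        V ◁ (f ⊗ₘ g) := by
  have hg : U' ◁ g ▷ V ≫ U' ◁ c W' = U' ◁ c W ≫ U' ◁ V ◁ g := by
    rw [← MonoidalCategory.whiskerLeft_comp, ← MonoidalCategory.whiskerLeft_comp, naturality]
  have hf : f ▷ V ▷ W ≫ c U' ▷ W = c U ▷ W ≫ (V ◁ f) ▷ W := by
    rw [← comp_whiskerRight, ← comp_whiskerRight, naturality]
  rw [MonoidalCategory.tensorHom_def]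
  calc
    _ = 𝟙 _ ⊗≫ f ▷ (W ⊗ V) ⊗≫ (U' ◁ g ▷ V ≫ U' ◁ c W') ⊗≫ c U' ▷ W' ⊗≫ 𝟙 _ := by monoidal
    _ = 𝟙 _ ⊗≫ (f ▷ (W ⊗ V) ≫ U' ◁ c W) ⊗≫ ((U' ⊗ V) ◁ g ≫ c U' ▷ W') ⊗≫ 𝟙 _ := by
      rw [hg]; monoidal
    _ = 𝟙 _ ⊗≫ U ◁ c W ⊗≫ (f ▷ V ▷ W ≫ c U' ▷ W) ⊗≫ (V ⊗ U') ◁ g ⊗≫ 𝟙 _ := by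
      rw [← whisker_exchange f (c W), whisker_exchange (c U') g]; monoidal
    _ = _ := by rw [hf]; monoidal

variable {k : Type} [Field k] {A : Type u} [Ring A] [Algebra k A]

theorem perm231_perm312 (t : A ⊗[k] A ⊗[k] A) : perm231 k A (perm312 k A t) = t :=
  eq_on_tmul₃ (F := (perm231 k A).toLinearMap ∘ₗ (perm312 k A).toLinearMap)
    (G := LinearMap.id) (fun _ _ _ => rfl) t

theorem perm231_perm132 (t : A ⊗[k] A ⊗[k] A) : perm231 k A (perm132 k A t) = perm213 k A t :=
  eq_on_tmul₃ (F := (perm231 k A).toLinearMap ∘ₗ (perm132 k A).toLinearMap)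
    (G := (perm213 k A).toLinearMap) (fun _ _ _ => rfl) t

theorem perm231_leg13 (t : A ⊗[k] A) : perm231 k A (leg13 k A t) = perm213 k A (leg12 k A t) := by
  induction t with
  | zero => simp
  | add s t hs ht => simp only [map_add, hs, ht]
  | tmul a b => rfl

/-- The left hexagon axiom of an R-matrix with permuted tensor factors. -/
theorem IsQuasitriangular.perm231_comulLeft {H : QuasiBialgebra k A} {R : A ⊗[k] A}
    (h : IsQuasitriangular H R) (t : A ⊗[k] A ⊗[k] A) :
    perm231 k A (comulLeft H.comul R * t) =
      H.reassoc.val * perm213 k A (leg12 k A R * ((H.reassoc⁻¹).val *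
        perm132 k A (leg23 k A R * (H.reassoc.val * t)))) := by
  have h231 : ∀ s, perm213 k A (perm132 k A s) = perm231 k A s := fun s => rfl
  rw [map_mul, h.hexagon_left]
  simp only [map_mul, h231]
  rw [perm231_perm312, perm231_perm132, perm231_leg13]
  simp only [mul_assoc]

theorem map_reassoc_inv {B : Type u} [Ring B] [Algebra k B] {H : QuasiBialgebra k A}
    {L : QuasiBialgebra k B} {j : A →ₐ[k] B} (h : IsQuasiBialgebraHom H L j) :
    map₃ j (H.reassoc⁻¹).val = (L.reassoc⁻¹).val := by
  have h1 : Units.map (map₃ j).toMonoidHom H.reassoc = L.reassoc := Units.ext h.map_reassoc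
  rw [← h1]
  rfl

namespace QMod

variable {H : QuasiBialgebra k A} {E : Type u} [Ring E] [Algebra k E] {j : A →ₐ[k] E}
  {L : QuasiBialgebra k E} (hj : IsQuasiBialgebraHom H L j) (inj : Function.Injective j)
  {T : A ⊗[k] E}
  (hT : IsQuasitriangular L (Algebra.TensorProduct.map j (AlgHom.id k E) T))

theorem mul_map_comul (hj : IsQuasiBialgebraHom H L j) (inj : Function.Injective j)
    (hT : IsQuasitriangular L (Algebra.TensorProduct.map j (AlgHom.id k E) T)) (a : A) :
    T * Algebra.TensorProduct.map (AlgHom.id k A) j (H.comul a) =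
    Algebra.TensorProduct.map (AlgHom.id k A) j
      (Algebra.TensorProduct.comm k A A (H.comul a)) * T := by
  have h1 : Function.Injective (Algebra.TensorProduct.map j (AlgHom.id k E)) :=
    Module.Flat.rTensor_preserves_injective_linearMap (M := E) j.toLinearMap inj
  have h2 : ∀ t : A ⊗[k] A, Algebra.TensorProduct.map j (AlgHom.id k E)
      (Algebra.TensorProduct.map (AlgHom.id k A) j t) = map₂ j t := by
    intro t
    induction t with
    | zero => simp
    | add s t hs ht => simp only [map_add, hs, ht]
    | tmul a b => simp
  have h3 : ∀ t : A ⊗[k] A, map₂ j (Algebra.TensorProduct.comm k A A t) =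
      Algebra.TensorProduct.comm k E E (map₂ j t) := by
    intro t
    induction t with
    | zero => simp
    | add s t hs ht => simp only [map_add, hs, ht]
    | tmul a b => simp
  apply h1
  rw [map_mul, map_mul, h2, h2, h3, ← hj.map_comul, hT.flip]

theorem tensor_ext₃ {M N P Q : QMod H} {f g : (M ⊗ N) ⊗ P ⟶ Q}
    (h : ∀ (m : M) (n : N) (p : P), f.lin (m ⊗ₜ[k] n ⊗ₜ[k] p) = g.lin (m ⊗ₜ[k] n ⊗ₜ[k] p)) :
    f = g :=
  Hom.ext (TensorProduct.ext_threefold h)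

/-- The half-braiding of the module `E` as a family of `A`-linear maps. -/
def braidingHom (U : QMod H) : U ⊗ ofAlgHom H j ⟶ ofAlgHom H j ⊗ U :=
  ⟨braidingOf j T U, fun a x => braidingOf_act₂ j T a (mul_map_comul hj inj hT a) U x⟩

theorem braidingHom_naturality {U U' : QMod H} (f : U ⟶ U') :
    f ▷ ofAlgHom H j ≫ braidingHom hj inj hT U' = braidingHom hj inj hT U ≫ ofAlgHom H j ◁ f :=
  hom_ext fun x => braidingOf_nat j T f x

theorem braidingHom_tensor_ofAlgHom :
    braidingHom hj inj hT (ofAlgHom H j ⊗ ofAlgHom H j) = (α_ _ _ _).hom ≫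
      ofAlgHom H j ◁ braidingHom hj inj hT (ofAlgHom H j) ≫ (α_ _ _ _).inv ≫
      braidingHom hj inj hT (ofAlgHom H j) ▷ ofAlgHom H j ≫ (α_ _ _ _).hom := by
  apply hom_ext
  intro x
  obtain ⟨t, rfl⟩ := (toMod₃ H j).surjective x
  change braidingOf j T (tensor (ofAlgHom H j) (ofAlgHom H j)) (toMod₃ H j t) =
    reassocEquiv _ _ _ (TensorProduct.map (braidingOf j T (ofAlgHom H j)) LinearMap.id
      ((reassocEquiv _ _ _).symm (TensorProduct.map LinearMap.id (braidingOf j T (ofAlgHom H j))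
        (reassocEquiv _ _ _ (toMod₃ H j t)))))
  rw [braidingOf_tensor j T hj.map_comul, reassocEquiv_toMod₃, map_braidingOf_right,
    reassocEquiv_symm_toMod₃, map_braidingOf_left, reassocEquiv_toMod₃, hT.perm231_comulLeft,
    map_reassoc_inv hj, hj.map_reassoc]

theorem braidingHom_tensor (U U' : QMod H) :
    braidingHom hj inj hT (U ⊗ U') = (α_ _ _ _).hom ≫
      U ◁ braidingHom hj inj hT U' ≫ (α_ _ _ _).inv ≫
      braidingHom hj inj hT U ▷ U' ≫ (α_ _ _ _).hom := by
  have nat : ∀ {U U' : QMod H} (f : U ⟶ U'), f ▷ ofAlgHom H j ≫ braidingHom hj inj hT U' =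
      braidingHom hj inj hT U ≫ ofAlgHom H j ◁ f := braidingHom_naturality hj inj hT
  -- the axiom holds for the regular module, which embeds in the module `E`
  have h1 : braidingHom hj inj hT (regular H ⊗ regular H) = (α_ _ _ _).hom ≫
      regular H ◁ braidingHom hj inj hT (regular H) ≫ (α_ _ _ _).inv ≫
      braidingHom hj inj hT (regular H) ▷ regular H ≫ (α_ _ _ _).hom := by
    let f : regular H ⟶ ofAlgHom H j := ⟨j.toLinearMap, fun a x => j.map_mul a x⟩
    have h2 := nat (f ⊗ₘ f)
    rw [braidingHom_tensor_ofAlgHom, hexagon_naturality _ nat] at h2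
    have h3 : Function.Injective (ofAlgHom H j ◁ (f ⊗ₘ f)).lin :=
      Module.Flat.lTensor_preserves_injective_linearMap (M := E) (TensorProduct.map f.lin f.lin)
        (TensorProduct.map_injective_of_flat_flat _ _ inj inj)
    apply hom_ext
    intro x
    apply h3
    exact (LinearMap.congr_fun (congrArg Hom.lin h2) x).symm
  apply tensor_ext₃
  intro x y v
  -- the orbit maps of `x` and `y` reduce the general case to the regular module
  have h2 := nat (orbit x ⊗ₘ orbit y)
  have h3 := hexagon_naturality _ nat (orbit x) (orbit y)
  rw [← h1, ← h2] at h3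
  have h5 : TensorProduct.map (TensorProduct.map (orbit x).lin (orbit y).lin) LinearMap.id
      (reg H 1 ⊗ₜ reg H 1 ⊗ₜ v) = x ⊗ₜ y ⊗ₜ v := by
    simp only [TensorProduct.map_tmul, orbit_one, LinearMap.id_apply]
  have h6 : ∀ F F' : (U ⊗ U') ⊗ ofAlgHom H j ⟶ ofAlgHom H j ⊗ (U ⊗ U'),
      (orbit x ⊗ₘ orbit y) ▷ ofAlgHom H j ≫ F = (orbit x ⊗ₘ orbit y) ▷ ofAlgHom H j ≫ F' →
        F.lin (x ⊗ₜ[k] y ⊗ₜ[k] v) = F'.lin (x ⊗ₜ[k] y ⊗ₜ[k] v) := fun F F' h =>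
    (congrArg F.lin h5.symm).trans ((LinearMap.congr_fun (congrArg Hom.lin h)
      (reg H 1 ⊗ₜ reg H 1 ⊗ₜ v)).trans (congrArg F'.lin h5))
  exact (h6 _ _ h3).symm

theorem lidEquiv_tensorAction_lmulMod (s : A ⊗[k] E) (x : unit H ⊗[k] ofAlgHom H j) :
    ridEquiv _ (TensorProduct.comm k _ _ (tensorAction (unit H).ρ (lmulMod H j) s x)) =
      lmulMod H j (Algebra.TensorProduct.lid k E
        (Algebra.TensorProduct.map H.counit (AlgHom.id k E) s)) (lidEquiv _ x) := by
  induction s with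
  | zero => simp
  | add s s' hs hs' => simp only [map_add, LinearMap.add_apply, hs, hs']
  | tmul a y =>
  induction x with
  | zero => simp
  | add s s' hs hs' => simp only [map_add, hs, hs']
  | tmul c z => simp [unit_ρ, smul_smul, mul_comm]

theorem isUnit_counit (hj : IsQuasiBialgebraHom H L j)
    (hT : IsQuasitriangular L (Algebra.TensorProduct.map j (AlgHom.id k E) T)) :
    IsUnit (Algebra.TensorProduct.lid k E
      (Algebra.TensorProduct.map H.counit (AlgHom.id k E) T)) := by
  have h : Algebra.TensorProduct.map H.counit (AlgHom.id k E) T =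
      Algebra.TensorProduct.map L.counit (AlgHom.id k E)
        (Algebra.TensorProduct.map j (AlgHom.id k E) T) := by
    have h2 : L.counit.comp j = H.counit := AlgHom.ext hj.map_counit
    rw [← AlgHom.comp_apply, ← Algebra.TensorProduct.map_comp, h2, AlgHom.id_comp]
  rw [h]
  exact (hT.isUnit.map _).map _

theorem isIso_braidingHom_unit : IsIso (braidingHom hj inj hT (𝟙_ (QMod H))) := by
  apply isIso_of_bijective
  have h1 : Function.Bijective (lmulMod H j (Algebra.TensorProduct.lid k E
      (Algebra.TensorProduct.map H.counit (AlgHom.id k E) T))) :=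
    (Module.End.isUnit_iff _).1 ((isUnit_counit hj hT).map _)
  have h2 := h1.comp (lidEquiv (ofAlgHom H j)).bijective
  have h3 : ∀ x, ridEquiv (ofAlgHom H j) ((braidingHom hj inj hT (𝟙_ (QMod H))).lin x) = _ :=
    lidEquiv_tensorAction_lmulMod T
  have h4 := (ridEquiv (ofAlgHom H j)).symm.bijective.comp h2
  refine Eq.mp (congrArg Function.Bijective (funext fun x => ?_)) h4
  exact (LinearEquiv.symm_apply_eq _).2 (h3 x).symm

/-- The half-braiding of the module `E` given by a quasitriangular element of `A ⊗ E`. -/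
def extensionBraiding : LaxHalfBraiding (ofAlgHom H j) where
  c := braidingHom hj inj hT
  naturality := braidingHom_naturality hj inj hT
  tensor := braidingHom_tensor hj inj hT
  unit := by
    have := isIso_braidingHom_unit hj inj hT
    exact unit_of_isIso _ (braidingHom_naturality hj inj hT) (braidingHom_tensor hj inj hT _ _)

end QMod

end QuasiHopf
end ExtensionBraiding

/-! ### The homomorphism from the double to an extension -/

section UniversalProperty

open CategoryTheory MonoidalCategory TensorProduct

namespace QuasiHopf

variable {k : Type} [Field k] {A : Type u} [Ring A] [Algebra k A] [FiniteDimensional k A]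

/-- The element `∑ e_μ ⊗ γ(e^μ)` of `A ⊗ E`. -/
def dualTensor {E : Type*} [Ring E] [Algebra k E] (γ : Module.Dual k A →ₗ[k] E) : A ⊗[k] E :=
  ∑ μ, Module.finBasis k A μ ⊗ₜ[k] γ ((Module.finBasis k A).coord μ)

theorem map_dualTensor {E F : Type*} [Ring E] [Algebra k E] [Ring F] [Algebra k F]
    (γ : Module.Dual k A →ₗ[k] E) (j : A →ₐ[k] F) (f : E →ₐ[k] F) :
    Algebra.TensorProduct.map j f (dualTensor γ) = rMatrix j (f.toLinearMap ∘ₗ γ) := by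
  simp [dualTensor, rMatrix]

theorem sum_smul_dual {E : Type*} [AddCommGroup E] [Module k E] (γ : Module.Dual k A →ₗ[k] E)
    (ψ : Module.Dual k A) :
    ∑ μ, ψ (Module.finBasis k A μ) • γ ((Module.finBasis k A).coord μ) = γ ψ := by
  conv_rhs => rw [← (Module.finBasis k A).sum_dual_apply_smul_coord ψ]
  simp only [map_sum, map_smul]

variable {H : QuasiHopfAlgebra k A} {E : Type u} [Ring E] [Algebra k E]
  {L : QuasiHopfAlgebra k E} {j : A →ₐ[k] E} {γ : Module.Dual k A →ₗ[k] E}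

open QMod

theorem IsDoubleExtension.quasitriangular_map (h : IsDoubleExtension H L j γ) :
    IsQuasitriangular L.toQuasiBialgebra
      (Algebra.TensorProduct.map j (AlgHom.id k E) (dualTensor γ)) := by
  rw [map_dualTensor]
  exact h.quasitriangular

/-- The object of the centre given by a double extension. -/
def extensionCenter (h : IsDoubleExtension H L j γ) : Center (QMod H.toQuasiBialgebra) :=
  (extensionBraiding h.isHom.toIsQuasiBialgebraHom h.injective h.quasitriangular_map).toCenter
    (isIso_halfBraiding _)

/-- The identification of an extension with its object of the centre. -/
def toExtension (h : IsDoubleExtension H L j γ) : E ≃ₗ[k] (extensionCenter h).1 :=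
  toMod H.toQuasiBialgebra j

theorem dualAct_toExtension (h : IsDoubleExtension H L j γ) (ψ : Module.Dual k A) (z : E) :
    dualAct (extensionCenter h) ψ (toExtension h z) = toExtension h (γ ψ * z) := by
  have h1 : dualAct (extensionCenter h) ψ (toExtension h z) =
      slice (ofAlgHom H.toQuasiBialgebra j) ψ
        (braidingOf j (dualTensor γ) (regular H.toQuasiBialgebra)
          (reg H.toQuasiBialgebra 1 ⊗ₜ toMod H.toQuasiBialgebra j z)) := rfl
  refine h1.trans ?_
  have h2 : ∀ a : A, (regular H.toQuasiBialgebra).ρ a (reg H.toQuasiBialgebra 1) =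
    reg H.toQuasiBialgebra a := regular_ρ_one
  simp only [braidingOf, dualTensor, map_sum, LinearMap.comp_apply, LinearEquiv.coe_coe,
    tensorAction_tmul, LinearMap.sum_apply, TensorProduct.map_tmul, TensorProduct.comm_tmul, h2,
    slice_tmul, lmulMod_toMod]
  conv_rhs => rw [← sum_smul_dual γ ψ, Finset.sum_mul, map_sum]
  refine Finset.sum_congr rfl fun μ _ => ?_
  rw [smul_mul_assoc, map_smul]
  rfl

theorem exists_act_toExtension (h : IsDoubleExtension H L j γ) (x : Double H) :
    ∃ y, ∀ z, act (extensionCenter h) x (toExtension h z) = toExtension h (y * z) := by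
  induction x using double_induction with
  | h₁ a => exact ⟨j a, fun z => by rw [act_inclDouble]; rfl⟩
  | h₂ ψ => exact ⟨γ ψ, fun z => by rw [act_dualInclDouble, dualAct_toExtension]⟩
  | hadd x x' hx hx' =>
    obtain ⟨y, hy⟩ := hx
    obtain ⟨y', hy'⟩ := hx'
    exact ⟨y + y', fun z => by rw [map_add, LinearMap.add_apply, hy, hy', add_mul, map_add]⟩
  | hmul x x' hx hx' =>
    obtain ⟨y, hy⟩ := hx
    obtain ⟨y', hy'⟩ := hx'
    exact ⟨y * y', fun z => by rw [map_mul, Module.End.mul_apply, hy', hy, mul_assoc]⟩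

/-- The homomorphism from the double to a double extension is given by the action of the double
on the unit of the extension. -/
def liftLin (h : IsDoubleExtension H L j γ) : Double H →ₗ[k] E :=
  (toExtension h).symm.toLinearMap ∘ₗ LinearMap.applyₗ (toExtension h 1) ∘ₗ
    (act (extensionCenter h)).toLinearMap

theorem act_toExtension (h : IsDoubleExtension H L j γ) (x : Double H) (z : E) :
    act (extensionCenter h) x (toExtension h z) = toExtension h (liftLin h x * z) := by
  obtain ⟨y, hy⟩ := exists_act_toExtension h x
  have h1 : liftLin h x = y := by
    change (toExtension h).symm (act (extensionCenter h) x (toExtension h 1)) = y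
    rw [hy, mul_one, LinearEquiv.symm_apply_apply]
  rw [hy, h1]

theorem eq_liftLin (h : IsDoubleExtension H L j γ) {x : Double H} {y : E}
    (hy : ∀ z, act (extensionCenter h) x (toExtension h z) = toExtension h (y * z)) :
    liftLin h x = y := by
  apply (toExtension h).injective
  rw [← mul_one y, ← hy, act_toExtension, mul_one]

/-- The homomorphism from the double to a double extension. -/
def lift (h : IsDoubleExtension H L j γ) : Double H →ₐ[k] E :=
  AlgHom.ofLinearMap (liftLin h) (eq_liftLin h fun z => by simp) fun x y => eq_liftLin h fun z => by
    rw [map_mul, Module.End.mul_apply, act_toExtension, act_toExtension, mul_assoc]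

theorem lift_inclDouble (h : IsDoubleExtension H L j γ) (a : A) : lift h (inclDouble H a) = j a :=
  eq_liftLin h fun z => by rw [act_inclDouble]; rfl

theorem lift_dualInclDouble (h : IsDoubleExtension H L j γ) (ψ : Module.Dual k A) :
    lift h (dualInclDouble H ψ) = γ ψ :=
  eq_liftLin h fun z => by rw [act_dualInclDouble, dualAct_toExtension]

end QuasiHopf
end UniversalProperty

/-! ### Counit identities for the reassociator and the R-matrix -/

section CounitIdentities

open CategoryTheory MonoidalCategory TensorProduct

namespace QuasiHopf

variable {k : Type} [Field k] {A : Type u} [Ring A] [Algebra k A]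

/-- `ε ⊗ id ⊗ id`. -/
def counit₁ (ε : A →ₐ[k] k) : A ⊗[k] A ⊗[k] A →ₐ[k] A ⊗[k] A :=
  Algebra.TensorProduct.map ((Algebra.TensorProduct.lid k A).toAlgHom.comp
    (Algebra.TensorProduct.map ε (AlgHom.id k A))) (AlgHom.id k A)

/-- `id ⊗ ε ⊗ id`. -/
def counit₂ (ε : A →ₐ[k] k) : A ⊗[k] A ⊗[k] A →ₐ[k] A ⊗[k] A :=
  Algebra.TensorProduct.map ((Algebra.TensorProduct.rid k k A).toAlgHom.comp
    (Algebra.TensorProduct.map (AlgHom.id k A) ε)) (AlgHom.id k A)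

@[simp] theorem counit₁_tmul (ε : A →ₐ[k] k) (a b c : A) :
    counit₁ ε (a ⊗ₜ b ⊗ₜ c) = (ε a • b) ⊗ₜ c := by simp [counit₁]

@[simp] theorem counit₂_tmul (ε : A →ₐ[k] k) (a b c : A) :
    counit₂ ε (a ⊗ₜ b ⊗ₜ c) = (ε b • a) ⊗ₜ c := by simp [counit₂]

theorem map_units_inv_eq_one {B C : Type*} [Ring B] [Ring C] [Algebra k B] [Algebra k C]
    (f : B →ₐ[k] C) {x : Bˣ} (h : f x.val = 1) : f (x⁻¹).val = 1 := by
  have h1 : Units.map f.toMonoidHom x = 1 := Units.ext h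
  have h2 := congrArg (fun y : Cˣ => (y⁻¹).val) h1
  simpa using h2

namespace QMod

variable {H : QuasiBialgebra k A}

theorem lidEquiv_act₃ {M N : QMod H} (t : A ⊗[k] A ⊗[k] A) (c : unit H) (m : M) (n : N) :
    lidEquiv (tensor M N) (TensorProduct.assoc k _ _ _ (act₃ (unit H) M N t (c ⊗ₜ m ⊗ₜ n))) =
      unitEquiv H c • act₂ M N (counit₁ H.counit t) (m ⊗ₜ n) := by
  let e : unit H ⊗[k] (M ⊗[k] N) →ₗ[k] M ⊗[k] N := (lidEquiv (tensor M N)).toLinearMap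
  have h : ∀ (x : unit H) (y : M ⊗[k] N), e (x ⊗ₜ y) = unitEquiv H x • y :=
    lidEquiv_tmul (tensor M N)
  refine eq_on_tmul₃ (M := M ⊗[k] N) (F := e ∘ₗ (TensorProduct.assoc k _ _ _).toLinearMap ∘ₗ
      LinearMap.applyₗ (c ⊗ₜ m ⊗ₜ n) ∘ₗ (act₃ (unit H) M N).toLinearMap)
    (G := unitEquiv H c • LinearMap.applyₗ (m ⊗ₜ n) ∘ₗ (act₂ M N).toLinearMap ∘ₗ
      (counit₁ H.counit).toLinearMap) (fun x y z => ?_) t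
  simp [h, unit_ρ, smul_smul, mul_comm, TensorProduct.smul_tmul']

end QMod

open QMod

/-- `(ε ⊗ id ⊗ id)(φ) = 1`: the coherence `α ≫ λ = λ ▷ _` of the monoidal category of modules,
evaluated at `1 ⊗ 1 ⊗ 1`. -/
theorem QuasiBialgebra.counit₁_reassoc (H : QuasiBialgebra k A) :
    counit₁ H.counit H.reassoc.val = 1 := by
  have h1 : (α_ (𝟙_ _) (regular H) (regular H)).hom ≫ (λ_ (regular H ⊗ regular H)).hom =
    (λ_ (regular H)).hom ▷ regular H := by simp
  have h2 := LinearMap.congr_fun (congrArg Hom.lin h1)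
    ((unitEquiv H).symm 1 ⊗ₜ reg H 1 ⊗ₜ reg H 1)
  have h3 := (lidEquiv_act₃ H.reassoc.val ((unitEquiv H).symm 1) (reg H 1) (reg H 1)).symm.trans h2
  rw [LinearEquiv.apply_symm_apply, one_smul] at h3
  have h4 : ∀ t : A ⊗[k] A, act₂ (regular H) (regular H) t (reg H 1 ⊗ₜ reg H 1) =
      TensorProduct.congr (reg H) (reg H) t := by
    intro t
    induction t with
    | zero => simp
    | add s s' hs hs' => simp only [map_add, LinearMap.add_apply, hs, hs']
    | tmul a b => rw [act₂_tmul, regular_ρ_one, regular_ρ_one]; rfl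
  rw [h4] at h3
  apply (TensorProduct.congr (reg H) (reg H)).injective
  refine h3.trans ?_
  change lidEquiv _ _ ⊗ₜ[k] reg H 1 = reg H 1 ⊗ₜ[k] reg H 1
  rw [lidEquiv_tmul, LinearEquiv.apply_symm_apply, one_smul]

/-- An R-matrix is normalized with respect to the counit: `id ⊗ ε ⊗ id` turns the right hexagon into
`R = R ((id ⊗ ε)(R) ⊗ 1)`. -/
theorem IsQuasitriangular.counit_right {H : QuasiBialgebra k A} {R : A ⊗[k] A}
    (h : IsQuasitriangular H R) :
    Algebra.TensorProduct.rid k k A (Algebra.TensorProduct.map (AlgHom.id k A) H.counit R) = 1 := by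
  have h1 : ∀ t, counit₂ H.counit (perm231 k A t) =
      Algebra.TensorProduct.comm k A A (counit₁ H.counit t) := fun t =>
    eq_on_tmul₃ (F := (counit₂ H.counit).toLinearMap ∘ₗ (perm231 k A).toLinearMap)
      (G := (Algebra.TensorProduct.comm k A A).toLinearMap ∘ₗ (counit₁ H.counit).toLinearMap)
      (fun a b c => by simp [perm231_tmul, TensorProduct.smul_tmul']) t
  have h2 : ∀ t, counit₂ H.counit (perm213 k A t) = counit₁ H.counit t := fun t =>
    eq_on_tmul₃ (F := (counit₂ H.counit).toLinearMap ∘ₗ (perm213 k A).toLinearMap)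
      (G := (counit₁ H.counit).toLinearMap) (fun a b c => by simp [perm213_tmul]) t
  have h3 : ∀ t, counit₂ H.counit (leg13 k A t) = t := by
    intro t
    induction t with
    | zero => simp
    | add s s' hs hs' => simp only [map_add, hs, hs']
    | tmul a b => simp [leg13_tmul]
  have h4 : ∀ t, counit₂ H.counit (leg12 k A t) = Algebra.TensorProduct.rid k k A
      (Algebra.TensorProduct.map (AlgHom.id k A) H.counit t) ⊗ₜ 1 := by
    intro t
    induction t with
    | zero => simp
    | add s s' hs hs' => simp only [map_add, add_tmul, hs, hs']
    | tmul a b => simp [leg12_tmul]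
  have h5 : ∀ t, counit₂ H.counit (comulRight H.comul t) = t := by
    have h6 : ∀ a (s : A ⊗[k] A), counit₂ H.counit (rebracket k A (a ⊗ₜ s)) =
        a ⊗ₜ Algebra.TensorProduct.lid k A
          (Algebra.TensorProduct.map H.counit (AlgHom.id k A) s) := by
      intro a s
      induction s with
      | zero => simp
      | add s s' hs hs' => simp only [map_add, tmul_add, hs, hs']
      | tmul b c => simp [rebracket_tmul, TensorProduct.smul_tmul']
    intro t
    induction t with
    | zero => simp
    | add s s' hs hs' => simp only [map_add, hs, hs']
    | tmul a b =>
      have h7 : comulRight H.comul (a ⊗ₜ b) = rebracket k A (a ⊗ₜ H.comul b) := rfl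
      rw [h7, h6, H.counit_left]
  have h6 := congrArg (counit₂ H.counit) h.hexagon_right
  have h7 : counit₂ H.counit (H.reassoc⁻¹).val = 1 := map_units_inv_eq_one _ H.counit_reassoc
  have h8 : counit₁ H.counit (H.reassoc⁻¹).val = 1 := map_units_inv_eq_one _ H.counit₁_reassoc
  simp only [map_mul, h1, h2, h3, h4, h5, h7, h8, H.counit₁_reassoc, map_one, mul_one, one_mul] at h6
  have h9 := h.isUnit.mul_left_cancel ((mul_one R).trans h6)
  have h10 := congrArg (fun t => Algebra.TensorProduct.rid k k A
    (Algebra.TensorProduct.map (AlgHom.id k A) H.counit t)) h9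
  simpa using h10.symm

end QuasiHopf
end CounitIdentities

/-! ### The universal property of the double -/

section UniversalPropertyCoalgebra

open TensorProduct

namespace QuasiHopf

variable {k : Type} [Field k] {A : Type u} [Ring A] [Algebra k A] [FiniteDimensional k A]

/-- A linear map `γ` on the dual space is determined by `∑ j(e_μ) ⊗ γ(e^μ)`, if `j` is
injective. -/
theorem eq_of_sum_tmul {E M : Type*} [AddCommGroup E] [Module k E] [AddCommGroup M] [Module k M]
    {j : A →ₗ[k] E} (inj : Function.Injective j) {γ γ' : Module.Dual k A →ₗ[k] M}
    (h : ∑ μ, j (Module.finBasis k A μ) ⊗ₜ[k] γ ((Module.finBasis k A).coord μ) =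
      ∑ μ, j (Module.finBasis k A μ) ⊗ₜ[k] γ' ((Module.finBasis k A).coord μ)) : γ = γ' := by
  have h1 : Function.Injective (TensorProduct.map j (LinearMap.id : M →ₗ[k] M)) :=
    Module.Flat.rTensor_preserves_injective_linearMap (M := M) j inj
  have h2 : ∑ μ, Module.finBasis k A μ ⊗ₜ[k] γ ((Module.finBasis k A).coord μ) =
      ∑ μ, Module.finBasis k A μ ⊗ₜ[k] γ' ((Module.finBasis k A).coord μ) := by
    apply h1
    simpa using h
  ext ψ
  have h3 := congrArg (fun t => TensorProduct.lid k M (TensorProduct.map ψ LinearMap.id t)) h2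
  simp only [map_sum, TensorProduct.map_tmul, LinearMap.id_apply, TensorProduct.lid_tmul] at h3
  rwa [sum_smul_dual, sum_smul_dual] at h3

variable {H : QuasiHopfAlgebra k A} {D E : Type u} [Ring D] [Algebra k D] [Ring E] [Algebra k E]
  {K : QuasiHopfAlgebra k D} {i : A →ₐ[k] D} {δ : Module.Dual k A →ₗ[k] D}
  {L : QuasiHopfAlgebra k E} {j : A →ₐ[k] E} {γ : Module.Dual k A →ₗ[k] E}

/-- The counit of `γ(ψ)` is read off from `(id ⊗ ε)(R) = 1`. -/
theorem IsDoubleExtension.counit_dual (h : IsDoubleExtension H L j γ) (ψ : Module.Dual k A) :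
    L.counit (γ ψ) = ψ 1 := by
  have h1 := h.quasitriangular.counit_right
  have h2 : L.counit.toLinearMap ∘ₗ γ = Module.Dual.eval k A 1 := by
    apply eq_of_sum_tmul (j := j.toLinearMap) h.injective
    apply (TensorProduct.rid k E).injective
    have h3 : ∑ μ, (Module.finBasis k A).repr 1 μ • j (Module.finBasis k A μ) = 1 := by
      simp only [← map_smul, ← map_sum, Module.Basis.sum_repr, map_one]
    simpa [rMatrix, h3] using h1
  exact LinearMap.congr_fun h2 ψ

theorem IsDoubleExtension.algHom_ext (h : IsDoubleExtension H K i δ) {B : Type*} [Ring B]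
    [Algebra k B] {f g : D →ₐ[k] B} (h₁ : ∀ a, f (i a) = g (i a))
    (h₂ : ∀ ψ, f (δ ψ) = g (δ ψ)) : f = g := by
  apply AlgHom.ext_of_adjoin_eq_top h.generates
  rintro _ (⟨a, rfl⟩ | ⟨ψ, rfl⟩)
  exacts [h₁ a, h₂ ψ]

theorem comulRight_rMatrix (Δ : E →ₐ[k] E ⊗[k] E) (j : A →ₐ[k] E) (γ : Module.Dual k A →ₗ[k] E) :
    comulRight Δ (rMatrix j γ) = rebracket k E (∑ μ, j (Module.finBasis k A μ) ⊗ₜ[k]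
      (Δ.toLinearMap ∘ₗ γ) ((Module.finBasis k A).coord μ)) := by
  simp [comulRight, rMatrix]

/-- An algebra homomorphism of double extensions that respects the generators is a homomorphism of
quasi-bialgebras: the hexagon axiom determines the coproduct of the generators `δ(ψ)`, and the
normalization of the R-matrix determines their counit. -/
theorem IsDoubleExtension.isQuasiBialgebraHom (hK : IsDoubleExtension H K i δ)
    (hL : IsDoubleExtension H L j γ) {f : D →ₐ[k] E} (hi : ∀ a, f (i a) = j a)
    (hδ : ∀ ψ, f (δ ψ) = γ ψ) :
    IsQuasiBialgebraHom K.toQuasiBialgebra L.toQuasiBialgebra f := by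
  have hij : f.comp i = j := AlgHom.ext hi
  have hδγ : f.toLinearMap ∘ₗ δ = γ := LinearMap.ext hδ
  have h₂ : ∀ t, map₂ f (map₂ i t) = map₂ j t := fun t => by
    rw [← hij, ← AlgHom.comp_apply, ← Algebra.TensorProduct.map_comp]
  have h₃ : ∀ t, map₃ f (map₃ i t) = map₃ j t := fun t => by
    rw [← hij, ← AlgHom.comp_apply, ← Algebra.TensorProduct.map_comp,
      ← Algebra.TensorProduct.map_comp]
  have hΦ : map₃ f K.reassoc.val = L.reassoc.val := by
    rw [← hK.isHom.map_reassoc, ← hL.isHom.map_reassoc, h₃]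
  have hΦ' : map₃ f (K.reassoc⁻¹).val = (L.reassoc⁻¹).val := by
    rw [← map_reassoc_inv hK.isHom.toIsQuasiBialgebraHom,
      ← map_reassoc_inv hL.isHom.toIsQuasiBialgebraHom, h₃]
  have hR : map₂ f (rMatrix i δ) = rMatrix j γ := by
    rw [← hij, ← hδγ]
    simp [rMatrix]
  refine ⟨fun x => ?_, fun x => ?_, hΦ⟩
  · refine AlgHom.congr_fun (φ₁ := L.comul.comp f) (φ₂ := (map₂ f).comp K.comul)
      (hK.algHom_ext (fun a => ?_) fun ψ => ?_) x
    · rw [AlgHom.comp_apply, AlgHom.comp_apply, hi, hK.isHom.map_comul, hL.isHom.map_comul]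
      exact (h₂ _).symm
    · -- both R-matrices satisfy the hexagon, and the elements `j(e_μ)` are linearly independent
      have h4 := hL.quasitriangular.hexagon_right
      rw [← hR, ← hΦ, ← hΦ', perm231_map₃, leg13_map₂, perm213_map₃, leg12_map₂, ← map_mul,
        ← map_mul, ← map_mul, ← map_mul, ← hK.quasitriangular.hexagon_right, hR,
        comulRight_rMatrix, comulRight_rMatrix, ← rebracket_map] at h4
      have h5 := (Algebra.TensorProduct.assoc k k k E E E).symm.injective h4
      have h6 : L.comul.toLinearMap ∘ₗ γ = (map₂ f).toLinearMap ∘ₗ K.comul.toLinearMap ∘ₗ δ := by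
        apply eq_of_sum_tmul (j := j.toLinearMap) hL.injective
        simp only [map_sum, Algebra.TensorProduct.map_tmul, hi] at h5
        exact h5
      have h7 := LinearMap.congr_fun h6 ψ
      rw [AlgHom.comp_apply, hδ]
      exact h7
  · refine AlgHom.congr_fun (φ₁ := L.counit.comp f) (φ₂ := K.counit)
      (hK.algHom_ext (fun a => ?_) fun ψ => ?_) x
    · rw [AlgHom.comp_apply, hi, hK.isHom.map_counit, hL.isHom.map_counit]
    · rw [AlgHom.comp_apply, hδ, hK.counit_dual, hL.counit_dual]

/-- The universal property of the double. -/
theorem isQuantumDouble_double (H : QuasiHopfAlgebra k A) :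
    IsQuantumDouble H (doubleQuasiHopf H) (inclDouble H) (dualInclDouble H) where
  toIsDoubleExtension := isDoubleExtension_double
  universal _ _ _ _ _ _ h := ⟨lift h,
    isDoubleExtension_double.isQuasiBialgebraHom h (lift_inclDouble h) (lift_dualInclDouble h),
    AlgHom.ext (lift_inclDouble h), LinearMap.ext (lift_dualInclDouble h)⟩

end QuasiHopf
end UniversalPropertyCoalgebra

/-! ### Uniqueness of the antipode -/

section AntipodeUniqueness

open TensorProduct

namespace QuasiHopf

variable {k : Type} [Field k] {A : Type u} [Ring A] [Algebra k A]

/-- The linear map `x ⊗ y ⊗ z ↦ S'(x) α y β S(z)`. -/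
def antipodeForm (S' S : A →ₗ[k] A) (α β : A) : A ⊗[k] A ⊗[k] A →ₗ[k] A :=
  LinearMap.mul' k A ∘ₗ TensorProduct.map
    (LinearMap.mul' k A ∘ₗ TensorProduct.map (LinearMap.mulRight k α ∘ₗ S')
      (LinearMap.mulRight k β)) S

theorem antipodeForm_tmul (S' S : A →ₗ[k] A) (α β x y z : A) :
    antipodeForm S' S α β (x ⊗ₜ y ⊗ₜ z) = S' x * α * (y * β) * S z := by
  simp [antipodeForm]

variable {H : QuasiBialgebra k A} {S' S : A →ₗ[k] A} {α β : A}

theorem antipodeForm_comulLeft (hS' : ∀ a b, S' (a * b) = S' b * S' a)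
    (hS : ∀ a b, S (a * b) = S b * S a)
    (hα : ∀ a, LinearMap.mul' k A (TensorProduct.map (LinearMap.mulRight k α ∘ₗ S') LinearMap.id
      (H.comul a)) = H.counit a • α) (t : A ⊗[k] A) (w : A ⊗[k] A ⊗[k] A) :
    antipodeForm S' S α β (comulLeft H.comul t * w) =
      antipodeForm S' S α β w * S (Algebra.TensorProduct.lid k A
        (Algebra.TensorProduct.map H.counit (AlgHom.id k A) t)) := by
  induction t with
  | zero => simp
  | add s t hs ht => simp only [map_add, add_mul, mul_add, hs, ht]
  | tmul b c =>
    refine eq_on_tmul₃ (F := antipodeForm S' S α β ∘ₗ LinearMap.mulLeft k _)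
      (G := LinearMap.mulRight k _ ∘ₗ antipodeForm S' S α β) (fun x y z => ?_) w
    have h1 : ∀ s : A ⊗[k] A, antipodeForm S' S α β ((s ⊗ₜ c) * (x ⊗ₜ y ⊗ₜ z)) = S' x *
        LinearMap.mul' k A (TensorProduct.map (LinearMap.mulRight k α ∘ₗ S') LinearMap.id s) *
          (y * β) * (S z * S c) := by
      intro s
      induction s with
      | zero => simp
      | add s t hs ht => simp only [map_add, add_tmul, add_mul, mul_add, hs, ht]
      | tmul p q =>
        simp only [Algebra.TensorProduct.tmul_mul_tmul, antipodeForm_tmul, hS, hS',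
          TensorProduct.map_tmul, LinearMap.mul'_apply, LinearMap.comp_apply,
          LinearMap.mulRight_apply, LinearMap.id_apply, mul_assoc]
    have h2 : comulLeft H.comul (b ⊗ₜ c) = H.comul b ⊗ₜ c := rfl
    simp only [LinearMap.comp_apply, LinearMap.mulLeft_apply, LinearMap.mulRight_apply, h2, h1, hα,
      antipodeForm_tmul]
    simp [mul_assoc]

theorem antipodeForm_comulRight (hS' : ∀ a b, S' (a * b) = S' b * S' a)
    (hS : ∀ a b, S (a * b) = S b * S a)
    (hβ : ∀ a, LinearMap.mul' k A (TensorProduct.map (LinearMap.mulRight k β) S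
      (H.comul a)) = H.counit a • β) (t : A ⊗[k] A) (w : A ⊗[k] A ⊗[k] A) :
    antipodeForm S' S α β (w * comulRight H.comul t) =
      S' (Algebra.TensorProduct.rid k k A
        (Algebra.TensorProduct.map (AlgHom.id k A) H.counit t)) * antipodeForm S' S α β w := by
  induction t with
  | zero => simp
  | add s t hs ht => simp only [map_add, add_mul, mul_add, hs, ht]
  | tmul b c =>
    refine eq_on_tmul₃ (F := antipodeForm S' S α β ∘ₗ LinearMap.mulRight k _)
      (G := LinearMap.mulLeft k _ ∘ₗ antipodeForm S' S α β) (fun x y z => ?_) w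
    have h1 : ∀ s : A ⊗[k] A, antipodeForm S' S α β ((x ⊗ₜ y ⊗ₜ z) * rebracket k A (b ⊗ₜ s)) =
        S' b * S' x * α * y *
        LinearMap.mul' k A (TensorProduct.map (LinearMap.mulRight k β) S s) * S z := by
      intro s
      induction s with
      | zero => simp
      | add s t hs ht => simp only [map_add, tmul_add, add_mul, mul_add, hs, ht]
      | tmul p q =>
        simp only [rebracket_tmul, Algebra.TensorProduct.tmul_mul_tmul, antipodeForm_tmul, hS, hS',
          TensorProduct.map_tmul, LinearMap.mul'_apply,
          LinearMap.mulRight_apply, mul_assoc]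
    have h2 : comulRight H.comul (b ⊗ₜ c) = rebracket k A (b ⊗ₜ H.comul c) := rfl
    simp only [LinearMap.comp_apply, LinearMap.mulLeft_apply, LinearMap.mulRight_apply, h2, h1, hβ,
      antipodeForm_tmul]
    simp [mul_assoc]

/-- Two antipodes with the same `α` and `β` agree if `S'(P) α Q β S(R) = 1` for the inverse
`P ⊗ Q ⊗ R` of the reassociator. -/
theorem antipode_unique (hS' : ∀ a b, S' (a * b) = S' b * S' a)
    (hS : ∀ a b, S (a * b) = S b * S a)
    (hα : ∀ a, LinearMap.mul' k A (TensorProduct.map (LinearMap.mulRight k α ∘ₗ S') LinearMap.id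
      (H.comul a)) = H.counit a • α)
    (hβ : ∀ a, LinearMap.mul' k A (TensorProduct.map (LinearMap.mulRight k β) S
      (H.comul a)) = H.counit a • β)
    (hφ : antipodeForm S' S α β (H.reassoc⁻¹).val = 1) (a : A) : S' a = S a := by
  -- apply the form to both sides of `φ⁻¹ (id ⊗ Δ)(Δ(a)) = (Δ ⊗ id)(Δ(a)) φ⁻¹`
  have h1 : (H.reassoc⁻¹).val * comulRight H.comul (H.comul a) =
      comulLeft H.comul (H.comul a) * (H.reassoc⁻¹).val := by
    rw [Units.inv_mul_eq_iff_eq_mul, ← mul_assoc, Units.eq_mul_inv_iff_mul_eq, H.quasi_coassoc]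
  have h2 := congrArg (antipodeForm S' S α β) h1
  rwa [antipodeForm_comulRight hS' hS hβ, antipodeForm_comulLeft hS' hS hα, H.counit_left,
    H.counit_right, hφ, one_mul, mul_one] at h2

end QuasiHopf
end AntipodeUniqueness

/-! ### Uniqueness of the double -/

section Uniqueness

open TensorProduct

namespace QuasiHopf

variable {k : Type} [Field k] {A : Type u} [Ring A] [Algebra k A] [FiniteDimensional k A]
variable {H : QuasiHopfAlgebra k A} {D E : Type u} [Ring D] [Algebra k D] [Ring E] [Algebra k E]
  {K : QuasiHopfAlgebra k D} {i : A →ₐ[k] D} {δ : Module.Dual k A →ₗ[k] D}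
  {L : QuasiHopfAlgebra k E} {j : A →ₐ[k] E} {γ : Module.Dual k A →ₗ[k] E}

/-- An isomorphism of double extensions respects the antipode: the antipodes agree on `A`, and the
reassociator has its entries in `A`. -/
theorem IsDoubleExtension.isQuasiHopfHom (hK : IsDoubleExtension H K i δ)
    (hL : IsDoubleExtension H L j γ) (e : D ≃ₐ[k] E) (hi : ∀ a, e (i a) = j a)
    (hδ : ∀ ψ, e (δ ψ) = γ ψ) : IsQuasiHopfHom K L e.toAlgHom := by
  have he := hK.isQuasiBialgebraHom (f := e.toAlgHom) hL hi hδ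
  have hα : e K.alpha = L.alpha := by rw [← hK.isHom.map_alpha, ← hL.isHom.map_alpha, hi]
  have hβ : e K.beta = L.beta := by rw [← hK.isHom.map_beta, ← hL.isHom.map_beta, hi]
  refine ⟨he, fun a => ?_, hα, hβ⟩
  -- the antipode of `D`, transported to `E`
  let S' : E →ₗ[k] E := e.toLinearMap ∘ₗ K.antipode.toLinearMap ∘ₗ e.symm.toLinearMap
  have hS' : ∀ x, S' (e x) = e (K.antipode x) := fun x => by simp [S']
  have hS'j : ∀ a, S' (j a) = j (H.antipode a) := fun a => by
    rw [← hi, hS', hK.isHom.map_antipode, hi]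
  have key := antipode_unique (H := L.toQuasiBialgebra) (S' := S') (S := L.antipode.toLinearMap)
    (α := L.alpha) (β := L.beta) (fun x y => ?_) L.antipode_mul (fun x => ?_) L.antipode_beta ?_
    (e a)
  · exact key.symm.trans (hS' a)
  · obtain ⟨x, rfl⟩ := e.surjective x
    obtain ⟨y, rfl⟩ := e.surjective y
    rw [← map_mul, hS', hS', hS', K.antipode_mul, map_mul]
  · obtain ⟨x, rfl⟩ := e.surjective x
    have h1 : L.comul (e x) = map₂ e.toAlgHom (K.comul x) := he.map_comul x
    have h2 : L.counit (e x) = K.counit x := he.map_counit x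
    rw [h1, h2, ← hα, ← map_smul, ← K.antipode_alpha]
    generalize K.comul x = t
    induction t with
    | zero => simp
    | add s t hs ht => simp only [map_add, hs, ht]
    | tmul p q => simp [hS']
  · rw [← map_reassoc_inv hL.isHom.toIsQuasiBialgebraHom, ← map_one j]
    have h1 := H.reassoc_inv_antipode
    have h2 := congrArg j h1
    refine Eq.trans ?_ h2
    refine eq_on_tmul₃ (F := antipodeForm S' L.antipode.toLinearMap L.alpha L.beta ∘ₗ
        (map₃ j).toLinearMap)
      (G := j.toLinearMap ∘ₗ antipodeForm H.antipode.toLinearMap H.antipode.toLinearMap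
        H.alpha H.beta) (fun x y z => ?_) _
    have h3 : ∀ a, L.antipode (j a) = j (H.antipode a) := hL.isHom.map_antipode
    change antipodeForm _ _ _ _ (j x ⊗ₜ j y ⊗ₜ j z) = j (antipodeForm _ _ _ _ _)
    rw [antipodeForm_tmul, antipodeForm_tmul, hS'j, ← hL.isHom.map_alpha, ← hL.isHom.map_beta]
    simp [h3]

/-- Two quantum doubles are isomorphic. -/
theorem IsQuantumDouble.exists_equiv (hK : IsQuantumDouble H K i δ)
    (hL : IsQuantumDouble H L j γ) :
    ∃ e : D ≃ₐ[k] E, IsQuasiHopfHom K L e.toAlgHom ∧ (∀ a, e (i a) = j a) ∧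
      ∀ ψ, e (δ ψ) = γ ψ := by
  obtain ⟨f, -, hfi, hfδ⟩ := hK.universal E L j γ hL.toIsDoubleExtension
  obtain ⟨g, -, hgj, hgγ⟩ := hL.universal D K i δ hK.toIsDoubleExtension
  have hfi' : ∀ a, f (i a) = j a := AlgHom.congr_fun hfi
  have hfδ' : ∀ ψ, f (δ ψ) = γ ψ := LinearMap.congr_fun hfδ
  have hgj' : ∀ a, g (j a) = i a := AlgHom.congr_fun hgj
  have hgγ' : ∀ ψ, g (γ ψ) = δ ψ := LinearMap.congr_fun hgγ
  let e : D ≃ₐ[k] E := AlgEquiv.ofAlgHom f g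
    (hL.toIsDoubleExtension.algHom_ext (fun a => by simp [hfi', hgj'])
      fun ψ => by simp [hfδ', hgγ'])
    (hK.toIsDoubleExtension.algHom_ext (fun a => by simp [hfi', hgj'])
      fun ψ => by simp [hfδ', hgγ'])
  exact ⟨e, hK.toIsDoubleExtension.isQuasiHopfHom hL.toIsDoubleExtension e hfi' hfδ', hfi', hfδ'⟩

/-- The map `μ` commutes with homomorphisms of extensions. -/
theorem map_muMap (f : D →ₐ[k] E) (hi : ∀ a, f (i a) = j a) (hδ : ∀ ψ, f (δ ψ) = γ ψ)
    (x : Module.Dual k A ⊗[k] A) : f (muMap H i δ x) = muMap H j γ x := by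
  induction x with
  | zero => simp
  | add x y hx hy => simp only [map_add, hx, hy]
  | tmul ψ a =>
    rw [muMap_tmul, muMap_tmul, map_mul, hi]
    congr 1
    generalize H.qRho = q
    induction q with
    | zero => simp
    | add x y hx hy => simp only [map_add, hx, hy]
    | tmul x y => simp [hi, hδ]

theorem IsQuantumDouble.muMap_bijective (hK : IsQuantumDouble H K i δ) :
    Function.Bijective (muMap H i δ) := by
  obtain ⟨e, -, hi, hδ⟩ := (isQuantumDouble_double H).exists_equiv hK
  have h : ⇑(muMap H i δ) = e ∘ muMap H (inclDouble H) (dualInclDouble H) :=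
    funext fun x => (map_muMap e.toAlgHom hi hδ x).symm
  rw [h]
  exact e.bijective.comp muMap_double_bijective

end QuasiHopf
end Uniqueness

end

theorem theoremA {G : Type u} [Ring G] [Algebra ℂ G] [FiniteDimensional ℂ G]
    (H : QuasiHopfAlgebra ℂ G) :
    -- existence
    (∃ (D : Type u) (_ : Ring D) (_ : Algebra ℂ D) (_ : FiniteDimensional ℂ D)
      (K : QuasiHopfAlgebra ℂ D) (i : G →ₐ[ℂ] D) (δ : Module.Dual ℂ G →ₗ[ℂ] D),
      IsQuantumDouble H K i δ) ∧
    -- uniqueness up to equivalence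
    (∀ (D₁ D₂ : Type u) [Ring D₁] [Algebra ℂ D₁] [Ring D₂] [Algebra ℂ D₂]
      (K₁ : QuasiHopfAlgebra ℂ D₁) (i₁ : G →ₐ[ℂ] D₁) (δ₁ : Module.Dual ℂ G →ₗ[ℂ] D₁)
      (K₂ : QuasiHopfAlgebra ℂ D₂) (i₂ : G →ₐ[ℂ] D₂) (δ₂ : Module.Dual ℂ G →ₗ[ℂ] D₂),
      IsQuantumDouble H K₁ i₁ δ₁ → IsQuantumDouble H K₂ i₂ δ₂ →
      ∃ e : D₁ ≃ₐ[ℂ] D₂, IsQuasiHopfHom K₁ K₂ e.toAlgHom ∧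
        (∀ a, e (i₁ a) = i₂ a) ∧ ∀ ψ, e (δ₁ ψ) = δ₂ ψ) ∧
    -- the map `μ` is a linear bijection
    (∀ (D : Type u) [Ring D] [Algebra ℂ D] (K : QuasiHopfAlgebra ℂ D) (i : G →ₐ[ℂ] D)
      (δ : Module.Dual ℂ G →ₗ[ℂ] D),
      IsQuantumDouble H K i δ → Function.Bijective (muMap H i δ)) :=
  ⟨⟨Double H, inferInstance, inferInstance, finiteDimensional_double, doubleQuasiHopf H,
      inclDouble H, dualInclDouble H, isQuantumDouble_double H⟩,
    fun _ _ _ _ _ _ _ _ _ _ _ _ h₁ h₂ => h₁.exists_equiv h₂,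
    fun _ _ _ _ _ _ h => h.muMap_bijective⟩
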